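/- **Conventions.** Let $G$ be a locally compact (Hausdorff) group with left Haar measure $ds$ and modular function $\Delta$, normalised by $\int_G f(s^{-1})\Delta(s)^{-1}\,ds=\int_G f(s)\,ds$. A $G$-C*-algebra $(B,\beta)$ is a C*-algebra with a strongly continuous action of $G$ by $*$-automorphisms. A $G$-equivariant Hilbert $(B,\beta)$-module $(\mathcal E,\gamma)$ is a right Hilbert $B$-module (inner product linear in the second variable, not assumed full) with a strongly continuous linear $G$-action satisfying $\langle\gamma_t\xi,\gamma_t\eta\rangle=\beta_t(\langle\xi,\eta\rangle)$ and $\gamma_t(\xi b)=\gamma_t(\xi)\beta_t(b)$; in particular $(B,\beta)$ is such a module over itself. $\mathcal L(\mathcal E)$ and $\mathcal K(\mathcal E)$ are the adjointable and the compact operators, the latter generated by the operators $|\xi\rangle\langle\eta|\colon\zeta\mapsto\xi\langle\eta,\zeta\rangle$; $G$ acts on $\mathcal K(\mathcal E)$ by $\mathrm{Ad}\,\gamma$. $L^2(G,\mathcal E)$ is the completion of $C_c(G,\mathcal E)$ for $\langle f,g\rangle=\int_G\langle f(t),g(t)\rangle\,dt$. *Crossed products.* For $\varphi\in C_c(G,\mathcal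 E)$ let $\lambda_\varphi\in\mathcal L(L^2(G,B),L^2(G,\mathcal E))$ be given on $f\in C_c(G,B)$ by $$\lambda_\varphi(f)(t)=\int_G\Delta(s)^{-1}\gamma_{t^{-1}}(\varphi(ts^{-1}))f(s)\,ds .$$ For $\mathcal E=B$ these operators generate the reduced crossed product $B\rtimes_rG\subseteq\mathcal L(L^2(G,B))$. The Hilbert $B\rtimes_rG$-module $\mathcal E\rtimes_rG$ is the closed linear span of all $\lambda_x c$ with $x\in C_c(G,\mathcal E)$, $c\in B\rtimes_rG$, with inner product $\langle S,T\rangle=S^*T$; equivalently, it is the completion of $C_c(G,\mathcal E)$ with respect to $\langle x,y\rangle(t)=\int_G\beta_{s^{-1}}(\langle x(s),y(st)\rangle)\,ds$. If $(A,\alpha)$ is a $G$-C*-algebra and $\phi\colon A\to\mathcal L(\mathcal E)$ is an equivariant $*$-homomorphism, then $A\rtimes_rG$ acts on $\mathcal E\rtimes_rG$ by the $*$-homomorphism $\Phi\colon A\rtimes_r G\to\mathcal L(\mathcal E\rtimes_r G)$ determined by $(f\cdot x)(t)=\int_G\phi(f(s))\gamma_s(x(s^{-1}t))\,ds$ for $f\in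 C_c(G,A)$, $x\in C_c(G,\mathcal E)$. *The dual module.* $\mathcal E^*=\{\xi^*:\xi\in\mathcal E\}$ is the conjugate space of $\mathcal E$, a $G$-equivariant Hilbert $\mathcal K(\mathcal E)$-module with $\langle\xi^*,\eta^*\rangle=|\xi\rangle\langle\eta|$, $\xi^*T=(T^*\xi)^*$, $\gamma_t(\xi^*)=\gamma_t(\xi)^*$, and with the equivariant left action $b\,\xi^*=(\xi b^*)^*$ of $B$; hence $B\rtimes_rG$ acts on the Hilbert $\mathcal K(\mathcal E)\rtimes_rG$-module $\mathcal E^*\rtimes_rG$. *Relatively $L^1$ subspaces.* A subspace $\mathcal R\subseteq\mathcal E$ is relatively $L^1$ if for all $\xi,\eta\in\mathcal R$ the function $k(s)=\Delta(s)^{-1/2}\langle\xi,\gamma_s(\eta)\rangle$ belongs to $L^1_\Delta(G,B)$, i.e. $k$, $\Delta^{1/2}k$ and $\Delta^{-1/2}k$ are all in $L^1(G,B)$. *The module $\mathcal F(\mathcal R)$.* A subspace $\mathcal R$ is relatively continuous if for every $\xi\in\mathcal R$ the map $C_c(G,B)\to\mathcal E$, $f\mapsto\int_G\Delta(t)^{-1/2}\gamma_{t^{-1}}(\xi)f(t)\,dt$,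 extends to an adjointable operator $|\xi\rangle\!\rangle\colon L^2(G,B)\to\mathcal E$, and $\langle\!\langle\xi|\eta\rangle\!\rangle:=|\xi\rangle\!\rangle^*|\eta\rangle\!\rangle\in B\rtimes_rG$ for all $\xi,\eta\in\mathcal R$. Then $\mathcal F(\mathcal R)$ is the Hilbert $B\rtimes_rG$-module completing $\mathcal R*C_c(G,B)$ in the inner product $\langle\!\langle\cdot|\cdot\rangle\!\rangle$, that is, the closed linear span of the operators $|\xi\rangle\!\rangle c$, $\xi\in\mathcal R$, $c\in B\rtimes_rG$, with inner product $\langle S,T\rangle=S^*T$. **Lemma.** Let $(\mathcal E,\gamma)$ be a $G$-equivariant Hilbert $(B,\beta)$-module. 1. Let $\mathcal R_{\mathcal E}\subseteq\mathcal E$ be a dense relatively $L^1$ subspace. Then $$\mathcal R_{\mathcal K}:=\operatorname{span}\{|\xi\rangle\langle\eta|:\xi\in\mathcal R_{\mathcal E},\ \eta\in\mathcal E\}$$ is a dense relatively $L^1$ subspace of $\mathcal K(\mathcal E)$; moreover, $\mathcal R_{\mathcal E}$ and $\mathcal R_{\mathcal K}$ are relatively continuous, the Hilbert module $\mathcal E^*\rtimes_rG$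 and the left action of $B\rtimes_rG$ on it described above are well defined, and $$\mathcal F(\mathcal R_{\mathcal K})\cong\mathcal F(\mathcal R_{\mathcal E})\otimes_{B\rtimes_rG}(\mathcal E^*\rtimes_rG)$$ as Hilbert $\mathcal K(\mathcal E)\rtimes_rG$-modules (interior tensor product). 2. Conversely, let $(A,\alpha)$ be a $G$-C*-algebra, let $\phi\colon A\to\mathcal L(\mathcal E)$ be a $G$-equivariant $*$-homomorphism that is nondegenerate (i.e. $\operatorname{span}\phi(A)\mathcal E$ is dense in $\mathcal E$), and let $\mathcal R_A\subseteq A$ be a dense relatively $L^1$ subspace. Then $$\mathcal R_{\mathcal E}:=\phi(\mathcal R_A)\mathcal E=\operatorname{span}\{\phi(a)\xi:a\in\mathcal R_A,\ \xi\in\mathcal E\}$$ is a dense relatively $L^1$ subspace of $\mathcal E$; moreover, $\mathcal R_A$ and $\mathcal R_{\mathcal E}$ are relatively continuous, the Hilbert module $\mathcal E\rtimes_rG$ and the left action of $A\rtimes_rG$ on it described above are well defined, and $$\mathcal F(\mathcal R_{\mathcal E})\cong\mathcal F(\mathcal R_A)\otimes_{A\rtimes_rG}(\mathcal E\rtimes_rG)$$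 as Hilbert $B\rtimes_rG$-modules. -/

import Mathlib

namespace HilbertModule

end HilbertModule

open MeasureTheory Topology UniformSpace HilbertModule
open scoped CompactlySupported TensorProduct

/-- A (right) pre-Hilbert module structure: a semi-definite `D`-valued sesquilinear form on `X`,
conjugate linear in the first variable, with a right action of `D`. -/
structure PreHilbertModule (D X : Type*) [NonUnitalCStarAlgebra D] [AddCommGroup X]
    [Module ℂ X] where
  form : X →ₗ⋆[ℂ] X →ₗ[ℂ] D
  ract : D → X →ₗ[ℂ] X
  star_form : ∀ x y, star (form x y) = form y x
  form_ract : ∀ x y d, form x (ract d y) = form x y * d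
  form_self : ∀ x, ∃ d, form x x = star d * d

/-- A right Hilbert module over the C*-algebra `B`; positivity of an element of `B` is expressed
by `∃ b, · = star b * b`. -/
class HilbertModule (B E : Type*) [NonUnitalCStarAlgebra B] [NormedAddCommGroup E]
    [NormedSpace ℂ E] extends CompleteSpace E where
  /-- the `B`-valued inner product, linear in the second variable -/
  ip : E → E → B
  /-- the right action of `B` -/
  ract : E → B → E
  ip_add_right : ∀ x y z, ip x (y + z) = ip x y + ip x z
  ip_smul_right : ∀ (c : ℂ) x y, ip x (c • y) = c • ip x y
  star_ip : ∀ x y, star (ip x y) = ip y x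
  ip_ract : ∀ x y b, ip x (ract y b) = ip x y * b
  ip_self : ∀ x, ∃ b, ip x x = star b * b
  norm_sq : ∀ x, ‖x‖ ^ 2 = ‖ip x x‖

theorem exists_star_mul_self_iff {A : Type*} [NonUnitalCStarAlgebra A] [PartialOrder A]
    [StarOrderedRing A] {a : A} : (∃ b, a = star b * b) ↔ 0 ≤ a :=
  CStarAlgebra.nonneg_iff_eq_star_mul_self.symm

namespace PreHilbertModule

variable {D X : Type*} [NonUnitalCStarAlgebra D] [AddCommGroup X] [Module ℂ X]
  (p : PreHilbertModule D X)

theorem norm_form_sq_le (x y : X) :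
    ‖p.form x y‖ ^ 2 ≤ ‖p.form x x‖ * ‖p.form y y‖ := by
  let _ := CStarAlgebra.spectralOrder D
  have _ := CStarAlgebra.spectralOrderedRing D
  set a := p.form x y with ha
  set N := ‖p.form x x‖ with hN
  have hyx : p.form y x = star a := by rw [ha, p.star_form]
  have hl : ∀ (u v : X) (d : D), p.form (p.ract d u) v = star d * p.form u v := by
    intro u v d
    rw [← p.star_form v, p.form_ract, star_mul, p.star_form]
  have key : ∀ t : ℝ, (2 * t - t ^ 2 * N) • (star a * a) ≤ p.form y y := by
    intro t
    have h0 : 0 ≤ p.form ((t : ℂ) • p.ract a x - y) ((t : ℂ) • p.ract a x - y) :=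
      exists_star_mul_self_iff.1 (p.form_self _)
    have h1 : p.form ((t : ℂ) • p.ract a x - y) ((t : ℂ) • p.ract a x - y)
        = (t ^ 2) • (star a * p.form x x * a) - (2 * t) • (star a * a) + p.form y y := by
      simp only [map_sub, map_smulₛₗ, LinearMap.sub_apply, LinearMap.smul_apply, p.form_ract, hl,
        hyx, Complex.conj_ofReal, mul_assoc, ← ha, RingHom.id_apply]
      simp only [Complex.coe_smul, smul_sub]
      rw [pow_two, two_mul, mul_smul, add_smul]
      abel
    have hxx : (0 : D) ≤ p.form x x := exists_star_mul_self_iff.1 (p.form_self _)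
    have h2 : star a * p.form x x * a ≤ N • (star a * a) :=
      CStarAlgebra.star_left_conjugate_le_norm_smul
    have h3 : (t ^ 2) • (star a * p.form x x * a) ≤ (t ^ 2) • (N • (star a * a)) :=
      smul_le_smul_of_nonneg_left h2 (sq_nonneg t)
    rw [h1] at h0
    have h4 : 0 ≤ (t ^ 2) • (N • (star a * a)) - (2 * t) • (star a * a) + p.form y y :=
      h0.trans (by gcongr)
    rw [sub_smul, ← sub_nonneg]
    rw [smul_smul] at h4
    convert h4 using 1
    abel
  have hN0 : 0 ≤ N := norm_nonneg _
  have key2 : ∀ ε > 0, ‖a‖ ^ 2 ≤ (N + ε) * ‖p.form y y‖ := by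
    intro ε hε
    have hpos : 0 < N + ε := by positivity
    have hk := key (N + ε)⁻¹
    set t := (N + ε)⁻¹ with ht
    have htpos : 0 < t := inv_pos.2 hpos
    have h5 : t ≤ 2 * t - t ^ 2 * N := by
      have : t * N ≤ 1 := by
        rw [ht, inv_mul_le_iff₀ hpos]; linarith
      nlinarith
    have h6 : ‖(2 * t - t ^ 2 * N) • (star a * a)‖ ≤ ‖p.form y y‖ :=
      CStarAlgebra.norm_le_norm_of_nonneg_of_le
        (smul_nonneg (htpos.le.trans h5) (star_mul_self_nonneg a)) hk
    rw [norm_smul, CStarRing.norm_star_mul_self, Real.norm_of_nonneg (htpos.le.trans h5)] at h6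
    have h7 : t * (‖a‖ * ‖a‖) ≤ ‖p.form y y‖ :=
      (mul_le_mul_of_nonneg_right h5 (by positivity)).trans h6
    rw [ht, inv_mul_le_iff₀ hpos] at h7
    rwa [pow_two]
  have hc : Filter.Tendsto (fun ε : ℝ => (N + ε) * ‖p.form y y‖) (𝓝[>] 0)
      (𝓝 ((N + 0) * ‖p.form y y‖)) :=
    ((continuous_const.add continuous_id).mul continuous_const).continuousWithinAt.tendsto
  rw [add_zero] at hc
  exact ge_of_tendsto hc (eventually_mem_nhdsWithin.mono fun ε hε => key2 ε hε)

theorem norm_form_le (x y : X) :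
    ‖p.form x y‖ ≤ √‖p.form x x‖ * √‖p.form y y‖ := by
  rw [← Real.sqrt_mul (norm_nonneg _)]
  exact Real.le_sqrt_of_sq_le (p.norm_form_sq_le x y)

/-- The seminorm `x ↦ ‖form x x‖ ^ (1/2)`. -/
noncomputable def seminorm : Seminorm ℂ X :=
  Seminorm.of (fun x => √‖p.form x x‖)
    (fun x y => by
      apply Real.sqrt_le_iff.2 ⟨by positivity, ?_⟩
      have h : p.form (x + y) (x + y)
          = p.form x x + p.form x y + p.form y x + p.form y y := by
        simp only [map_add, LinearMap.add_apply]; abel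
      have h1 := p.norm_form_le x y
      have h2 := p.norm_form_le y x
      have e1 := Real.sq_sqrt (norm_nonneg (p.form x x))
      have e2 := Real.sq_sqrt (norm_nonneg (p.form y y))
      calc ‖p.form (x + y) (x + y)‖
          ≤ ‖p.form x x‖ + ‖p.form x y‖ + ‖p.form y x‖ + ‖p.form y y‖ := by
            rw [h]; exact norm_add₄_le
        _ ≤ (√‖p.form x x‖ + √‖p.form y y‖) ^ 2 := by nlinarith)
    (fun c x => by
      have h : p.form (c • x) (c • x) = (star c * c) • p.form x x := by
        simp only [map_smulₛₗ, LinearMap.smul_apply, smul_smul, RingHom.id_apply]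
        rw [mul_comm]; rfl
      rw [h, norm_smul, CStarRing.norm_star_mul_self, Real.sqrt_mul (by positivity),
        Real.sqrt_mul_self (norm_nonneg _)])

/-- The vector space `X` with the seminorm `‖x‖ = ‖form x x‖ ^ (1/2)`. -/
@[nolint unusedArguments]
def Space (_ : PreHilbertModule D X) : Type _ := X

noncomputable instance : SeminormedAddCommGroup p.Space :=
  let _ : AddCommGroup p.Space := inferInstanceAs (AddCommGroup X)
  p.seminorm.toAddGroupSeminorm.toSeminormedAddCommGroup

noncomputable instance : NormedSpace ℂ p.Space :=
  let m : Module ℂ p.Space := inferInstanceAs (Module ℂ X)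
  { m with norm_smul_le := fun c x => (p.seminorm.smul' c x).le }

/-- The form, on the seminormed space `p.Space`. -/
def form' : p.Space →ₗ⋆[ℂ] p.Space →ₗ[ℂ] D := p.form

theorem norm_form'_le (x y : p.Space) : ‖p.form' x y‖ ≤ ‖x‖ * ‖y‖ := p.norm_form_le x y

theorem norm_sq_eq (x : p.Space) : ‖x‖ ^ 2 = ‖p.form' x x‖ :=
  Real.sq_sqrt (norm_nonneg (p.form x x))

theorem continuous_form' : Continuous fun z : p.Space × p.Space => p.form' z.1 z.2 := by
  have : Continuous fun z : p.Space × p.Space =>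
      (LinearMap.mkContinuous₂ p.form' 1 fun x y => by
        simpa using p.norm_form'_le x y) z.1 z.2 := by fun_prop
  exact this

/-- The right action, on the seminormed space `p.Space`. -/
def ract' (d : D) : p.Space →ₗ[ℂ] p.Space := p.ract d

theorem form'_ract' (x y : p.Space) (d : D) : p.form' x (p.ract' d y) = p.form' x y * d :=
  p.form_ract x y d

theorem star_form' (x y : p.Space) : star (p.form' x y) = p.form' y x := p.star_form x y

theorem continuous_ract' (d : D) : Continuous (p.ract' d) := by
  refine (LinearMap.mkContinuous (p.ract' d) ‖d‖ fun x => ?_).continuous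
  have h : p.form' (p.ract' d x) (p.ract' d x) = star d * p.form' x x * d := by
    rw [form'_ract', ← star_form', form'_ract', star_mul, star_form']
  refine le_of_sq_le_sq ?_ (by positivity)
  rw [norm_sq_eq, h, mul_pow, norm_sq_eq]
  calc ‖star d * p.form' x x * d‖ ≤ ‖star d‖ * ‖p.form' x x‖ * ‖d‖ := norm_mul₃_le
    _ = ‖d‖ ^ 2 * ‖p.form' x x‖ := by rw [norm_star]; ring

/-- The Hilbert module completion of a pre-Hilbert module (elements of length zero are divided
out). -/
abbrev Hilbert : Type _ := Completion p.Space

/-- The canonical map of a pre-Hilbert module to its completion. -/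
noncomputable def toHilbert : X →ₗ[ℂ] p.Hilbert :=
  (Completion.toComplₗᵢ (𝕜 := ℂ) (E := p.Space)).toLinearMap

noncomputable def ipC (x y : p.Hilbert) : D :=
  ((Completion.isDenseInducing_coe (α := p.Space)).prodMap
    (Completion.isDenseInducing_coe (α := p.Space))).extend
      (fun z : p.Space × p.Space => p.form' z.1 z.2) (x, y)

theorem ipC_coe (x y : p.Space) : p.ipC (x : p.Hilbert) (y : p.Hilbert) = p.form' x y :=
  (Completion.isDenseInducing_coe.prodMap Completion.isDenseInducing_coe).extend_eq
    p.continuous_form' (x, y)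

theorem continuous_ipC : Continuous fun z : p.Hilbert × p.Hilbert => p.ipC z.1 z.2 := by
  let f : p.Space →+ p.Space →+ D :=
    { toFun := fun x => (p.form' x).toAddMonoidHom
      map_zero' := by ext x; simp
      map_add' := fun x y => by ext z; simp }
  have : Continuous fun z : p.Space × p.Space => f z.1 z.2 := p.continuous_form'
  exact (Completion.isDenseInducing_toCompl p.Space).extend_Z_bilin
    (Completion.isDenseInducing_toCompl p.Space) this

theorem continuous_ipC' {T : Type*} [TopologicalSpace T] {f g : T → p.Hilbert}
    (hf : Continuous f) (hg : Continuous g) : Continuous fun t => p.ipC (f t) (g t) :=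
  p.continuous_ipC.comp (hf.prodMk hg)

noncomputable instance : HilbertModule D p.Hilbert where
  ip := p.ipC
  ract x d := Completion.map (p.ract' d) x
  ip_add_right x y z := by
    induction x, y, z using Completion.induction_on₃ with
    | hp => exact isClosed_eq (p.continuous_ipC' (by fun_prop) (by fun_prop))
              ((p.continuous_ipC' (by fun_prop) (by fun_prop)).add
                (p.continuous_ipC' (by fun_prop) (by fun_prop)))
    | ih x y z => rw [← Completion.coe_add]; simp only [ipC_coe, map_add]
  ip_smul_right c x y := by
    induction x, y using Completion.induction_on₂ with
    | hp => exact isClosed_eq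
              (p.continuous_ipC' continuous_fst ((continuous_const_smul c).comp continuous_snd))
              ((continuous_const_smul c).comp (p.continuous_ipC' continuous_fst continuous_snd))
    | ih x y => rw [← Completion.coe_smul]; simp only [ipC_coe, map_smul]
  star_ip x y := by
    induction x, y using Completion.induction_on₂ with
    | hp => exact isClosed_eq (p.continuous_ipC' (by fun_prop) (by fun_prop)).star
              (p.continuous_ipC' (by fun_prop) (by fun_prop))
    | ih x y => simp only [ipC_coe, star_form']
  ip_ract x y d := by
    have hu : UniformContinuous (p.ract' d) :=
      uniformContinuous_addMonoidHom_of_continuous (p.continuous_ract' d)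
    induction x, y using Completion.induction_on₂ with
    | hp => exact isClosed_eq (p.continuous_ipC' (by fun_prop)
              (Completion.continuous_map.comp continuous_snd))
              ((p.continuous_ipC' (by fun_prop) (by fun_prop)).mul continuous_const)
    | ih x y => rw [Completion.map_coe hu]; simp only [ipC_coe, form'_ract']
  ip_self x := by
    let _ := CStarAlgebra.spectralOrder D
    have _ := CStarAlgebra.spectralOrderedRing D
    simp only [exists_star_mul_self_iff]
    induction x using Completion.induction_on with
    | hp => exact CStarAlgebra.isClosed_nonneg.preimage
              (p.continuous_ipC' continuous_id continuous_id)
    | ih x => rw [ipC_coe]; exact exists_star_mul_self_iff.1 (p.form_self x)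
  norm_sq x := by
    induction x using Completion.induction_on with
    | hp => exact isClosed_eq (by fun_prop)
              (p.continuous_ipC' continuous_id continuous_id).norm
    | ih x => rw [ipC_coe, Completion.norm_coe, norm_sq_eq]

end PreHilbertModule

namespace HilbertModule

section Basic

variable {B E : Type*} [NonUnitalCStarAlgebra B] [NormedAddCommGroup E] [NormedSpace ℂ E]
  [HilbertModule B E]

theorem ip_add_left (x y z : E) : ip (x + y) z = (ip x z + ip y z : B) := by
  rw [← star_ip, ip_add_right, star_add, star_ip, star_ip]

theorem ip_smul_left (c : ℂ) (x y : E) : ip (c • x) y = (star c • ip x y : B) := by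
  rw [← star_ip, ip_smul_right, star_smul, star_ip]

theorem ip_ract_left (x y : E) (b : B) : ip (ract x b) y = star b * ip x y := by
  rw [← star_ip, ip_ract, star_mul, star_ip]

/-- The inner product as a sesquilinear map. -/
def ipₗ : E →ₗ⋆[ℂ] E →ₗ[ℂ] B :=
  LinearMap.mk₂'ₛₗ (starRingEnd ℂ) (RingHom.id ℂ) ip ip_add_left ip_smul_left ip_add_right
    ip_smul_right

theorem ipₗ_apply (x y : E) : (ipₗ x y : B) = ip x y := rfl

theorem ip_zero_right (x : E) : (ip x 0 : B) = 0 := (ipₗ x : E →ₗ[ℂ] B).map_zero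

theorem ip_zero_left (x : E) : (ip 0 x : B) = 0 := by rw [← star_ip, ip_zero_right, star_zero]

theorem ip_sub_right (x y z : E) : (ip x (y - z) : B) = ip x y - ip x z :=
  (ipₗ x : E →ₗ[ℂ] B).map_sub y z

variable (B) in
theorem ext_ip {x y : E} (h : ∀ z, (ip z x : B) = ip z y) : x = y := by
  have h0 : (ip (x - y) (x - y) : B) = 0 := by rw [ip_sub_right, h, sub_self]
  have h1 : ‖x - y‖ ^ 2 = 0 := by rw [norm_sq (B := B), h0, norm_zero]
  exact sub_eq_zero.1 (norm_eq_zero.1 (pow_eq_zero_iff two_ne_zero |>.1 h1))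

/-- The right action of a fixed element, as a linear map. -/
def ractₗ (b : B) : E →ₗ[ℂ] E where
  toFun x := ract x b
  map_add' x y := ext_ip B fun z => by
    rw [ip_ract, ip_add_right, ip_add_right, ip_ract, ip_ract, add_mul]
  map_smul' c x := ext_ip B fun z => by
    rw [RingHom.id_apply, ip_ract, ip_smul_right, ip_smul_right, ip_ract, smul_mul_assoc]

variable (B E) in
/-- A Hilbert module, regarded as a pre-Hilbert module. -/
def toPre : PreHilbertModule B E where
  form := ipₗ
  ract := ractₗ
  star_form := star_ip
  form_ract := ip_ract
  form_self := ip_self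

theorem norm_eq_sqrt (x : E) : ‖x‖ = √‖(ip x x : B)‖ := by
  rw [← norm_sq, Real.sqrt_sq (norm_nonneg x)]

variable (B) in
theorem norm_ip_le (x y : E) : ‖(ip x y : B)‖ ≤ ‖x‖ * ‖y‖ := by
  rw [norm_eq_sqrt (B := B) x, norm_eq_sqrt (B := B) y]
  exact (toPre B E).norm_form_le x y

theorem continuous_ip : Continuous fun z : E × E => (ip z.1 z.2 : B) := by
  have : Continuous fun z : E × E =>
      (LinearMap.mkContinuous₂ (ipₗ : E →ₗ⋆[ℂ] E →ₗ[ℂ] B) 1 fun x y => by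
        simpa [ipₗ_apply] using norm_ip_le B x y) z.1 z.2 := by fun_prop
  exact this

theorem norm_ract_le (x : E) (b : B) : ‖ract x b‖ ≤ ‖x‖ * ‖b‖ := by
  refine le_of_sq_le_sq ?_ (by positivity)
  rw [norm_sq (B := B), ip_ract, ip_ract_left, mul_pow, norm_sq (B := B)]
  calc ‖star b * ip x x * b‖ ≤ ‖star b‖ * ‖(ip x x : B)‖ * ‖b‖ := norm_mul₃_le
    _ = ‖(ip x x : B)‖ * ‖b‖ ^ 2 := by rw [norm_star]; ring

theorem continuous_ract (b : B) : Continuous fun x : E => ract x b :=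
  ((ractₗ b : E →ₗ[ℂ] E).mkContinuous ‖b‖ fun x =>
    (norm_ract_le x b).trans_eq (mul_comm _ _)).continuous

/-- A C*-algebra as a right Hilbert module over itself: `⟨x, y⟩ = x⋆ y`. -/
instance self (A : Type*) [NonUnitalCStarAlgebra A] : HilbertModule A A where
  ip x y := star x * y
  ract x a := x * a
  ip_add_right _ _ _ := mul_add _ _ _
  ip_smul_right _ _ _ := mul_smul_comm _ _ _
  star_ip _ _ := by rw [star_mul, star_star]
  ip_ract _ _ _ := (mul_assoc _ _ _).symm
  ip_self x := ⟨x, rfl⟩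
  norm_sq x := by rw [CStarRing.norm_star_mul_self, pow_two]

end Basic

section Adjointable

variable (B : Type*) [NonUnitalCStarAlgebra B]
variable (H K M : Type*) [NormedAddCommGroup H] [NormedSpace ℂ H] [HilbertModule B H]
  [NormedAddCommGroup K] [NormedSpace ℂ K] [HilbertModule B K]
  [NormedAddCommGroup M] [NormedSpace ℂ M] [HilbertModule B M]

variable {H K M} in
/-- `S` is an adjoint of `T`. -/
def IsAdjoint (T : H →L[ℂ] K) (S : K →L[ℂ] H) : Prop :=
  ∀ x y, (ip (T x) y : B) = ip x (S y)

variable {H K M} in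
theorem IsAdjoint.symm {T : H →L[ℂ] K} {S : K →L[ℂ] H} (h : IsAdjoint B T S) :
    IsAdjoint B S T := fun x y => by rw [← star_ip, ← h, star_ip]

variable {H K M} in
theorem IsAdjoint.unique {T : H →L[ℂ] K} {S S' : K →L[ℂ] H} (h : IsAdjoint B T S)
    (h' : IsAdjoint B T S') : S = S' :=
  ContinuousLinearMap.ext fun y => ext_ip B fun z => by rw [← h, ← h']

variable {H K M} in
theorem IsAdjoint.norm_le {T : H →L[ℂ] K} {S : K →L[ℂ] H} (h : IsAdjoint B T S) :
    ‖S‖ ≤ ‖T‖ := by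
  refine S.opNorm_le_bound (norm_nonneg _) fun y => ?_
  have h1 : ‖S y‖ * ‖S y‖ ≤ ‖T‖ * ‖y‖ * ‖S y‖ := by
    rw [← pow_two, norm_sq (B := B), ← h]
    refine (norm_ip_le B _ _).trans ?_
    have := T.le_opNorm (S y)
    nlinarith [norm_nonneg y, norm_nonneg (S y)]
  rcases (norm_nonneg (S y)).eq_or_lt with h0 | h0
  · rw [← h0]; positivity
  · exact le_of_mul_le_mul_right h1 h0

variable {H K M} in
theorem IsAdjoint.comp {T : H →L[ℂ] K} {S : K →L[ℂ] H} {T' : K →L[ℂ] M} {S' : M →L[ℂ] K}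
    (h : IsAdjoint B T S) (h' : IsAdjoint B T' S') : IsAdjoint B (T'.comp T) (S.comp S') :=
  fun x y => by
    rw [ContinuousLinearMap.comp_apply, ContinuousLinearMap.comp_apply, h', h]

/-- The Banach space `L(H, K)` of adjointable operators between Hilbert `B`-modules. -/
def adjointable : Submodule ℂ (H →L[ℂ] K) where
  carrier := {T | ∃ S, IsAdjoint B T S}
  zero_mem' := ⟨0, fun x y => by simp [ip_zero_left, ip_zero_right]⟩
  add_mem' := by
    rintro T T' ⟨S, h⟩ ⟨S', h'⟩
    exact ⟨S + S', fun x y => by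
      simp only [add_apply, ip_add_left, ip_add_right, h x y, h' x y]⟩
  smul_mem' := by
    rintro c T ⟨S, h⟩
    refine ⟨star c • S, fun x y => ?_⟩
    simp only [smul_apply, ip_smul_left, ip_smul_right, h x y]

variable {H K M} in
/-- The adjoint of an adjointable operator. -/
noncomputable def adj (T : adjointable B H K) : adjointable B K H :=
  ⟨T.2.choose, T.1, T.2.choose_spec.symm⟩

variable {H K M}

theorem isAdjoint_adj (T : adjointable B H K) : IsAdjoint B T.1 (adj B T).1 := T.2.choose_spec

theorem adj_eq {T : adjointable B H K} {S : adjointable B K H} (h : IsAdjoint B T.1 S.1) :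
    adj B T = S := Subtype.ext ((isAdjoint_adj B T).unique B h)

theorem norm_adj (T : adjointable B H K) : ‖adj B T‖ = ‖T‖ :=
  le_antisymm ((isAdjoint_adj B T).norm_le B) ((isAdjoint_adj B T).symm B |>.norm_le B)

theorem adj_adj (T : adjointable B H K) : adj B (adj B T) = T :=
  adj_eq B (isAdjoint_adj B T).symm

theorem adj_add (S T : adjointable B H K) : adj B (S + T) = adj B S + adj B T :=
  adj_eq B fun x y => by
    have h1 := isAdjoint_adj B S x y
    have h2 := isAdjoint_adj B T x y
    simp only [Submodule.coe_add, add_apply, ip_add_left, ip_add_right, h1, h2]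

theorem adj_smul (c : ℂ) (T : adjointable B H K) : adj B (c • T) = star c • adj B T :=
  adj_eq B fun x y => by
    have h1 := isAdjoint_adj B T x y
    simp only [Submodule.coe_smul, smul_apply, ip_smul_left, ip_smul_right, h1]

theorem adj_sub (S T : adjointable B H K) : adj B (S - T) = adj B S - adj B T :=
  adj_eq B fun x y => by
    have h1 := isAdjoint_adj B S x y
    have h3 : ∀ z, (ip (T.1 z) y : B) = ip z ((adj B T).1 y) :=
      fun z => isAdjoint_adj B T z y
    rw [← star_ip]
    simp only [Submodule.coe_sub, sub_apply, ip_sub_right, star_sub, star_ip, h1, h3]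

theorem uniformContinuous_adj :
    UniformContinuous (adj B : adjointable B H K → adjointable B K H) := by
  refine (LipschitzWith.of_dist_le_mul (K := 1) fun S T => ?_).uniformContinuous
  rw [dist_eq_norm, dist_eq_norm, ← adj_sub, NNReal.coe_one, one_mul]
  exact (norm_adj B (S - T)).le

variable (H K) in
theorem isClosed_adjointable : IsClosed (adjointable B H K : Set (H →L[ℂ] K)) := by
  have : CompleteSpace H := HilbertModule.toCompleteSpace B
  refine isClosed_of_closure_subset fun T hT => ?_
  obtain ⟨u, hu, hlim⟩ := mem_closure_iff_seq_limit.1 hT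
  have hc : CauchySeq fun n => (adj B (⟨u n, hu n⟩ : adjointable B H K)) := by
    have hc0 : CauchySeq fun n => (⟨u n, hu n⟩ : adjointable B H K) := by
      have := hlim.cauchySeq
      rw [Metric.cauchySeq_iff] at this ⊢
      exact this
    exact (uniformContinuous_adj B).comp_cauchySeq hc0
  have hc' : CauchySeq fun n => (adj B (⟨u n, hu n⟩ : adjointable B H K)).1 := by
    rw [Metric.cauchySeq_iff] at hc ⊢
    exact hc
  obtain ⟨S, hS⟩ := cauchySeq_tendsto_of_complete hc'
  refine ⟨S, fun x y => ?_⟩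
  have h1 : Filter.Tendsto (fun n => (ip (u n x) y : B)) Filter.atTop (𝓝 (ip (T x) y)) :=
    ((continuous_ip (B := B)).comp (Continuous.prodMk
      (ContinuousLinearMap.apply ℂ K x).continuous continuous_const)).continuousAt.tendsto.comp hlim
  have h2 : Filter.Tendsto (fun n => (ip x ((adj B (⟨u n, hu n⟩ : adjointable B H K)).1 y) : B))
      Filter.atTop (𝓝 (ip x (S y))) :=
    ((continuous_ip (B := B)).comp (Continuous.prodMk continuous_const
      (ContinuousLinearMap.apply ℂ H y).continuous)).continuousAt.tendsto.comp hS
  refine tendsto_nhds_unique h1 (h2.congr fun n => ?_)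
  exact (isAdjoint_adj B (⟨u n, hu n⟩ : adjointable B H K) x y).symm

instance : CompleteSpace (adjointable B H K) := by
  have : CompleteSpace K := HilbertModule.toCompleteSpace B
  exact (isClosed_adjointable B H K).completeSpace_coe

/-- Composition of adjointable operators. -/
def compA (T : adjointable B K M) (S : adjointable B H K) : adjointable B H M :=
  ⟨T.1.comp S.1, by
    obtain ⟨T', hT⟩ := T.2
    obtain ⟨S', hS⟩ := S.2
    exact ⟨_, hS.comp B hT⟩⟩

theorem norm_mul_norm_le (T : adjointable B H K) :
    ‖T‖ * ‖T‖ ≤ ‖compA B (adj B T) T‖ := by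
  set Q := (compA B (adj B T) T).1 with hQ
  have h : ‖T.1‖ ≤ √‖Q‖ := by
    refine T.1.opNorm_le_bound (Real.sqrt_nonneg _) fun x => ?_
    refine le_of_sq_le_sq ?_ (by positivity)
    rw [norm_sq (B := B), isAdjoint_adj B T, mul_pow, Real.sq_sqrt (norm_nonneg _)]
    refine (norm_ip_le B _ _).trans ?_
    have : ‖(adj B T).1 (T.1 x)‖ ≤ ‖Q‖ * ‖x‖ := Q.le_opNorm x
    nlinarith [norm_nonneg x]
  calc ‖T‖ * ‖T‖ ≤ √‖Q‖ * √‖Q‖ := mul_self_le_mul_self (norm_nonneg _) h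
    _ = ‖Q‖ := Real.mul_self_sqrt (norm_nonneg _)

variable (H) in
/-- The C*-algebra `L(H)` of adjointable operators on a Hilbert `B`-module. -/
def adjointableEnd : Subalgebra ℂ (H →L[ℂ] H) where
  carrier := adjointable B H H
  add_mem' := (adjointable B H H).add_mem
  mul_mem' := fun {T S} hT hS => (compA B ⟨T, hT⟩ ⟨S, hS⟩).2
  algebraMap_mem' c := by
    rw [Algebra.algebraMap_eq_smul_one]
    exact (adjointable B H H).smul_mem c ⟨1, fun _ _ => rfl⟩

noncomputable instance : CStarAlgebra (adjointableEnd B H) where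
  star T := (adj B (T : adjointable B H H) : adjointable B H H)
  star_involutive T := adj_adj B (T : adjointable B H H)
  star_mul S T := adj_eq B ((isAdjoint_adj B (T : adjointable B H H)).comp B
    (isAdjoint_adj B (S : adjointable B H H)))
  star_add S T := adj_add B (S : adjointable B H H) (T : adjointable B H H)
  star_smul c T := adj_smul B c (T : adjointable B H H)
  complete := (inferInstance : CompleteSpace (adjointable B H H)).complete
  norm_mul_self_le T := norm_mul_norm_le B (T : adjointable B H H)

end Adjointable

end HilbertModule

section Positivity

/-- A positive element of a closed *-subalgebra has the form `b⋆ b` with `b` in the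
subalgebra. -/
theorem exists_mem_star_mul_self {A : Type*} [NonUnitalCStarAlgebra A]
    (C : NonUnitalStarSubalgebra ℂ A) [hC : IsClosed (C : Set A)] {a : A} (ha : a ∈ C)
    (hpos : ∃ b, a = star b * b) : ∃ b ∈ C, a = star b * b := by
  let _ := CStarAlgebra.spectralOrder A
  have _ := CStarAlgebra.spectralOrderedRing A
  have h0 : 0 ≤ a := exists_star_mul_self_iff.1 hpos
  refine ⟨cfcₙ Real.sqrt a, cfcₙ_mem (𝕜' := ℂ) Real.sqrt ha, ?_⟩
  rw [← cfcₙ_star, ← cfcₙ_mul ..]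
  conv_lhs => rw [← cfcₙ_id' ℝ a]
  refine cfcₙ_congr fun x hx => ?_
  exact (Real.mul_self_sqrt (quasispectrum_nonneg_of_nonneg a h0 x hx)).symm

/-- A criterion for positivity of `a` through a separating family of positive additive maps. -/
theorem exists_star_mul_self_of_family {A D ι : Type*} [NonUnitalCStarAlgebra A]
    [NonUnitalCStarAlgebra D] (f : ι → A →+ D)
    (hf : ∀ i c, ∃ d, f i (star c * c) = star d * d)
    (h0 : ∀ c, (∀ i, f i (star c * c) = 0) → c = 0) {a : A} (ha : IsSelfAdjoint a)
    (h : ∀ i c, ∃ d, f i (star c * a * c) = star d * d) : ∃ b, a = star b * b := by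
  let _ := CStarAlgebra.spectralOrder A
  have _ := CStarAlgebra.spectralOrderedRing A
  let _ := CStarAlgebra.spectralOrder D
  have _ := CStarAlgebra.spectralOrderedRing D
  simp only [exists_star_mul_self_iff] at hf h ⊢
  set n := a⁻ with hn
  have hn0 : 0 ≤ n := CFC.negPart_nonneg a
  have hns : star n = n := (IsSelfAdjoint.of_nonneg hn0).star_eq
  set r := CFC.sqrt n with hr
  have hr0 : 0 ≤ r := CFC.sqrt_nonneg n
  have hrs : star r = r := (IsSelfAdjoint.of_nonneg hr0).star_eq
  have hrr : r * r = n := CFC.sqrt_mul_sqrt_self n hn0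
  have hnan : star n * a * n = -(star (r * n) * (r * n)) := by
    have h1 : a = a⁺ - n := (CFC.posPart_sub_negPart a ha).symm
    have h2 : n * a = - (n * n) := by
      conv_lhs => rw [h1]
      rw [mul_sub, hn, CFC.negPart_mul_posPart, zero_sub]
    rw [hns, h2, star_mul, hrs, hns]
    rw [show n * r * (r * n) = n * (r * r) * n by simp only [mul_assoc], hrr, neg_mul]
  have hrn : r * n = 0 := by
    refine h0 _ fun i => le_antisymm ?_ (hf i _)
    have := h i n
    rw [hnan, map_neg] at this
    exact neg_nonneg.1 this
  have hnn : star n * n = 0 := by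
    rw [hns]; nth_rw 1 [← hrr]; rw [mul_assoc, hrn, mul_zero]
  have hn1 : n = 0 := CStarRing.star_mul_self_eq_zero_iff n |>.1 hnn
  rw [← CFC.posPart_sub_negPart a ha, ← hn, hn1, sub_zero]
  exact CFC.posPart_nonneg a

namespace HilbertModule

variable {B H K : Type*} [NonUnitalCStarAlgebra B] [NormedAddCommGroup H] [NormedSpace ℂ H]
  [HilbertModule B H] [NormedAddCommGroup K] [NormedSpace ℂ K] [HilbertModule B K]

theorem star_coe_eq (T : adjointableEnd B H) (x y : H) :
    (ip ((star T).1 x) y : B) = ip x (T.1 y) :=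
  ((isAdjoint_adj B (T : adjointable B H H)).symm B) x y

theorem exists_star_mul_self_of_ip (T : adjointableEnd B H) (hT : IsSelfAdjoint T)
    (h : ∀ x, ∃ b : B, ip x (T.1 x) = star b * b) : ∃ S, T = star S * S := by
  let f : H → adjointableEnd B H →+ B := fun x =>
    { toFun := fun T => ip x (T.1 x)
      map_zero' := ip_zero_right x
      map_add' := fun S T => ip_add_right x _ _ }
  have hfc : ∀ x (c d : adjointableEnd B H), f x (star c * d) = ip (c.1 x) (d.1 x) := by
    intro x c d
    rw [← star_star c, star_coe_eq, star_star]
    rfl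
  refine exists_star_mul_self_of_family f (fun x c => ?_) (fun c hc => ?_) hT fun x c => ?_
  · rw [hfc]; exact ip_self _
  · refine Subtype.ext (ContinuousLinearMap.ext fun x => ?_)
    have := hc x
    rw [hfc] at this
    have h1 : ‖c.1 x‖ ^ 2 = 0 := by rw [norm_sq (B := B), this, norm_zero]
    exact norm_eq_zero.1 (pow_eq_zero_iff two_ne_zero |>.1 h1)
  · rw [mul_assoc, hfc]
    exact h (c.1 x)

/-- The product `S⋆ T ∈ L(H)` of adjointable operators `S, T : H → K`. -/
noncomputable def starMul (S T : adjointable B H K) : adjointableEnd B H :=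
  (compA B (adj B S) T : adjointable B H H)

/-- The composition `T c` of an adjointable operator `T : H → K` with `c ∈ L(H)`. -/
noncomputable def mulEnd (T : adjointable B H K) (c : adjointableEnd B H) : adjointable B H K :=
  compA B T (c : adjointable B H H)

theorem starMul_apply (S T : adjointable B H K) (x y : H) :
    (ip x ((starMul S T).1 y) : B) = ip (S.1 x) (T.1 y) := (isAdjoint_adj B S x (T.1 y)).symm

theorem end_ext {S T : adjointableEnd B H} (h : ∀ x y, (ip x (S.1 y) : B) = ip x (T.1 y)) :
    S = T :=
  Subtype.ext (ContinuousLinearMap.ext fun y => ext_ip B fun x => h x y)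

theorem star_starMul (S T : adjointable B H K) : star (starMul S T) = starMul T S :=
  end_ext fun x y => by
    rw [← star_ip, star_coe_eq, starMul_apply, starMul_apply, star_ip]

theorem starMul_add (S T T' : adjointable B H K) :
    starMul S (T + T') = starMul S T + starMul S T' :=
  end_ext fun x y => by
    have : (ip x ((starMul S T + starMul S T').1 y) : B)
      = ip x ((starMul S T).1 y) + ip x ((starMul S T').1 y) := ip_add_right _ _ _
    rw [this]
    simp only [starMul_apply, Submodule.coe_add, add_apply, ip_add_right]

theorem starMul_smul (c : ℂ) (S T : adjointable B H K) :
    starMul S (c • T) = c • starMul S T :=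
  end_ext fun x y => by
    have : (ip x ((c • starMul S T).1 y) : B) = c • ip x ((starMul S T).1 y) :=
      ip_smul_right _ _ _
    rw [this]
    simp only [starMul_apply, Submodule.coe_smul, smul_apply, ip_smul_right]

theorem starMul_mulEnd (S T : adjointable B H K) (c : adjointableEnd B H) :
    starMul S (mulEnd T c) = starMul S T * c := rfl

theorem exists_starMul_self (T : adjointable B H K) : ∃ S, starMul T T = star S * S :=
  exists_star_mul_self_of_ip _ (star_starMul T T) fun x => by
    rw [starMul_apply]; exact ip_self _

theorem norm_starMul_self (T : adjointable B H K) : ‖T‖ ^ 2 = ‖starMul T T‖ := by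
  refine le_antisymm ?_ ?_
  · rw [pow_two]; exact norm_mul_norm_le B T
  · rw [pow_two]
    refine (ContinuousLinearMap.opNorm_comp_le (adj B T).1 T.1).trans_eq ?_
    congr 1
    exact norm_adj B T

theorem norm_starMul_le (S T : adjointable B H K) : ‖starMul S T‖ ≤ ‖S‖ * ‖T‖ := by
  refine (ContinuousLinearMap.opNorm_comp_le (adj B S).1 T.1).trans_eq ?_
  congr 1
  exact norm_adj B S

theorem norm_mulEnd_le (T : adjointable B H K) (c : adjointableEnd B H) :
    ‖mulEnd T c‖ ≤ ‖T‖ * ‖c‖ := ContinuousLinearMap.opNorm_comp_le _ _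

theorem starMul_add_left (S S' T : adjointable B H K) :
    starMul (S + S') T = starMul S T + starMul S' T := by
  rw [← star_starMul, starMul_add, star_add, star_starMul, star_starMul]

theorem starMul_smul_left (c : ℂ) (S T : adjointable B H K) :
    starMul (c • S) T = star c • starMul S T := by
  rw [← star_starMul, starMul_smul, star_smul, star_starMul]

/-- The map `T ↦ S⋆ T`. -/
noncomputable def starMulL (S : adjointable B H K) :
    adjointable B H K →L[ℂ] adjointableEnd B H :=
  LinearMap.mkContinuous ⟨⟨starMul S, starMul_add S⟩, fun c T => starMul_smul c S T⟩ ‖S‖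
    fun T => norm_starMul_le S T

/-- The map `T ↦ T c`. -/
noncomputable def mulEndL (c : adjointableEnd B H) :
    adjointable B H K →L[ℂ] adjointable B H K :=
  LinearMap.mkContinuous ⟨⟨fun T => mulEnd T c, fun _ _ =>
    Subtype.ext (ContinuousLinearMap.add_comp _ _ _)⟩, fun _ _ =>
    Subtype.ext (ContinuousLinearMap.smul_comp _ _ _)⟩ ‖c‖
    fun T => (norm_mulEnd_le T c).trans_eq (mul_comm _ _)

/-! ### Hilbert modules over concrete C*-algebras of operators -/

section Concrete

variable (C : NonUnitalStarSubalgebra ℂ (adjointableEnd B H))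

/-- `S⋆ T ∈ C` for all `S, T ∈ X`. -/
def IsAdmissible (X : Set (adjointable B H K)) : Prop :=
  ∀ S ∈ X, ∀ T ∈ X, starMul S T ∈ C

/-- The closed linear span of `{T c | T ∈ X, c ∈ C}`. -/
noncomputable def spanSubmodule (X : Set (adjointable B H K)) : Submodule ℂ (adjointable B H K) :=
  (Submodule.span ℂ {Q | ∃ T ∈ X, ∃ c ∈ C, Q = mulEnd T c}).topologicalClosure

variable {C}

theorem starMul_mem [hC : IsClosed (C : Set (adjointableEnd B H))]
    {X : Set (adjointable B H K)} (hX : IsAdmissible C X) {S T : adjointable B H K}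
    (hS : S ∈ spanSubmodule C X) (hT : T ∈ spanSubmodule C X) : starMul S T ∈ C := by
  have key : ∀ S : adjointable B H K,
      (∀ T ∈ {Q | ∃ T ∈ X, ∃ c ∈ C, Q = mulEnd T c}, starMul S T ∈ C) →
      ∀ T ∈ spanSubmodule C X, starMul S T ∈ C := by
    intro S hS T hT
    let N : Submodule ℂ (adjointable B H K) :=
      C.toNonUnitalSubalgebra.toSubmodule.comap (starMulL S).toLinearMap
    have hN : IsClosed (N : Set (adjointable B H K)) := hC.preimage (starMulL S).continuous
    exact Submodule.topologicalClosure_minimal (t := N) _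
      (Submodule.span_le.2 fun T hT => hS T hT) hN hT
  refine key S (fun T hT' => ?_) T hT
  rw [← star_starMul]
  refine star_mem (key T (fun S hS' => ?_) S hS)
  obtain ⟨T, hT, c, hc, rfl⟩ := hT'
  obtain ⟨S, hS, d, hd, rfl⟩ := hS'
  rw [starMul_mulEnd, ← star_starMul, starMul_mulEnd, star_mul]
  exact mul_mem (mul_mem (star_mem hc) (star_mem (hX _ hS _ hT))) hd

theorem mulEnd_mem {X : Set (adjointable B H K)} {T : adjointable B H K}
    (hT : T ∈ spanSubmodule C X) {c : adjointableEnd B H} (hc : c ∈ C) :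
    mulEnd T c ∈ spanSubmodule C X := by
  let N : Submodule ℂ (adjointable B H K) :=
    (spanSubmodule C X).comap (mulEndL c).toLinearMap
  have hN : IsClosed (N : Set (adjointable B H K)) :=
    (Submodule.isClosed_topologicalClosure _).preimage (mulEndL c).continuous
  refine Submodule.topologicalClosure_minimal (t := N) _ (Submodule.span_le.2 ?_) hN hT
  rintro _ ⟨T, hT, d, hd, rfl⟩
  exact subset_closure (Submodule.subset_span ⟨T, hT, d * c, mul_mem hd hc, rfl⟩)

/-- The Hilbert `C`-module generated by an admissible set `X` of operators `H → K`, for a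
C*-algebra `C ⊆ L(H)`: the closed linear span of `X C` with `⟨S, T⟩ = S⋆ T` and composition as
right action. -/
@[nolint unusedArguments]
def Generated {X : Set (adjointable B H K)} (_ : IsAdmissible C X) : Type _ :=
  spanSubmodule C X

variable {X : Set (adjointable B H K)} (hX : IsAdmissible C X)

noncomputable instance : NormedAddCommGroup (Generated hX) :=
  inferInstanceAs (NormedAddCommGroup (spanSubmodule C X))

noncomputable instance : NormedSpace ℂ (Generated hX) :=
  inferInstanceAs (NormedSpace ℂ (spanSubmodule C X))

/-- The operator underlying an element of the generated Hilbert module. -/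
def Generated.op {hX : IsAdmissible C X} (T : Generated hX) : adjointable B H K := Subtype.val T

noncomputable instance [hC : IsClosed (C : Set (adjointableEnd B H))] :
    HilbertModule C (Generated hX) where
  ip S T := ⟨starMul S.op T.op, starMul_mem hX (Subtype.prop S) (Subtype.prop T)⟩
  ract T c := (⟨mulEnd T.op c.1, mulEnd_mem (Subtype.prop T) c.2⟩ : spanSubmodule C X)
  ip_add_right S T T' := Subtype.ext (starMul_add S.op T.op T'.op)
  ip_smul_right c S T := Subtype.ext (starMul_smul c S.op T.op)
  star_ip S T := Subtype.ext (star_starMul S.op T.op)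
  ip_ract S T c := rfl
  ip_self T := by
    obtain ⟨b, hb, h⟩ := exists_mem_star_mul_self C
      (starMul_mem hX (Subtype.prop T) (Subtype.prop T)) (exists_starMul_self T.op)
    exact ⟨⟨b, hb⟩, Subtype.ext h⟩
  norm_sq T := norm_starMul_self T.op
  complete := ((Submodule.isClosed_topologicalClosure _).completeSpace_coe :
    CompleteSpace (spanSubmodule C X)).complete

end Concrete

end HilbertModule

end Positivity

namespace HilbertModule

section Tensor

variable {C D X Y : Type*} [NonUnitalCStarAlgebra C] [NonUnitalCStarAlgebra D]
  [NormedAddCommGroup X] [NormedSpace ℂ X] [HilbertModule C X]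
  [NormedAddCommGroup Y] [NormedSpace ℂ Y] [HilbertModule D Y]
  (Φ : C →⋆ₙₐ[ℂ] adjointableEnd D Y)

/-- The matrix of inner products of a finite family is positive. -/
theorem exists_gram {ι : Type*} [Fintype ι] (x : ι → X) :
    ∃ N : ι → ι → C, ∀ i j, (ip (x i) (x j) : C) = ∑ k, star (N k i) * N k j := by
  classical
  let _ := CStarAlgebra.spectralOrder C
  have _ := CStarAlgebra.spectralOrderedRing C
  let M : CStarMatrix ι ι C := CStarMatrix.ofMatrix fun i j => ip (x i) (x j)
  have hM : ∀ i j, M i j = ip (x i) (x j) := fun i j => rfl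
  have hmul : ∀ (P Q : CStarMatrix ι ι C) i j, (P * Q) i j = ∑ k, P i k * Q k j :=
    fun P Q i j => CStarMatrix.mul_apply
  have hstar : ∀ (P : CStarMatrix ι ι C) i j, star P i j = star (P j i) :=
    fun P i j => rfl
  let f : ι → CStarMatrix ι ι C →+ C := fun i =>
    { toFun := fun P => P i i
      map_zero' := rfl
      map_add' := fun _ _ => rfl }
  have hf : ∀ i (P : CStarMatrix ι ι C), f i P = P i i := fun i P => rfl
  obtain ⟨N, hN⟩ : ∃ N : CStarMatrix ι ι C, M = star N * N := by
    refine exists_star_mul_self_of_family f (fun i P => ?_) (fun P hP => ?_) ?_ fun i P => ?_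
    · rw [hf, hmul, exists_star_mul_self_iff]
      exact Finset.sum_nonneg fun k _ => star_mul_self_nonneg (P k i)
    · ext k i
      have := hP i
      rw [hf, hmul] at this
      have h1 := (Finset.sum_eq_zero_iff_of_nonneg
        (fun k _ => star_mul_self_nonneg (P k i))).1 this k (Finset.mem_univ k)
      exact (CStarRing.star_mul_self_eq_zero_iff _).1 h1
    · ext i j
      rw [hstar, hM, hM, star_ip]
    · obtain ⟨d, hd⟩ := ip_self (B := C) (∑ k, ract (x k) (P k i))
      refine ⟨d, ?_⟩
      rw [← hd, hf, hmul]
      have h1 : ∀ (z : X), (ip z (∑ k, ract (x k) (P k i)) : C) = ∑ k, ip z (x k) * P k i := by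
        intro z
        rw [← ipₗ_apply, map_sum]
        simp only [ipₗ_apply, ip_ract]
      rw [h1]
      refine Finset.sum_congr rfl fun k _ => ?_
      rw [← star_ip, h1, hmul, star_sum]
      congr 1
      refine Finset.sum_congr rfl fun l _ => ?_
      rw [star_mul, star_ip, hstar, hM]
  refine ⟨fun k i => N k i, fun i j => ?_⟩
  rw [← hM, hN, hmul]
  rfl

/-- The linear functional `x' ⊗ y' ↦ ⟨y, Φ(⟨x, x'⟩) y'⟩`. -/
noncomputable def tensorFormAux (x : X) (y : Y) : X ⊗[ℂ] Y →ₗ[ℂ] D :=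
  TensorProduct.lift (LinearMap.mk₂ ℂ (fun x' y' => ip y ((Φ (ip x x')).1 y'))
    (fun a b c => by
      rw [ip_add_right, map_add]; exact ip_add_right y _ _)
    (fun z a b => by
      rw [ip_smul_right, map_smul]; exact ip_smul_right z y _)
    (fun a b c => by rw [map_add, ip_add_right])
    (fun z a b => by rw [map_smul, ip_smul_right]))

/-- The semi-inner product `⟨x ⊗ y, x' ⊗ y'⟩ = ⟨y, Φ(⟨x, x'⟩) y'⟩` on the algebraic tensor
product. -/
noncomputable def tensorForm : X ⊗[ℂ] Y →ₗ⋆[ℂ] X ⊗[ℂ] Y →ₗ[ℂ] D :=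
  TensorProduct.lift (LinearMap.mk₂'ₛₗ (starRingEnd ℂ) (starRingEnd ℂ) (tensorFormAux Φ)
    (fun a b c => TensorProduct.ext' fun x' y' => by
      change ip c ((Φ (ip (a + b) x')).1 y') =
        (ip c ((Φ (ip a x')).1 y') + ip c ((Φ (ip b x')).1 y') : D)
      rw [ip_add_left, map_add]; exact ip_add_right c _ _)
    (fun z a c => TensorProduct.ext' fun x' y' => by
      change ip c ((Φ (ip (z • a) x')).1 y') = (star z • ip c ((Φ (ip a x')).1 y') : D)
      rw [ip_smul_left, map_smul]; exact ip_smul_right (star z) c _)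
    (fun a b c => TensorProduct.ext' fun x' y' => by
      change ip (b + c) ((Φ (ip a x')).1 y') =
        (ip b ((Φ (ip a x')).1 y') + ip c ((Φ (ip a x')).1 y') : D)
      rw [ip_add_left])
    (fun z a c => TensorProduct.ext' fun x' y' => by
      change ip (z • c) ((Φ (ip a x')).1 y') = (star z • ip c ((Φ (ip a x')).1 y') : D)
      rw [ip_smul_left]))

theorem tensorForm_tmul (x x' : X) (y y' : Y) :
    tensorForm Φ (x ⊗ₜ y) (x' ⊗ₜ y') = ip y ((Φ (ip x x')).1 y') := rfl

/-- The algebraic tensor product as a pre-Hilbert `D`-module. -/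
noncomputable def tensorPre : PreHilbertModule D (X ⊗[ℂ] Y) where
  form := tensorForm Φ
  ract d := LinearMap.lTensor X (ractₗ d)
  star_form u v := by
    induction u with
    | zero => simp
    | add u u' h h' => simp only [map_add, LinearMap.add_apply, star_add, h, h']
    | tmul x y =>
      induction v with
      | zero => simp
      | add v v' h h' => simp only [map_add, LinearMap.add_apply, star_add, h, h']
      | tmul x' y' =>
        rw [tensorForm_tmul, tensorForm_tmul, star_ip, ← star_ip x' x, map_star, star_coe_eq]
  form_ract u v d := by
    induction u with
    | zero => simp
    | add u u' h h' => simp only [map_add, LinearMap.add_apply, add_mul, h, h']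
    | tmul x y =>
      induction v with
      | zero => simp
      | add v v' h h' => simp only [map_add, add_mul, h, h']
      | tmul x' y' =>
        rw [LinearMap.lTensor_tmul, tensorForm_tmul, tensorForm_tmul, ← star_coe_eq,
          ← star_coe_eq]
        exact ip_ract _ _ _
  form_self u := by
    let _ := CStarAlgebra.spectralOrder D
    have _ := CStarAlgebra.spectralOrderedRing D
    obtain ⟨S, rfl⟩ := TensorProduct.exists_finset u
    obtain ⟨N, hN⟩ := exists_gram (C := C) fun i : S => i.1.1
    rw [← Finset.sum_coe_sort, exists_star_mul_self_iff]
    have h1 : tensorForm Φ (∑ i : S, i.1.1 ⊗ₜ[ℂ] i.1.2) (∑ i : S, i.1.1 ⊗ₜ[ℂ] i.1.2)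
        = ∑ k : S, (ip (∑ i : S, (Φ (N k i)).1 i.1.2) (∑ i : S, (Φ (N k i)).1 i.1.2) : D) := by
      have e : ∀ u v : S → Y, (ip (∑ i, u i) (∑ j, v j) : D) = ∑ i, ∑ j, ip (u i) (v j) := by
        intro u v
        rw [← ipₗ_apply]
        simp only [map_sum, LinearMap.sum_apply, ipₗ_apply]
        exact Finset.sum_comm
      simp only [e, map_sum, LinearMap.sum_apply, tensorForm_tmul]
      conv_rhs => rw [Finset.sum_comm]
      rw [Finset.sum_comm]
      refine Finset.sum_congr rfl fun i _ => ?_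
      conv_rhs => rw [Finset.sum_comm]
      refine Finset.sum_congr rfl fun j _ => ?_
      rw [hN, map_sum]
      have e2 : ∀ T : S → adjointableEnd D Y, (ip i.1.2 ((∑ k, T k).1 j.1.2) : D)
          = ∑ k, ip i.1.2 ((T k).1 j.1.2) := by
        intro T
        let f : adjointableEnd D Y →+ D :=
          ⟨⟨fun T => ip i.1.2 (T.1 j.1.2), ip_zero_right _⟩, fun _ _ => ip_add_right _ _ _⟩
        exact map_sum f T Finset.univ
      rw [e2]
      refine Finset.sum_congr rfl fun k _ => ?_
      rw [map_mul, map_star, ← star_star (Φ (N k i)), star_coe_eq, star_star]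
      rfl
    rw [h1]
    exact Finset.sum_nonneg fun k _ => exists_star_mul_self_iff.1 (ip_self _)

variable (X) in
/-- The interior tensor product `X ⊗_Φ Y` of a Hilbert `C`-module `X` and a Hilbert `D`-module
`Y` along `Φ : C → L(Y)`. -/
def Tensor : Type _ := (tensorPre (X := X) Φ).Hilbert

noncomputable instance : NormedAddCommGroup (Tensor X Φ) :=
  inferInstanceAs (NormedAddCommGroup (tensorPre (X := X) Φ).Hilbert)

noncomputable instance : NormedSpace ℂ (Tensor X Φ) :=
  inferInstanceAs (NormedSpace ℂ (tensorPre (X := X) Φ).Hilbert)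

noncomputable instance : HilbertModule D (Tensor X Φ) :=
  inferInstanceAs (HilbertModule D (tensorPre (X := X) Φ).Hilbert)

end Tensor

/-- Unitary isomorphisms of Hilbert `C`-modules. -/
structure UnitaryEquiv (C X Y : Type*) [NonUnitalCStarAlgebra C]
    [NormedAddCommGroup X] [NormedSpace ℂ X] [HilbertModule C X]
    [NormedAddCommGroup Y] [NormedSpace ℂ Y] [HilbertModule C Y] extends X ≃ₗ[ℂ] Y where
  map_ip : ∀ x y, (ip (toFun x) (toFun y) : C) = ip x y
  map_ract : ∀ x (c : C), toFun (ract x c) = ract (toFun x) c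

end HilbertModule

/-! ### Group actions -/

section Actions

variable (G : Type*) [Group G] [TopologicalSpace G]

/-- A strongly continuous action of `G` on the C*-algebra `A` by *-automorphisms. -/
structure CStarAction (A : Type*) [NonUnitalCStarAlgebra A] where
  toFun : G → A →⋆ₙₐ[ℂ] A
  map_one : ∀ a, toFun 1 a = a
  map_mul : ∀ s t a, toFun (s * t) a = toFun s (toFun t a)
  continuous : ∀ a, Continuous fun t => toFun t a

variable {G}

/-- A `G`-action `γ` on a Hilbert `B`-module `E`, compatible with the action `β` of `G` on `B`;
that is, `(E, γ)` is a `G`-equivariant Hilbert `(B, β)`-module. -/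
structure ModuleAction {B : Type*} [NonUnitalCStarAlgebra B] (β : CStarAction G B)
    (E : Type*) [NormedAddCommGroup E] [NormedSpace ℂ E] [HilbertModule B E] where
  toFun : G → E →ₗ[ℂ] E
  map_one : ∀ x, toFun 1 x = x
  map_mul : ∀ s t x, toFun (s * t) x = toFun s (toFun t x)
  map_ip : ∀ t x y, (ip (toFun t x) (toFun t y) : B) = β.toFun t (ip x y)
  map_ract : ∀ t x (b : B), toFun t (ract x b) = ract (toFun t x) (β.toFun t b)
  continuous : ∀ x, Continuous fun t => toFun t x

/-- A `G`-C*-algebra as an equivariant Hilbert module over itself. -/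
def CStarAction.self {A : Type*} [NonUnitalCStarAlgebra A] (α : CStarAction G A) :
    ModuleAction α A where
  toFun t := (α.toFun t : A →ₗ[ℂ] A)
  map_one := α.map_one
  map_mul := α.map_mul
  map_ip t x y := by
    change star (α.toFun t x) * α.toFun t y = α.toFun t (star x * y)
    rw [_root_.map_mul, map_star]
  map_ract t x b := _root_.map_mul (α.toFun t) x b
  continuous := α.continuous

end Actions

namespace HilbertModule

/-! ### Compact operators and the dual module -/

section Compact

variable (B E : Type*) [NonUnitalCStarAlgebra B] [NormedAddCommGroup E] [NormedSpace ℂ E]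
  [HilbertModule B E]

variable {E} in
/-- The rank one operator `|ξ⟩⟨η| : ζ ↦ ξ ⟨η, ζ⟩`. -/
noncomputable def rankOne (ξ η : E) : adjointableEnd B E :=
  ⟨LinearMap.mkContinuous
    { toFun := fun ζ => ract ξ (ip η ζ : B)
      map_add' := fun x y => ext_ip B fun z => by
        simp only [ip_ract, ip_add_right, mul_add]
      map_smul' := fun c x => ext_ip B fun z => by
        simp only [ip_ract, ip_smul_right, mul_smul_comm, RingHom.id_apply] }
    (‖ξ‖ * ‖η‖) fun ζ => by
      refine (norm_ract_le ξ _).trans ?_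
      rw [mul_assoc]
      exact mul_le_mul_of_nonneg_left (norm_ip_le B η ζ) (norm_nonneg ξ),
   ⟨LinearMap.mkContinuous
    { toFun := fun ζ => ract η (ip ξ ζ : B)
      map_add' := fun x y => ext_ip B fun z => by
        simp only [ip_ract, ip_add_right, mul_add]
      map_smul' := fun c x => ext_ip B fun z => by
        simp only [ip_ract, ip_smul_right, mul_smul_comm, RingHom.id_apply] }
    (‖η‖ * ‖ξ‖) fun ζ => by
      refine (norm_ract_le η _).trans ?_
      rw [mul_assoc]
      exact mul_le_mul_of_nonneg_left (norm_ip_le B ξ ζ) (norm_nonneg η),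
    fun x y => by
      change (ip (ract ξ (ip η x : B)) y : B) = ip x (ract η (ip ξ y : B))
      rw [ip_ract, ip_ract_left, star_ip]⟩⟩

variable {B E}

theorem rankOne_apply (ξ η ζ : E) : (rankOne B ξ η).1 ζ = ract ξ (ip η ζ : B) := rfl

theorem norm_rankOne_le (ξ η : E) : ‖rankOne B ξ η‖ ≤ ‖ξ‖ * ‖η‖ :=
  ContinuousLinearMap.opNorm_le_bound _ (by positivity) fun ζ => by
    refine (norm_ract_le ξ _).trans ?_
    rw [mul_assoc]
    exact mul_le_mul_of_nonneg_left (norm_ip_le B η ζ) (norm_nonneg ξ)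

theorem star_rankOne (ξ η : E) : star (rankOne B ξ η) = rankOne B η ξ :=
  end_ext fun x y => by
    rw [← star_ip, star_coe_eq, rankOne_apply, rankOne_apply, ip_ract, ip_ract, star_mul,
      star_ip, star_ip]

theorem rankOne_add_right (ξ η η' : E) :
    rankOne B ξ (η + η') = rankOne B ξ η + rankOne B ξ η' :=
  end_ext fun x y => by
    have h : (ip x ((rankOne B ξ η + rankOne B ξ η').1 y) : B)
      = ip x ((rankOne B ξ η).1 y) + ip x ((rankOne B ξ η').1 y) := ip_add_right x _ _
    rw [h]
    simp only [rankOne_apply, ip_ract, ip_add_left, mul_add]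

theorem rankOne_smul_right (c : ℂ) (ξ η : E) :
    rankOne B ξ (c • η) = star c • rankOne B ξ η :=
  end_ext fun x y => by
    have h : (ip x ((star c • rankOne B ξ η).1 y) : B)
      = star c • ip x ((rankOne B ξ η).1 y) := ip_smul_right _ x _
    rw [h]
    simp only [rankOne_apply, ip_ract, ip_smul_left, mul_smul_comm]

theorem rankOne_add_left (ξ ξ' η : E) :
    rankOne B (ξ + ξ') η = rankOne B ξ η + rankOne B ξ' η := by
  rw [← star_rankOne, rankOne_add_right, star_add, star_rankOne, star_rankOne]

theorem rankOne_smul_left (c : ℂ) (ξ η : E) :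
    rankOne B (c • ξ) η = c • rankOne B ξ η := by
  rw [← star_rankOne, rankOne_smul_right, star_smul, star_rankOne, star_star]

theorem rankOne_mul (ξ η : E) (T : adjointableEnd B E) :
    rankOne B ξ η * T = rankOne B ξ ((star T).1 η) :=
  end_ext fun x y => by
    rw [rankOne_apply, star_coe_eq]
    rfl

theorem exists_rankOne_self (ξ : E) : ∃ S, rankOne B ξ ξ = star S * S :=
  exists_star_mul_self_of_ip _ (star_rankOne ξ ξ) fun x =>
    ⟨ip ξ x, by rw [rankOne_apply, ip_ract, star_ip]⟩

theorem norm_rankOne_self (ξ : E) : ‖ξ‖ ^ 2 = ‖rankOne B ξ ξ‖ := by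
  refine le_antisymm ?_ ((norm_rankOne_le ξ ξ).trans_eq (pow_two _).symm)
  set a : B := ip ξ ξ with ha
  have hsa : star a = a := star_ip ξ ξ
  have hn : ‖ξ‖ ^ 2 = ‖a‖ := norm_sq ξ
  have h1 : ‖a * a‖ = ‖a‖ * ‖a‖ := by
    nth_rw 1 [← hsa]; exact CStarRing.norm_star_mul_self
  have h2 : ip ξ ((rankOne B ξ ξ).1 ξ) = a * a := by rw [rankOne_apply, ip_ract]
  have h3 : ‖a‖ * ‖a‖ ≤ ‖rankOne B ξ ξ‖ * ‖a‖ := by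
    rw [← h1, ← h2]
    refine (norm_ip_le B _ _).trans ?_
    have := (rankOne B ξ ξ).1.le_opNorm ξ
    rw [← hn]
    have h4 : ‖(rankOne B ξ ξ).1‖ = ‖rankOne B ξ ξ‖ := rfl
    rw [h4] at this
    nlinarith [norm_nonneg ξ]
  rw [hn]
  rcases (norm_nonneg a).eq_or_lt with h0 | h0
  · rw [← h0]; exact norm_nonneg _
  · exact le_of_mul_le_mul_right h3 h0

variable (B E) in
/-- The C*-algebra `K(E)` of compact operators, generated by the rank one operators. (The linear
span of the rank one operators is already a *-algebra, so this is its closure.) -/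
noncomputable def compacts : NonUnitalStarSubalgebra ℂ (adjointableEnd B E) :=
  (NonUnitalStarAlgebra.adjoin ℂ {T | ∃ ξ η : E, T = rankOne B ξ η}).topologicalClosure

instance : IsClosed (compacts B E : Set (adjointableEnd B E)) :=
  NonUnitalStarSubalgebra.isClosed_topologicalClosure _

theorem rankOne_mem (ξ η : E) : rankOne B ξ η ∈ compacts B E :=
  NonUnitalStarSubalgebra.le_topologicalClosure _
    (NonUnitalStarAlgebra.subset_adjoin ℂ _ ⟨ξ, η, rfl⟩)

variable (B E) in
/-- `K(E)` as a C*-algebra. -/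
def Compacts : Type _ := compacts B E

noncomputable instance : NonUnitalCStarAlgebra (Compacts B E) :=
  inferInstanceAs (NonUnitalCStarAlgebra (compacts B E))

/-- The operator underlying an element of `K(E)`. -/
def Compacts.op (T : Compacts B E) : adjointableEnd B E := Subtype.val T

/-- The element of `K(E)` given by an operator. -/
def Compacts.mk (T : adjointableEnd B E) (hT : T ∈ compacts B E) : Compacts B E :=
  (⟨T, hT⟩ : compacts B E)

theorem Compacts.ext {S T : Compacts B E} (h : S.op = T.op) : S = T := Subtype.ext h

/-- The rank one operator `|ξ⟩⟨η|` as an element of `K(E)`. -/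
noncomputable def rankOneK (ξ η : E) : Compacts B E := .mk (rankOne B ξ η) (rankOne_mem ξ η)

/-- The conjugate vector space of `E`: the same additive group with scalar multiplication
`c • ξ⋆ = (star c • ξ)⋆`. -/
def Conj (E : Type*) : Type _ := E

/-- The element `ξ⋆` of the dual module. -/
def Conj.mk (ξ : E) : Conj E := ξ

/-- The element `ξ` for `ξ⋆`. -/
def Conj.out (ξ : Conj E) : E := ξ

noncomputable instance : NormedAddCommGroup (Conj E) := inferInstanceAs (NormedAddCommGroup E)

noncomputable instance : NormedSpace ℂ (Conj E) where
  smul c ξ := Conj.mk (star c • ξ.out)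
  one_smul ξ := show star (1 : ℂ) • ξ.out = ξ.out by rw [star_one, one_smul]
  mul_smul c d ξ := show star (c * d) • ξ.out = star c • star d • ξ.out by
    rw [star_mul, mul_comm, mul_smul]
  smul_zero c := show star c • (0 : E) = 0 from smul_zero _
  smul_add c ξ η := show star c • (ξ.out + η.out) = star c • ξ.out + star c • η.out from
    smul_add _ _ _
  add_smul c d ξ := show star (c + d) • ξ.out = star c • ξ.out + star d • ξ.out by
    rw [star_add, add_smul]
  zero_smul ξ := show star (0 : ℂ) • ξ.out = 0 by rw [star_zero, zero_smul]
  norm_smul_le c ξ := show ‖star c • ξ.out‖ ≤ ‖c‖ * ‖ξ.out‖ by rw [norm_smul, norm_star]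

/-- The dual `E⋆` of a Hilbert `B`-module `E`, as a right Hilbert `K(E)`-module:
`⟨ξ⋆, η⋆⟩ = |ξ⟩⟨η|` and `ξ⋆ T = (T⋆ ξ)⋆`. -/
noncomputable instance : HilbertModule (Compacts B E) (Conj E) where
  ip ξ η := rankOneK ξ.out η.out
  ract ξ T := Conj.mk ((star T.op).1 ξ.out)
  ip_add_right ξ η η' := Compacts.ext (rankOne_add_right ξ.out η.out η'.out)
  ip_smul_right c ξ η := Compacts.ext <| by
    have := rankOne_smul_right (B := B) (star c) ξ.out η.out
    rw [star_star] at this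
    exact this
  star_ip ξ η := Subtype.ext (star_rankOne ξ.out η.out)
  ip_ract ξ η T := Compacts.ext (rankOne_mul ξ.out η.out T.op).symm
  ip_self ξ := by
    obtain ⟨b, hb, h⟩ := exists_mem_star_mul_self (compacts B E) (rankOne_mem ξ.out ξ.out)
      (exists_rankOne_self ξ.out)
    exact ⟨.mk b hb, Compacts.ext h⟩
  norm_sq ξ := norm_rankOne_self ξ.out
  complete := (HilbertModule.toCompleteSpace B : CompleteSpace E).complete

/-- The operator `ξ⋆ ↦ (ξ b⋆)⋆`. -/
noncomputable def dualOp (b : B) : Conj E →L[ℂ] Conj E :=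
  LinearMap.mkContinuous
    { toFun := fun ξ => Conj.mk (ract ξ.out (star b))
      map_add' := fun ξ η => (ractₗ (star b)).map_add ξ.out η.out
      map_smul' := fun c ξ => (ractₗ (star b)).map_smul (star c) ξ.out } ‖star b‖
    fun ξ => (norm_ract_le ξ.out (star b)).trans_eq (mul_comm _ _)

theorem isAdjoint_dualOp (b : B) :
    IsAdjoint (Compacts B E) (dualOp b : Conj E →L[ℂ] Conj E) (dualOp (star b)) :=
  fun ξ η => Compacts.ext <| end_ext fun x y => by
    change (ip x ((rankOne B (ract ξ.out (star b)) η.out).1 y) : B) =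
      ip x ((rankOne B ξ.out (ract η.out (star (star b)))).1 y)
    rw [rankOne_apply, rankOne_apply, ip_ract, ip_ract, ip_ract, ip_ract_left, star_star,
      mul_assoc]

variable (B E) in
/-- The left action `b ξ⋆ = (ξ b⋆)⋆` of `B` on `E⋆`. -/
noncomputable def dualLeft : B →⋆ₙₐ[ℂ] adjointableEnd (Compacts B E) (Conj E) where
  toFun b := ⟨dualOp b, dualOp (star b), isAdjoint_dualOp b⟩
  map_smul' c b := Subtype.ext <| ContinuousLinearMap.ext fun ξ =>
    ext_ip B (E := E) fun z => by
      change (ip z (ract ξ.out (star (c • b))) : B) = ip z (star c • ract ξ.out (star b))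
      rw [ip_ract, ip_smul_right, ip_ract, star_smul, mul_smul_comm]
  map_zero' := Subtype.ext <| ContinuousLinearMap.ext fun ξ =>
    ext_ip B (E := E) fun z => by
      change (ip z (ract ξ.out (star (0 : B))) : B) = ip z (0 : E)
      rw [ip_ract, star_zero, mul_zero, ip_zero_right]
  map_add' b b' := Subtype.ext <| ContinuousLinearMap.ext fun ξ =>
    ext_ip B (E := E) fun z => by
      change (ip z (ract ξ.out (star (b + b'))) : B) =
        ip z (ract ξ.out (star b) + ract ξ.out (star b'))
      rw [ip_add_right, ip_ract, ip_ract, ip_ract, star_add, mul_add]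
  map_mul' b b' := Subtype.ext <| ContinuousLinearMap.ext fun ξ =>
    ext_ip B (E := E) fun z => by
      change (ip z (ract ξ.out (star (b * b'))) : B) =
        ip z (ract (ract ξ.out (star b')) (star b))
      rw [ip_ract, ip_ract, ip_ract, star_mul, mul_assoc]
  map_star' b := (adj_eq (Compacts B E)
    (T := (⟨dualOp b, dualOp (star b), isAdjoint_dualOp b⟩ :
      adjointable (Compacts B E) (Conj E) (Conj E)))
    (S := ⟨dualOp (star b), dualOp b, (isAdjoint_dualOp b).symm _⟩)
    (isAdjoint_dualOp b)).symm

end Compact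

/-! ### The induced actions on `K(E)` and on `E⋆` -/

section Induced

variable {G B E : Type*} [Group G] [TopologicalSpace G] [NonUnitalCStarAlgebra B]
  [NormedAddCommGroup E] [NormedSpace ℂ E] [HilbertModule B E] {β : CStarAction G B}
  (γ : ModuleAction β E)

theorem norm_action_le (t : G) (x : E) : ‖γ.toFun t x‖ ≤ ‖x‖ := by
  refine le_of_sq_le_sq ?_ (norm_nonneg x)
  rw [norm_sq (B := B), norm_sq (B := B), γ.map_ip]
  exact NonUnitalStarAlgHom.norm_apply_le (β.toFun t) _

/-- `γ_t` as a bounded operator. -/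
noncomputable def actionL (t : G) : E →L[ℂ] E :=
  LinearMap.mkContinuous (γ.toFun t) 1 fun x => by
    rw [one_mul]; exact norm_action_le γ t x

theorem action_inv (t : G) (x : E) : γ.toFun t (γ.toFun t⁻¹ x) = x := by
  rw [← γ.map_mul, mul_inv_cancel, γ.map_one]

theorem inv_action (t : G) (x : E) : γ.toFun t⁻¹ (γ.toFun t x) = x := by
  rw [← γ.map_mul, inv_mul_cancel, γ.map_one]

theorem ip_action (t : G) (x y : E) :
    (ip (γ.toFun t x) y : B) = β.toFun t (ip x (γ.toFun t⁻¹ y)) := by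
  rw [← γ.map_ip, action_inv]

theorem ip_action' (t : G) (x y : E) :
    (ip x (γ.toFun t y) : B) = β.toFun t (ip (γ.toFun t⁻¹ x) y) := by
  rw [← γ.map_ip, action_inv]

/-- The operator `γ_t T γ_t⁻¹`. -/
noncomputable def adOp (t : G) (T : adjointableEnd B E) : adjointableEnd B E :=
  ⟨(actionL γ t).comp (T.1.comp (actionL γ t⁻¹)),
    ⟨(actionL γ t).comp ((star T).1.comp (actionL γ t⁻¹)), fun x y => by
      change (ip (γ.toFun t (T.1 (γ.toFun t⁻¹ x))) y : B) =
        ip x (γ.toFun t ((star T).1 (γ.toFun t⁻¹ y)))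
      rw [ip_action, ip_action' γ t x, ← star_coe_eq (star T), star_star]⟩⟩

theorem adOp_apply (t : G) (T : adjointableEnd B E) (x : E) :
    (adOp γ t T).1 x = γ.toFun t (T.1 (γ.toFun t⁻¹ x)) := rfl

/-- The action `Ad γ` on `L(E)`, `T ↦ γ_t T γ_t⁻¹`. -/
noncomputable def adHom (t : G) : adjointableEnd B E →⋆ₙₐ[ℂ] adjointableEnd B E where
  toFun := adOp γ t
  map_smul' c T := Subtype.ext <| ContinuousLinearMap.ext fun x => (γ.toFun t).map_smul c _
  map_zero' := Subtype.ext <| ContinuousLinearMap.ext fun x => (γ.toFun t).map_zero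
  map_add' S T := Subtype.ext <| ContinuousLinearMap.ext fun x => (γ.toFun t).map_add _ _
  map_mul' S T := Subtype.ext <| ContinuousLinearMap.ext fun x => by
    change γ.toFun t (S.1 (T.1 (γ.toFun t⁻¹ x))) =
      γ.toFun t (S.1 (γ.toFun t⁻¹ (γ.toFun t (T.1 (γ.toFun t⁻¹ x)))))
    rw [inv_action]
  map_star' T := end_ext fun x y => by
    rw [← star_coe_eq (star (adOp γ t T)), star_star, adOp_apply, adOp_apply, ip_action,
      ip_action' γ t x, ← star_coe_eq (star T), star_star]

theorem adHom_rankOne (t : G) (ξ η : E) :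
    adHom γ t (rankOne B ξ η) = rankOne B (γ.toFun t ξ) (γ.toFun t η) :=
  Subtype.ext <| ContinuousLinearMap.ext fun x => by
    change γ.toFun t (ract ξ (ip η (γ.toFun t⁻¹ x) : B)) =
      ract (γ.toFun t ξ) (ip (γ.toFun t η) x : B)
    rw [γ.map_ract, ip_action]

theorem adHom_mem (t : G) {T : adjointableEnd B E} (hT : T ∈ compacts B E) :
    adHom γ t T ∈ compacts B E := by
  have hle : NonUnitalStarAlgebra.adjoin ℂ {T | ∃ ξ η : E, T = rankOne B ξ η} ≤
      (compacts B E).comap (adHom γ t) := by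
    refine NonUnitalStarAlgebra.adjoin_le ?_
    rintro _ ⟨ξ, η, rfl⟩
    change adHom γ t _ ∈ compacts B E
    rw [adHom_rankOne]
    exact rankOne_mem _ _
  have hcl : IsClosed ((compacts B E).comap (adHom γ t) : Set (adjointableEnd B E)) :=
    (inferInstance : IsClosed (compacts B E : Set (adjointableEnd B E))).preimage
      (AddMonoidHomClass.continuous_of_bound (adHom γ t) 1 fun x => by
        rw [one_mul]; exact NonUnitalStarAlgHom.norm_apply_le _ x)
  exact NonUnitalStarSubalgebra.topologicalClosure_minimal _ hle hcl hT

theorem continuous_rankOne :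
    Continuous fun z : E × E => rankOne B z.1 z.2 := by
  have : Continuous fun z : E × E =>
      (LinearMap.mkContinuous₂ (LinearMap.mk₂'ₛₗ (starRingEnd ℂ) (RingHom.id ℂ)
        (fun y x => rankOne B x y : E → E → adjointableEnd B E)
          (fun y y' x => rankOne_add_right x y y') (fun c y x => rankOne_smul_right c x y)
          (fun y x x' => rankOne_add_left x x' y) (fun c y x => rankOne_smul_left c x y)) 1
        fun y x => by
          rw [one_mul, mul_comm]; exact norm_rankOne_le x y) z.2 z.1 := by fun_prop
  exact this

theorem continuous_adHom {T : adjointableEnd B E} (hT : T ∈ compacts B E) :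
    Continuous fun t => adHom γ t T := by
  have h1 : ∀ T ∈ NonUnitalStarAlgebra.adjoin ℂ {T | ∃ ξ η : E, T = rankOne B ξ η},
      Continuous fun t => adHom γ t T := by
    intro T hT
    induction hT using NonUnitalStarAlgebra.adjoin_induction with
    | mem T hT =>
      obtain ⟨ξ, η, rfl⟩ := hT
      simp only [adHom_rankOne]
      exact continuous_rankOne.comp ((γ.continuous ξ).prodMk (γ.continuous η))
    | add S T _ _ hS hT => simp only [map_add]; exact hS.add hT
    | zero => simp only [map_zero]; exact continuous_const
    | mul S T _ _ hS hT => simp only [map_mul]; exact hS.mul hT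
    | smul c T _ hT => simp only [map_smul]; exact hT.const_smul c
    | star T _ hT => simp only [map_star]; exact hT.star
  refine continuous_iff_continuousAt.2 fun t => ?_
  rw [Metric.continuousAt_iff']
  intro ε hε
  obtain ⟨S, hS, hST⟩ := Metric.mem_closure_iff.1 hT (ε / 3) (by positivity)
  have hc : ∀ s, dist (adHom γ s T) (adHom γ s S) ≤ dist T S := fun s => by
    rw [dist_eq_norm, dist_eq_norm, ← map_sub]
    exact NonUnitalStarAlgHom.norm_apply_le (adHom γ s) _
  filter_upwards [Metric.continuousAt_iff'.1 ((h1 S hS).continuousAt (x := t)) (ε / 3)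
    (by positivity)] with s hs
  calc dist (adHom γ s T) (adHom γ t T)
      ≤ dist (adHom γ s T) (adHom γ s S) + dist (adHom γ s S) (adHom γ t S)
        + dist (adHom γ t S) (adHom γ t T) := dist_triangle4 _ _ _ _
    _ < ε := by
      have h2 := hc s
      have h3 := hc t
      rw [dist_comm] at h3
      linarith

/-- The restriction of `Ad γ_t` to `K(E)`. -/
noncomputable def adHomK (t : G) : Compacts B E →⋆ₙₐ[ℂ] Compacts B E where
  toFun T := .mk (adHom γ t T.op) (adHom_mem γ t (Subtype.prop T))
  map_smul' c T := Compacts.ext (map_smul (adHom γ t) c T.op)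
  map_zero' := Compacts.ext (map_zero (adHom γ t))
  map_add' S T := Compacts.ext (map_add (adHom γ t) S.op T.op)
  map_mul' S T := Compacts.ext (map_mul (adHom γ t) S.op T.op)
  map_star' T := Compacts.ext (map_star (adHom γ t) T.op)

/-- The action `Ad γ` of `G` on the C*-algebra `K(E)`. -/
noncomputable def adAction : CStarAction G (Compacts B E) where
  toFun t := adHomK γ t
  map_one T := Compacts.ext <| Subtype.ext <| ContinuousLinearMap.ext fun x => by
    change γ.toFun 1 (T.op.1 (γ.toFun 1⁻¹ x)) = T.op.1 x
    rw [inv_one, γ.map_one, γ.map_one]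
  map_mul s t T := Compacts.ext <| Subtype.ext <| ContinuousLinearMap.ext fun x => by
    change γ.toFun (s * t) (T.op.1 (γ.toFun (s * t)⁻¹ x)) =
      γ.toFun s (γ.toFun t (T.op.1 (γ.toFun t⁻¹ (γ.toFun s⁻¹ x))))
    rw [mul_inv_rev, γ.map_mul, γ.map_mul]
  continuous T := (continuous_adHom γ (Subtype.prop T)).subtype_mk _

/-- The action `γ⋆_t(ξ⋆) = γ_t(ξ)⋆` on the dual module `E⋆`. -/
noncomputable def dualAction : ModuleAction (adAction γ) (Conj E) where
  toFun t :=
    { toFun := fun ξ => Conj.mk (γ.toFun t ξ.out)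
      map_add' := fun ξ η => (γ.toFun t).map_add ξ.out η.out
      map_smul' := fun c ξ => (γ.toFun t).map_smul (star c) ξ.out }
  map_one ξ := γ.map_one ξ.out
  map_mul s t ξ := γ.map_mul s t ξ.out
  map_ip t ξ η := Compacts.ext (adHom_rankOne γ t ξ.out η.out).symm
  map_ract t ξ T := by
    change γ.toFun t ((star T.op).1 ξ.out) = (star (adHom γ t T.op)).1 (γ.toFun t ξ.out)
    rw [← map_star]
    change _ = γ.toFun t ((star T.op).1 (γ.toFun t⁻¹ (γ.toFun t ξ.out)))
    rw [inv_action]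
  continuous ξ := γ.continuous ξ.out

end Induced

end HilbertModule

/-! ### Crossed products and modules over them -/

section Crossed

variable {G : Type*} [Group G] [TopologicalSpace G] [IsTopologicalGroup G]
  [LocallyCompactSpace G] [MeasurableSpace G] [BorelSpace G]

/-- The modular function `Δ` of `G`, with the normalisation
`∫ f (s⁻¹) Δ(s)⁻¹ ds = ∫ f s ds` and `∫ f (s t) ds = Δ(t)⁻¹ ∫ f s ds` for the left Haar measure.
It is the inverse of Mathlib's modular character. -/
noncomputable def modular (t : G) : ℝ := ((Measure.modularCharacterFun t : NNReal) : ℝ)⁻¹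

namespace HilbertModule

section L2

variable (G) (B E : Type*) [NonUnitalCStarAlgebra B] [NormedAddCommGroup E] [NormedSpace ℂ E]
  [HilbertModule B E]

variable {G E} in
theorem integrable_ip (f g : C_c(G, E)) :
    Integrable (fun t => (ip (f t) (g t) : B)) Measure.haar := by
  refine Continuous.integrable_of_hasCompactSupport
    (continuous_ip.comp (f.continuous.prodMk g.continuous)) ?_
  refine g.hasCompactSupport.mono fun t ht => ?_
  rw [Function.mem_support] at ht ⊢
  exact fun h => ht (by rw [h, ip_zero_right])

/-- The pre-Hilbert module `C_c(G, E)` with `⟨f, g⟩ = ∫ ⟨f t, g t⟩ dt` and pointwise action. -/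
noncomputable def l2Pre : PreHilbertModule B C_c(G, E) where
  form := LinearMap.mk₂'ₛₗ (starRingEnd ℂ) (RingHom.id ℂ)
    (fun f g => ∫ t, (ip (f t) (g t) : B) ∂Measure.haar)
    (fun f f' g => by
      rw [← integral_add (integrable_ip B f g) (integrable_ip B f' g)]
      exact integral_congr_ae (.of_forall fun t => ip_add_left _ _ _))
    (fun c f g => by
      rw [← integral_smul]
      exact integral_congr_ae (.of_forall fun t => ip_smul_left _ _ _))
    (fun f g g' => by
      rw [← integral_add (integrable_ip B f g) (integrable_ip B f g')]
      exact integral_congr_ae (.of_forall fun t => ip_add_right _ _ _))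
    (fun c f g => by
      rw [← integral_smul]
      exact integral_congr_ae (.of_forall fun t => ip_smul_right _ _ _))
  ract b :=
    { toFun := fun f =>
        { toFun := fun t => ract (f t) b
          continuous_toFun := (continuous_ract b).comp f.continuous
          hasCompactSupport' := f.hasCompactSupport.comp_left (g := fun x => ract x b)
            ((ractₗ b : E →ₗ[ℂ] E).map_zero) }
      map_add' := fun f g => CompactlySupportedContinuousMap.ext fun t =>
        (ractₗ b : E →ₗ[ℂ] E).map_add (f t) (g t)
      map_smul' := fun c f => CompactlySupportedContinuousMap.ext fun t =>
        (ractₗ b : E →ₗ[ℂ] E).map_smul c (f t) }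
  star_form f g := by
    have := (starL' ℝ : B ≃L[ℝ] B).toContinuousLinearMap.integral_comp_comm
      (integrable_ip B f g)
    refine this.symm.trans ?_
    exact integral_congr_ae (.of_forall fun t => star_ip _ _)
  form_ract f g b := by
    have := ((ContinuousLinearMap.mul ℝ B).flip b).integral_comp_comm (integrable_ip B f g)
    refine Eq.trans ?_ this
    exact integral_congr_ae (.of_forall fun t => ip_ract _ _ _)
  form_self f := by
    let _ := CStarAlgebra.spectralOrder B
    have _ := CStarAlgebra.spectralOrderedRing B
    rw [exists_star_mul_self_iff]
    exact integral_nonneg fun t => exists_star_mul_self_iff.1 (ip_self (f t))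

/-- The Hilbert `B`-module `L²(G, E)`, the completion of `C_c(G, E)`. -/
def L2 : Type _ := (l2Pre G B E).Hilbert

noncomputable instance : NormedAddCommGroup (L2 G B E) :=
  inferInstanceAs (NormedAddCommGroup (l2Pre G B E).Hilbert)

noncomputable instance : NormedSpace ℂ (L2 G B E) :=
  inferInstanceAs (NormedSpace ℂ (l2Pre G B E).Hilbert)

noncomputable instance : HilbertModule B (L2 G B E) :=
  inferInstanceAs (HilbertModule B (l2Pre G B E).Hilbert)

/-- The canonical map `C_c(G, E) → L²(G, E)`. -/
noncomputable def toL2 : C_c(G, E) →ₗ[ℂ] L2 G B E := (l2Pre G B E).toHilbert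

end L2

section Laurent

variable {B E : Type*} [NonUnitalCStarAlgebra B] [NormedAddCommGroup E] [NormedSpace ℂ E]
  [HilbertModule B E] {β : CStarAction G B} (γ : ModuleAction β E)

/-- `T : L²(G, B) → L²(G, E)` is the Laurent operator with symbol `φ`: on `C_c(G, B)` it is
`(T f)(t) = ∫ Δ(s)⁻¹ γ_t⁻¹(φ(t s⁻¹)) f(s) ds`. -/
def IsLaurent (φ : C_c(G, E)) (T : L2 G B B →L[ℂ] L2 G B E) : Prop :=
  ∀ f : C_c(G, B), ∃ g : C_c(G, E),
    (∀ t, g t = ∫ s, (modular s)⁻¹ • ract (γ.toFun t⁻¹ (φ (t * s⁻¹))) (f s) ∂Measure.haar) ∧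
    T (toL2 G B B f) = toL2 G B E g

/-- The reduced crossed product `B ⋊_r G ⊆ L(L²(G, B))`, the C*-algebra generated by the Laurent
operators with symbols in `C_c(G, B)`. (These already form a *-algebra, so that it is their
closure.) -/
noncomputable def crossedAlg (β : CStarAction G B) :
    NonUnitalStarSubalgebra ℂ (adjointableEnd B (L2 G B B)) :=
  (NonUnitalStarAlgebra.adjoin ℂ
    {T : adjointableEnd B (L2 G B B) | ∃ φ : C_c(G, B), IsLaurent β.self φ T.1}).topologicalClosure

instance (β : CStarAction G B) :
    IsClosed (crossedAlg β : Set (adjointableEnd B (L2 G B B))) :=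
  NonUnitalStarSubalgebra.isClosed_topologicalClosure _

/-- `B ⋊_r G` as a C*-algebra. -/
def CrossedProduct (β : CStarAction G B) : Type _ := crossedAlg β

noncomputable instance (β : CStarAction G B) : NonUnitalCStarAlgebra (CrossedProduct β) :=
  inferInstanceAs (NonUnitalCStarAlgebra (crossedAlg β))

/-- The operator underlying an element of `B ⋊_r G`. -/
def CrossedProduct.op {β : CStarAction G B} (T : CrossedProduct β) :
    adjointableEnd B (L2 G B B) := Subtype.val T

/-- `T : L²(G, B) → E` extends the operator
`|ξ⟫ : f ↦ ∫ Δ(t)^(-1/2) γ_t⁻¹(ξ) f(t) dt` on `C_c(G, B)`. -/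
def IsKet (ξ : E) (T : L2 G B B →L[ℂ] E) : Prop :=
  ∀ f : C_c(G, B), T (toL2 G B B f) =
    ∫ t, modular t ^ (-(1 / 2) : ℝ) • ract (γ.toFun t⁻¹ ξ) (f t) ∂Measure.haar

/-- The operators `|ξ⟫ ∈ L(L²(G, B), E)` for the square-integrable `ξ ∈ R`. -/
def kets (R : Set E) : Set (adjointable B (L2 G B B) E) := {T | ∃ ξ ∈ R, IsKet γ ξ T.1}

/-- `R` is relatively continuous: every `ξ ∈ R` is square-integrable, that is, `|ξ⟫` extends to
an adjointable operator, and `⟪ξ|η⟫ = |ξ⟫⋆ |η⟫` lies in `B ⋊_r G` for all `ξ, η ∈ R`. -/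
structure RelativelyContinuous (R : Set E) : Prop where
  squareIntegrable : ∀ ξ ∈ R, ∃ T : adjointable B (L2 G B B) E, IsKet γ ξ T.1
  admissible : IsAdmissible (crossedAlg β) (kets γ R)

variable {γ} in
/-- The Hilbert `B ⋊_r G`-module `F(R)` of a relatively continuous subspace: the closed linear
span of the operators `|ξ⟫ c`, `ξ ∈ R`, `c ∈ B ⋊_r G`, with inner product `⟨S, T⟩ = S⋆ T`. Since
`|ξ * f⟫ = |ξ⟫ λ_f` and `⟪ξ * f|η * g⟫ = |ξ * f⟫⋆ |η * g⟫`, this is the completion of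
`R * C_c(G, B)` for the inner product `⟪·|·⟫`. -/
def F {R : Set E} (h : RelativelyContinuous γ R) : Type _ := Generated h.admissible

noncomputable instance {R : Set E} (h : RelativelyContinuous γ R) : NormedAddCommGroup (F h) :=
  inferInstanceAs (NormedAddCommGroup (Generated h.admissible))

noncomputable instance {R : Set E} (h : RelativelyContinuous γ R) : NormedSpace ℂ (F h) :=
  inferInstanceAs (NormedSpace ℂ (Generated h.admissible))

noncomputable instance {R : Set E} (h : RelativelyContinuous γ R) :
    HilbertModule (CrossedProduct β) (F h) :=
  inferInstanceAs (HilbertModule (crossedAlg β) (Generated h.admissible))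

/-- The Laurent operators with symbol in `C_c(G, E)`. -/
def laurents : Set (adjointable B (L2 G B B) (L2 G B E)) :=
  {T | ∃ φ : C_c(G, E), IsLaurent γ φ T.1}

/-- The Laurent operators with symbols in `C_c(G, E)` are adjointable and generate a Hilbert
`B ⋊_r G`-module. -/
structure HasCrossedModule : Prop where
  exists_op : ∀ φ : C_c(G, E), ∃ T : adjointable B (L2 G B B) (L2 G B E), IsLaurent γ φ T.1
  admissible : IsAdmissible (crossedAlg β) (laurents γ)

variable {γ} in
/-- The Hilbert `B ⋊_r G`-module `E ⋊_r G`: the completion of `C_c(G, E)` for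
`⟨x, y⟩(t) = ∫ β_s⁻¹⟨x(s), y(s t)⟩ ds` and
`(x f)(t) = ∫ x(s) β_s(f(s⁻¹ t)) ds`, realised by the Laurent operators `λ_x`, for which
`λ_x⋆ λ_y = λ_⟨x, y⟩` and `λ_x λ_f = λ_(x f)`. -/
def CrossedModule (h : HasCrossedModule γ) : Type _ := Generated h.admissible

noncomputable instance (h : HasCrossedModule γ) : NormedAddCommGroup (CrossedModule h) :=
  inferInstanceAs (NormedAddCommGroup (Generated h.admissible))

noncomputable instance (h : HasCrossedModule γ) : NormedSpace ℂ (CrossedModule h) :=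
  inferInstanceAs (NormedSpace ℂ (Generated h.admissible))

noncomputable instance (h : HasCrossedModule γ) :
    HilbertModule (CrossedProduct β) (CrossedModule h) :=
  inferInstanceAs (HilbertModule (crossedAlg β) (Generated h.admissible))

/-- The Laurent operator underlying an element of `E ⋊_r G`. -/
noncomputable def CrossedModule.op {h : HasCrossedModule γ} (T : CrossedModule h) :
    adjointable B (L2 G B B) (L2 G B E) := Generated.op T

/-- `Φ : A ⋊_r G → L(E ⋊_r G)` is the left action induced by `φ : A → L(E)`: for `f ∈ C_c(G, A)`
and `x ∈ C_c(G, E)`, `Φ(f) x = y` with `y(t) = ∫ φ(f(s)) γ_s(x(s⁻¹ t)) ds`. -/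
def IsInduced {A : Type*} [NonUnitalCStarAlgebra A] (α : CStarAction G A)
    (φ : A →⋆ₙₐ[ℂ] adjointableEnd B E) (hγ : HasCrossedModule γ)
    (Φ : CrossedProduct α →⋆ₙₐ[ℂ] adjointableEnd (CrossedProduct β) (CrossedModule hγ)) : Prop :=
  ∀ (f : C_c(G, A)) (x : C_c(G, E)),
    ∃ (T : CrossedProduct α) (S S' : CrossedModule hγ) (y : C_c(G, E)),
      IsLaurent α.self f T.op.1 ∧ IsLaurent γ x S.op.1 ∧ IsLaurent γ y S'.op.1 ∧
      (∀ t, y t = ∫ s, (φ (f s)).1 (γ.toFun s (x (s⁻¹ * t))) ∂Measure.haar) ∧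
      (Φ T).1 S = S'

/-- The Banach space-valued function `k` lies in `L¹_Δ(G)`, that is, `k`, `Δ^(1/2) k` and
`Δ^(-1/2) k` are integrable. -/
def MemL1Δ (k : G → B) : Prop :=
  Integrable k Measure.haar ∧
  Integrable (fun s => modular s ^ (1 / 2 : ℝ) • k s) Measure.haar ∧
  Integrable (fun s => modular s ^ (-(1 / 2) : ℝ) • k s) Measure.haar

/-- `R` is relatively `L¹`: for all `ξ, η ∈ R` the function
`⟪ξ|η⟫ : s ↦ Δ(s)^(-1/2) ⟨ξ, γ_s(η)⟩` lies in `L¹_Δ(G, B)`. -/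
def RelativelyL1 (R : Set E) : Prop :=
  ∀ ξ ∈ R, ∀ η ∈ R,
    MemL1Δ fun s => modular s ^ (-(1 / 2) : ℝ) • (ip ξ (γ.toFun s η) : B)

end Laurent

end HilbertModule

end Crossed

set_option linter.unusedSectionVars false

namespace HilbertModule

/-! ### Approximate units -/

section ApproximateUnit

/-! Both parts are instances of one statement, `exists_unitaryEquiv_induced`. Let D be an
equivariant Hilbert A-module, φ : A → L(E) equivariant and nondegenerate, and let an equivariant
bilinear map τ exhibit a module as the interior tensor product D ⊗_φ E (`IsTensorModel`). If R ⊆ D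
is dense and relatively L¹, then so is R' = span τ(R × E), and F(R') ≅ F(R) ⊗ (E ⋊_r G). Part 1 is E
⊗_B E⋆ = K(E) with τ(ξ, η⋆) = |ξ⟩⟨η|. Part 2 is A ⊗_φ E = E with τ(a, ξ) = φ(a)ξ.

The isomorphism is composition of operators. Since φ is nondegenerate, L²(G, A) ⊗_φ E = L²(G, E)
(`isTensorModel_l2Tensor`). Hence every adjointable S : L²(G, A) → D amplifies to S ⊗ 1 : L²(G, E) →
D ⊗_φ E, functorially and compatibly with adjoints. Elements of E ⋊_r G are operators X : L²(G, B) →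
L²(G, E), and the map is (S, X) ↦ (S ⊗ 1)X.

Inner products match because ((S ⊗ 1)X)⋆(S' ⊗ 1)X' = X⋆(S⋆S' ⊗ 1)X', and T ↦ (T ⊗ 1)X is the
prescribed left action of A ⋊_r G on E ⋊_r G (`amplify_laurentEnd_laurentOp`).

For the range, let (M_e f)(t) = γ_t⁻¹(e) f(t). Then (|d⟫ ⊗ 1) M_e = |τ(d, e)⟫
(`isKet_map_creationOp`). Moreover M_e λ_h = λ_(e h), so that E ⋊_r G is the closed span of the
operators M_e c with c ∈ B ⋊_r G (`mulEnd_creationOp_mem`, `crossedSpan_le`). Hence the map takes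
values in F(R') and reaches the generators |τ(d, e)⟫ c.

That dense relatively L¹ subspaces are relatively continuous follows from Fubini: |ξ⟫⋆|η⟫ is
convolution by k(r) = Δ(r)^(-1/2)⟨ξ, γ_r η⟩ (`ip_ketFun`). This operator lies in B ⋊_r G because k
is an L¹-limit of compactly supported symbols (`exists_mem_crossedAlg`). The case ξ = η bounds |ξ⟫,
and its adjoint is known on the vectors |η⟫g, which span a dense subspace. Finally R' is relatively
L¹ because the symbol of a pair of simple tensors is ⟨e, φ(k(s)) γ_s e'⟩, which is dominated by a
multiple of ‖k(s)‖. -/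

theorem exists_approxUnit {A : Type*} [NonUnitalCStarAlgebra A] (a : A) {ε : ℝ} (hε : 0 < ε) :
    ∃ u : A, ‖u‖ ≤ 1 ∧ ‖a - a * u‖ < ε := by
  let _ := CStarAlgebra.spectralOrder A
  have _ := CStarAlgebra.spectralOrderedRing A
  have h := CStarAlgebra.increasingApproximateUnit A
  have h1 := Metric.tendsto_nhds.1 (h.tendsto_mul_left a) ε hε
  obtain ⟨u, hu1, hu2⟩ := (h1.and h.eventually_norm).exists
  refine ⟨u, hu2, ?_⟩
  rwa [dist_comm, dist_eq_norm] at hu1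

theorem exists_mem_approxUnit {A : Type*} [NonUnitalCStarAlgebra A]
    (C : NonUnitalStarSubalgebra ℂ A) [IsClosed (C : Set A)] {a : A} (ha : a ∈ C) {ε : ℝ}
    (hε : 0 < ε) : ∃ u ∈ C, ‖u‖ ≤ 1 ∧ ‖a - a * u‖ < ε := by
  obtain ⟨u, hu, h⟩ := exists_approxUnit (⟨a, ha⟩ : C) hε
  exact ⟨u.1, u.2, hu, h⟩

end ApproximateUnit

/-! ### The right action and the inner product as continuous maps -/

section Basic

variable {B E : Type*} [NonUnitalCStarAlgebra B] [NormedAddCommGroup E] [NormedSpace ℂ E]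
  [HilbertModule B E]

theorem ract_add (x : E) (b c : B) : ract x (b + c) = ract x b + ract x c :=
  ext_ip B fun z => by simp only [ip_ract, ip_add_right, mul_add]

theorem ract_smul (c : ℂ) (x : E) (b : B) : ract x (c • b) = c • ract x b :=
  ext_ip B fun z => by simp only [ip_ract, ip_smul_right, mul_smul_comm]

theorem ract_mul (x : E) (b c : B) : ract x (b * c) = ract (ract x b) c :=
  ext_ip B fun z => by simp only [ip_ract, mul_assoc]

theorem add_ract (x y : E) (b : B) : ract (x + y) b = ract x b + ract y b :=
  (ractₗ b : E →ₗ[ℂ] E).map_add x y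

theorem smul_ract (c : ℂ) (x : E) (b : B) : ract (c • x) b = c • ract x b :=
  (ractₗ b : E →ₗ[ℂ] E).map_smul c x

theorem ip_sub_left (x y z : E) : (ip (x - y) z : B) = ip x z - ip y z := by
  rw [← star_ip, ip_sub_right, star_sub, star_ip, star_ip]

variable (B E) in
/-- The right action as a bounded bilinear map. -/
noncomputable def ractL : E →L[ℂ] B →L[ℂ] E :=
  LinearMap.mkContinuous₂ (LinearMap.mk₂ ℂ (fun x (b : B) => ract x b) add_ract smul_ract
    ract_add ract_smul) 1 fun x b => by rw [one_mul]; exact norm_ract_le x b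

variable (B) in
/-- The inner product with a fixed vector as a bounded linear map. -/
noncomputable def ipL (x : E) : E →L[ℂ] B :=
  (ipₗ x : E →ₗ[ℂ] B).mkContinuous ‖x‖ fun y => norm_ip_le B x y

theorem ipL_apply (x y : E) : ipL B x y = ip x y := rfl

theorem ract_zero (x : E) : ract x (0 : B) = 0 := (ractL B E x).map_zero

theorem zero_ract (b : B) : ract (0 : E) b = 0 := (ractₗ b : E →ₗ[ℂ] E).map_zero

theorem continuous_ract₂ : Continuous fun z : E × B => ract z.1 z.2 :=
  (ractL B E).continuous₂

theorem _root_.Continuous.ract {T : Type*} [TopologicalSpace T] {f : T → E} {g : T → B}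
    (hf : Continuous f) (hg : Continuous g) : Continuous fun t => ract (f t) (g t) :=
  continuous_ract₂.comp (hf.prodMk hg)

theorem _root_.Continuous.ip {T : Type*} [TopologicalSpace T] {f g : T → E}
    (hf : Continuous f) (hg : Continuous g) : Continuous fun t => (ip (f t) (g t) : B) :=
  continuous_ip.comp (hf.prodMk hg)

variable (B) in
-- An approximate unit u for ⟨x, x⟩ does it, as ⟨x − x u, x − x u⟩ = (a − a u) − u⋆(a − a u) with a
-- = ⟨x, x⟩. Thus E B is dense in E although E need not be full.
theorem exists_ract_near (x : E) {ε : ℝ} (hε : 0 < ε) : ∃ b : B, ‖x - ract x b‖ < ε := by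
  obtain ⟨u, hu, h⟩ := exists_approxUnit (ip x x : B) (ε := ε ^ 2 / 2) (by positivity)
  refine ⟨u, lt_of_pow_lt_pow_left₀ 2 hε.le ?_⟩
  set a : B := ip x x
  have h1 : (ip (x - ract x u) (x - ract x u) : B) = (a - a * u) - star u * (a - a * u) := by
    rw [ip_sub_right, ip_sub_left, ip_ract, ip_sub_left, ip_ract_left, mul_sub, sub_mul, mul_assoc]
    simp only [a]
    abel
  rw [norm_sq (B := B), h1]
  have h2 : ‖star u * (a - a * u)‖ ≤ 1 * ‖a - a * u‖ :=
    (norm_mul_le _ _).trans (by rw [norm_star]; gcongr)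
  linarith [norm_sub_le (a - a * u) (star u * (a - a * u))]

variable (B) in
theorem norm_le_of_ip {x : E} {c : ℝ} (hc : 0 ≤ c) (h : ‖(ip x x : B)‖ ≤ c * ‖x‖) : ‖x‖ ≤ c := by
  rcases (norm_nonneg x).eq_or_lt with h0 | h0
  · rwa [← h0]
  · rw [← norm_sq, pow_two] at h
    exact le_of_mul_le_mul_right h h0

end Basic

/-! ### Criteria for adjointability and membership in generated modules -/

section Adjointable

variable {B H K M : Type*} [NonUnitalCStarAlgebra B] [NormedAddCommGroup H] [NormedSpace ℂ H]
  [HilbertModule B H] [NormedAddCommGroup K] [NormedSpace ℂ K] [HilbertModule B K]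
  [NormedAddCommGroup M] [NormedSpace ℂ M] [HilbertModule B M]

theorem ip_adj (T : adjointable B H K) (x : H) (y : K) :
    (ip (T.1 x) y : B) = ip x ((adj B T).1 y) := isAdjoint_adj B T x y

theorem ip_adj' (T : adjointable B H K) (x : H) (y : K) :
    (ip ((adj B T).1 y) x : B) = ip y (T.1 x) := ((isAdjoint_adj B T).symm B) y x

theorem map_ract (T : adjointable B H K) (x : H) (b : B) :
    T.1 (ract x b) = ract (T.1 x) b :=
  ext_ip B fun z => by rw [← ip_adj', ip_ract, ip_ract, ip_adj']

/-- A bounded operator is adjointable as soon as `⟨V x, y⟩ = ⟨x, z⟩` is solvable in `z` for all `y`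
in a set with dense linear span. -/
theorem mem_adjointable_of_dense {V : H →L[ℂ] K} (Y : Set K)
    (hY : Dense (Submodule.span ℂ Y : Set K))
    (h : ∀ y ∈ Y, ∃ z, ∀ x, (ip (V x) y : B) = ip x z) : V ∈ adjointable B H K := by
  have : CompleteSpace H := HilbertModule.toCompleteSpace B
  let N : Submodule ℂ K :=
    { carrier := {y | ∃ z, ∀ x, (ip (V x) y : B) = ip x z}
      zero_mem' := ⟨0, fun x => by rw [ip_zero_right, ip_zero_right]⟩
      add_mem' := by
        rintro y y' ⟨z, hz⟩ ⟨z', hz'⟩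
        exact ⟨z + z', fun x => by rw [ip_add_right, ip_add_right, hz, hz']⟩
      smul_mem' := by
        rintro c y ⟨z, hz⟩
        exact ⟨c • z, fun x => by rw [ip_smul_right, ip_smul_right, hz]⟩ }
  -- Taking x = z gives ‖z‖² = ‖⟨V z, y⟩‖. This bound makes solutions for a convergent sequence of
  -- y's a Cauchy sequence, so the set of solvable y is closed.
  have hbd : ∀ y z, (∀ x, (ip (V x) y : B) = ip x z) → ‖z‖ ≤ ‖V‖ * ‖y‖ := by
    intro y z hz
    rcases (norm_nonneg z).eq_or_lt with h0 | h0
    · rw [← h0]; positivity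
    · refine le_of_mul_le_mul_right ?_ h0
      rw [← pow_two, norm_sq (B := B), ← hz]
      refine (norm_ip_le B _ _).trans ?_
      have := V.le_opNorm z
      nlinarith [norm_nonneg y]
  have hall : ∀ y, ∃ z, ∀ x, (ip (V x) y : B) = ip x z := by
    intro y
    have hy : y ∈ closure (N : Set K) :=
      closure_mono (Submodule.span_le.2 fun y hy => h y hy) (hY y)
    obtain ⟨u, hu, hlim⟩ := mem_closure_iff_seq_limit.1 hy
    choose z hz using hu
    have hc : CauchySeq z := by
      refine Metric.cauchySeq_iff'.2 fun ε hε => ?_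
      obtain ⟨n, hn⟩ := Metric.cauchySeq_iff'.1 hlim.cauchySeq (ε / (‖V‖ + 1)) (by positivity)
      refine ⟨n, fun m hm => ?_⟩
      have h1 := hbd (u m - u n) (z m - z n) fun x => by
        rw [ip_sub_right, ip_sub_right, hz, hz]
      have h2 := hn m hm
      rw [dist_eq_norm] at h2 ⊢
      rw [lt_div_iff₀ (by positivity)] at h2
      nlinarith [norm_nonneg (u m - u n), norm_nonneg V]
    obtain ⟨w, hw⟩ := cauchySeq_tendsto_of_complete hc
    refine ⟨w, fun x => ?_⟩
    have h1 := ((ipL B (V x)).continuous.tendsto y).comp hlim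
    have h2 := ((ipL B x).continuous.tendsto w).comp hw
    exact tendsto_nhds_unique (h1.congr fun n => hz n x) h2
  choose z hz using hall
  exact ⟨LinearMap.mkContinuous
    { toFun := z
      map_add' := fun a b => ext_ip B fun x => by
        rw [← hz, ip_add_right, ip_add_right, hz, hz]
      map_smul' := fun c a => ext_ip B fun x => by
        rw [← hz, RingHom.id_apply, ip_smul_right, ip_smul_right, hz] } ‖V‖
    fun y => hbd y (z y) (hz y), fun x y => hz y x⟩

/-- Composition with a fixed operator on the left, as a bounded linear map. -/
noncomputable def compL (T : adjointable B K M) : adjointable B H K →L[ℂ] adjointable B H M :=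
  LinearMap.mkContinuous ⟨⟨fun S => compA B T S, fun _ _ =>
    Subtype.ext (ContinuousLinearMap.comp_add _ _ _)⟩, fun _ _ =>
    Subtype.ext (ContinuousLinearMap.comp_smul _ _ _)⟩ ‖T‖
    fun _ => ContinuousLinearMap.opNorm_comp_le _ _

theorem mulEnd_mulEnd (T : adjointable B H K) (c d : adjointableEnd B H) :
    mulEnd (mulEnd T c) d = mulEnd T (c * d) := rfl

theorem mulEnd_compA (T : adjointable B K M) (S : adjointable B H K) (c : adjointableEnd B H) :
    mulEnd (compA B T S) c = compA B T (mulEnd S c) := rfl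

/-- An operator `T ∈ X` lies in the Hilbert module generated by an admissible set `X`. -/
theorem mem_spanSubmodule (C : NonUnitalStarSubalgebra ℂ (adjointableEnd B H))
    [IsClosed (C : Set (adjointableEnd B H))] {X : Set (adjointable B H K)}
    (hX : IsAdmissible C X) {T : adjointable B H K} (hT : T ∈ X) : T ∈ spanSubmodule C X := by
  refine Metric.mem_closure_iff.2 fun ε hε => ?_
  -- With u an approximate unit for a = T⋆T inside C, ‖T − T u‖² is at most 2‖a − a u‖ < ε².
  obtain ⟨u, huC, hu, h⟩ := exists_mem_approxUnit C (hX T hT T hT) (ε := ε ^ 2 / 2)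
    (by positivity)
  refine ⟨mulEnd T u, Submodule.subset_span ⟨T, hT, u, huC, rfl⟩, ?_⟩
  rw [dist_eq_norm]
  refine lt_of_pow_lt_pow_left₀ 2 hε.le ?_
  set a := starMul T T
  have h1 : starMul (T - mulEnd T u) (T - mulEnd T u) = (a - a * u) - star u * (a - a * u) := by
    have e1 : ∀ S S' S'' : adjointable B H K, starMul S (S' - S'') = starMul S S' - starMul S S'' :=
      fun S S' S'' => (starMulL S).map_sub S' S''
    have e2 : ∀ S S' S'' : adjointable B H K, starMul (S - S') S'' = starMul S S'' - starMul S' S'' :=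
      fun S S' S'' => by rw [← star_starMul, e1, star_sub, star_starMul, star_starMul]
    have e3 : ∀ S, starMul (mulEnd T u) S = star u * starMul T S := fun S => by
      rw [← star_starMul, starMul_mulEnd, star_mul, star_starMul]
    rw [e1, e2, starMul_mulEnd, e2, e3, mul_sub, sub_mul, mul_assoc]
    simp only [a]
    abel
  refine (norm_starMul_self _).trans_lt ?_
  rw [h1]
  have h2 : ‖star u * (a - a * u)‖ ≤ 1 * ‖a - a * u‖ :=
    (norm_mul_le _ _).trans (by rw [norm_star]; gcongr)
  linarith [norm_sub_le (a - a * u) (star u * (a - a * u))]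

end Adjointable

/-! ### Unitary equivalences -/

section Unitary

variable {D X Y : Type*} [NonUnitalCStarAlgebra D] [AddCommGroup X] [Module ℂ X]
  [NormedAddCommGroup Y] [NormedSpace ℂ Y] [HilbertModule D Y]

/-- A linear map with dense range that respects the inner products identifies a Hilbert module with
the completion of a pre-Hilbert module. -/
theorem nonempty_unitaryEquiv (p : PreHilbertModule D X) (U : X →ₗ[ℂ] Y)
    (hU : ∀ x y, (ip (U x) (U y) : D) = p.form x y) (hd : DenseRange U) :
    Nonempty (UnitaryEquiv D Y p.Hilbert) := by
  have : CompleteSpace Y := HilbertModule.toCompleteSpace D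
  let U' : p.Space →ₗᵢ[ℂ] Y :=
    { toLinearMap := U
      norm_map' := fun x => by
        rw [norm_eq_sqrt (B := D)]
        exact congrArg (fun d => √‖d‖) (hU x x) }
  let V : p.Hilbert →L[ℂ] Y := U'.toContinuousLinearMap.fromCompletion
  have hV : ∀ x : p.Space, V (x : p.Hilbert) = U' x := fun x =>
    Completion.extension_coe U'.toContinuousLinearMap.uniformContinuous x
  have hip : ∀ x y, (ip (V x) (V y) : D) = ip x y := fun x y => by
    induction x, y using Completion.induction_on₂ with
    | hp => exact isClosed_eq ((V.continuous.comp continuous_fst).ip (V.continuous.comp continuous_snd))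
              (continuous_fst.ip continuous_snd)
    | ih x y =>
      rw [hV, hV]
      exact (hU x y).trans (p.ipC_coe x y).symm
  have hn : ∀ x, ‖V x‖ = ‖x‖ := fun x => by
    rw [norm_eq_sqrt (B := D) (V x), norm_eq_sqrt (B := D) x, hip]
  have hi : Isometry V := AddMonoidHomClass.isometry_of_norm V hn
  have hs : Function.Surjective V := by
    rw [← Set.range_eq_univ, ← hi.isClosedEmbedding.isClosed_range.closure_eq]
    refine Dense.closure_eq (hd.mono ?_)
    rintro _ ⟨x, rfl⟩
    exact ⟨p.toHilbert x, hV x⟩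
  let e : p.Hilbert ≃ₗ[ℂ] Y := LinearEquiv.ofBijective V.toLinearMap ⟨hi.injective, hs⟩
  have he : ∀ x, V (e.symm x) = x := fun x => e.apply_symm_apply x
  have hip' : ∀ x y, (ip (e.symm x) (e.symm y) : D) = ip x y := fun x y => by
    rw [← hip, he, he]
  -- Compatibility with the right action is automatic: both sides have the same inner product with
  -- every vector in the range of the surjective isometry.
  refine ⟨{ e.symm with map_ip := hip', map_ract := fun x c => ext_ip D fun z => ?_ }⟩
  obtain ⟨y, rfl⟩ := e.symm.surjective z
  change (ip (e.symm y) (e.symm (ract x c)) : D) = ip (e.symm y) (ract (e.symm x) c)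
  rw [hip', ip_ract, ip_ract, hip']

end Unitary

/-! ### Concrete interior tensor products -/

section TensorModel

variable {C D X X' X'' Y M M' M'' : Type*} [NonUnitalCStarAlgebra C] [NonUnitalCStarAlgebra D]
  [NormedAddCommGroup X] [NormedSpace ℂ X] [HilbertModule C X]
  [NormedAddCommGroup X'] [NormedSpace ℂ X'] [HilbertModule C X']
  [NormedAddCommGroup X''] [NormedSpace ℂ X''] [HilbertModule C X'']
  [NormedAddCommGroup Y] [NormedSpace ℂ Y] [HilbertModule D Y]
  [NormedAddCommGroup M] [NormedSpace ℂ M] [HilbertModule D M]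
  [NormedAddCommGroup M'] [NormedSpace ℂ M'] [HilbertModule D M']
  [NormedAddCommGroup M''] [NormedSpace ℂ M''] [HilbertModule D M'']
  {Φ : C →⋆ₙₐ[ℂ] adjointableEnd D Y}

variable (Φ) in
/-- The bilinear map `τ : X × Y → M` exhibits `M` as the interior tensor product `X ⊗_Φ Y`. -/
structure IsTensorModel (τ : X →ₗ[ℂ] Y →ₗ[ℂ] M) : Prop where
  ip_eq : ∀ x y x' y', (ip (τ x y) (τ x' y') : D) = ip y ((Φ (ip x x')).1 y')
  dense : Dense (Submodule.span ℂ {z | ∃ x y, z = τ x y} : Set M)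

/-- The hypothesis is S⋆S + R⋆R = c in weak form; sesquilinearity carries it from simple tensors to
the form on the algebraic tensor product. -/
theorem starMul_add_eq_smul {c : ℂ} {S : X →ₗ[ℂ] X'} {R : X →ₗ[ℂ] X}
    (h : ∀ x y, (ip (S x) (S y) + ip (R x) (R y) : C) = c • ip x y) (u v : X ⊗[ℂ] Y) :
    tensorForm Φ (S.rTensor Y u) (S.rTensor Y v) + tensorForm Φ (R.rTensor Y u) (R.rTensor Y v) =
      c • tensorForm Φ u v := by
  induction u with
  | zero => simp
  | add u u' h h' =>
    simp only [map_add, LinearMap.add_apply, smul_add, ← h, ← h']; abel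
  | tmul x y =>
    induction v with
    | zero => simp
    | add v v' h h' =>
      simp only [map_add, smul_add, ← h, ← h']; abel
    | tmul x' y' =>
      simp only [LinearMap.rTensor_tmul, tensorForm_tmul]
      rw [← ip_smul_right, ← ip_add_right]
      congr 1
      have : Φ (ip (S x) (S x')) + Φ (ip (R x) (R x')) = c • Φ (ip x x') := by
        rw [← map_add, h, map_smul]
      exact congrArg (fun T : adjointableEnd D Y => T.1 y') this

/-- The operator ‖S‖² − S⋆S is positive, say R⋆R. The forms of (S ⊗ 1)u and (R ⊗ 1)u are positive
and add up to ‖S‖² times the form of u, so the first is dominated. This is the boundedness of S ⊗ 1.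
-/
theorem norm_tensorForm_rTensor_le (S : adjointable C X X') (u : X ⊗[ℂ] Y) :
    ‖tensorForm Φ (S.1.toLinearMap.rTensor Y u) (S.1.toLinearMap.rTensor Y u)‖ ≤
      ‖S.1‖ ^ 2 * ‖tensorForm Φ u u‖ := by
  obtain ⟨R, hR⟩ : ∃ R : adjointableEnd C X,
      ((‖S.1‖ ^ 2 : ℝ) : ℂ) • 1 - starMul S S = star R * R := by
    let _ := CStarAlgebra.spectralOrder (adjointableEnd C X)
    have _ := CStarAlgebra.spectralOrderedRing (adjointableEnd C X)
    have hn : ‖S.1‖ ^ 2 = ‖starMul S S‖ := norm_starMul_self S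
    rw [exists_star_mul_self_iff, sub_nonneg, hn]
    have := IsSelfAdjoint.le_algebraMap_norm_self (a := starMul S S) (star_starMul S S)
    rw [Algebra.algebraMap_eq_smul_one] at this
    exact this.trans_eq (Complex.coe_smul _ _).symm
  have h : ∀ x y, (ip (S.1 x) (S.1 y) + ip (R.1 x) (R.1 y) : C) =
      ((‖S.1‖ ^ 2 : ℝ) : ℂ) • ip x y := by
    intro x y
    have h1 : (ip (R.1 x) (R.1 y) : C) = ip x ((star R * R).1 y) := by
      rw [← star_star R, star_coe_eq, star_star]; rfl
    rw [h1, ← hR, ← starMul_apply]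
    have h2 : (((‖S.1‖ ^ 2 : ℝ) : ℂ) • 1 - starMul S S : adjointableEnd C X).1 y =
      ((‖S.1‖ ^ 2 : ℝ) : ℂ) • y - (starMul S S).1 y := rfl
    rw [h2, ip_sub_right, ip_smul_right, add_sub_cancel]
  have h1 := starMul_add_eq_smul (Φ := Φ) (S := S.1.toLinearMap) (R := R.1.toLinearMap) h u u
  let _ := CStarAlgebra.spectralOrder D
  have _ := CStarAlgebra.spectralOrderedRing D
  have h2 : 0 ≤ tensorForm Φ (S.1.toLinearMap.rTensor Y u) (S.1.toLinearMap.rTensor Y u) :=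
    exists_star_mul_self_iff.1 ((tensorPre Φ).form_self _)
  have h3 : 0 ≤ tensorForm Φ (R.1.toLinearMap.rTensor Y u) (R.1.toLinearMap.rTensor Y u) :=
    exists_star_mul_self_iff.1 ((tensorPre Φ).form_self _)
  refine (CStarAlgebra.norm_le_norm_of_nonneg_of_le h2
    ((le_add_of_nonneg_right h3).trans_eq h1)).trans_eq ?_
  rw [norm_smul, Complex.norm_real, Real.norm_of_nonneg (by positivity)]

namespace IsTensorModel

variable {τ : X →ₗ[ℂ] Y →ₗ[ℂ] M} {τ' : X' →ₗ[ℂ] Y →ₗ[ℂ] M'} {τ'' : X'' →ₗ[ℂ] Y →ₗ[ℂ] M''}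

theorem ip_lift (h : IsTensorModel Φ τ) (u v : X ⊗[ℂ] Y) :
    (ip (TensorProduct.lift τ u) (TensorProduct.lift τ v) : D) = tensorForm Φ u v := by
  induction u with
  | zero => simp [ip_zero_left]
  | add u u' h h' => simp only [map_add, LinearMap.add_apply, ip_add_left, h, h']
  | tmul x y =>
    induction v with
    | zero => simp [ip_zero_right]
    | add v v' h h' => simp only [map_add, ip_add_right, h, h']
    | tmul x' y' =>
      rw [TensorProduct.lift.tmul, TensorProduct.lift.tmul, h.ip_eq, tensorForm_tmul]

theorem denseRange_lift (h : IsTensorModel Φ τ) : DenseRange (TensorProduct.lift τ) := by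
  refine h.dense.mono ?_
  have : Submodule.span ℂ {z | ∃ x y, z = τ x y} ≤ LinearMap.range (TensorProduct.lift τ) :=
    Submodule.span_le.2 fun z ⟨x, y, hz⟩ => ⟨x ⊗ₜ y, by rw [TensorProduct.lift.tmul, hz]⟩
  exact this

theorem norm_lift (h : IsTensorModel Φ τ) (u : X ⊗[ℂ] Y) :
    ‖TensorProduct.lift τ u‖ = √‖tensorForm Φ u u‖ := by
  rw [norm_eq_sqrt (B := D), h.ip_lift]

theorem norm_le (h : IsTensorModel Φ τ) (x : X) (y : Y) : ‖τ x y‖ ≤ ‖x‖ * ‖y‖ := by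
  refine le_of_sq_le_sq ?_ (by positivity)
  rw [norm_sq (B := D), h.ip_eq]
  refine (norm_ip_le D _ _).trans ?_
  have h1 : ‖(Φ (ip x x)).1 y‖ ≤ ‖x‖ ^ 2 * ‖y‖ :=
    ((Φ (ip x x)).1.le_opNorm y).trans (by
      gcongr
      exact (NonUnitalStarAlgHom.norm_apply_le Φ _).trans_eq (norm_sq x).symm)
  nlinarith [norm_nonneg y]

theorem clm_ext (h : IsTensorModel Φ τ) {Z : Type*} [NormedAddCommGroup Z] [NormedSpace ℂ Z]
    {S T : M →L[ℂ] Z}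
    (hST : ∀ x y, S (τ x y) = T (τ x y)) : S = T := by
  refine ContinuousLinearMap.ext_on h.dense ?_
  rintro _ ⟨x, y, rfl⟩
  exact hST x y

theorem ext_ip (h : IsTensorModel Φ τ) {z w : M}
    (hzw : ∀ x y, (ip (τ x y) z : D) = ip (τ x y) w) : z = w := by
  have h1 : ipL D z = ipL D w := h.clm_ext fun x y => by
    rw [ipL_apply, ipL_apply, ← star_ip, hzw, star_ip]
  refine HilbertModule.ext_ip D fun v => ?_
  rw [← star_ip, ← ipL_apply, h1, ipL_apply, star_ip]

/-- This identity and the balancing relation `ract_left` follow from the inner products and the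
density of simple tensors alone, so they are not demanded of τ. -/
theorem ract_right (h : IsTensorModel Φ τ) (x : X) (y : Y) (d : D) :
    τ x (ract y d) = ract (τ x y) d :=
  h.ext_ip fun x' y' => by rw [ip_ract, h.ip_eq, h.ip_eq, map_ract ⟨_, (Φ _).2⟩, ip_ract]

theorem ract_left (h : IsTensorModel Φ τ) (x : X) (y : Y) (c : C) :
    τ (ract x c) y = τ x ((Φ c).1 y) :=
  h.ext_ip fun x' y' => by
    rw [h.ip_eq, h.ip_eq, ip_ract, map_mul]
    rfl

variable (h : IsTensorModel Φ τ) (h' : IsTensorModel Φ τ') (h'' : IsTensorModel Φ τ'')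

/-- The algebraic map S ⊗ 1 is bounded by `norm_tensorForm_rTensor_le` and extends from the dense
image of X ⊗ Y. Its adjoint is given on simple tensors by S⋆ ⊗ 1, which suffices by
`mem_adjointable_of_dense`. -/
theorem exists_map (h : IsTensorModel Φ τ) (h' : IsTensorModel Φ τ') (S : adjointable C X X') :
    ∃ T : adjointable D M M', ∀ x y, T.1 (τ x y) = τ' (S.1 x) y := by
  have : CompleteSpace M' := HilbertModule.toCompleteSpace D
  let f : X ⊗[ℂ] Y →ₗ[ℂ] M' := TensorProduct.lift τ' ∘ₗ S.1.toLinearMap.rTensor Y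
  have hb : ∀ u, ‖f u‖ ≤ ‖S.1‖ * ‖TensorProduct.lift τ u‖ := by
    intro u
    rw [h.norm_lift, LinearMap.comp_apply, h'.norm_lift]
    refine (Real.sqrt_le_sqrt (norm_tensorForm_rTensor_le S u)).trans_eq ?_
    rw [Real.sqrt_mul (by positivity), Real.sqrt_sq (norm_nonneg S.1)]
  let V := f.extendOfNorm (TensorProduct.lift τ)
  have hV : ∀ x y, V (τ x y) = τ' (S.1 x) y := fun x y =>
    LinearMap.extendOfNorm_eq h.denseRange_lift ⟨_, hb⟩ (x ⊗ₜ y)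
  refine ⟨⟨V, mem_adjointable_of_dense _ h'.dense ?_⟩, hV⟩
  rintro _ ⟨x', y', rfl⟩
  refine ⟨τ ((adj C S).1 x') y', fun z => ?_⟩
  refine h.denseRange_lift.induction_on
    (p := fun z => (ip (V z) (τ' x' y') : D) = ip z (τ ((adj C S).1 x') y')) z
    (isClosed_eq (V.continuous.ip continuous_const) (continuous_id.ip continuous_const)) fun u => ?_
  induction u with
  | zero => simp [ip_zero_left]
  | add u u' h h' => simp only [map_add, ip_add_left, h, h']
  | tmul x y =>
    rw [TensorProduct.lift.tmul, hV, h'.ip_eq, h.ip_eq, ip_adj]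

/-- The operator `S ⊗ 1 : X ⊗_Φ Y → X' ⊗_Φ Y` on concrete interior tensor products. -/
noncomputable def map (S : adjointable C X X') : adjointable D M M' := (exists_map h h' S).choose

theorem map_apply (S : adjointable C X X') (x : X) (y : Y) :
    (map h h' S).1 (τ x y) = τ' (S.1 x) y := (exists_map h h' S).choose_spec x y

/-- Uniqueness of S ⊗ 1: operators agreeing on simple tensors agree. Compatibility with composition,
sums and scalars is read off from this. -/
theorem eq_map {S : adjointable C X X'} {T : adjointable D M M'}
    (hT : ∀ x y, T.1 (τ x y) = τ' (S.1 x) y) : map h h' S = T :=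
  Subtype.ext (h.clm_ext fun x y => by rw [map_apply, hT])

theorem map_comp (T : adjointable C X' X'') (S : adjointable C X X') :
    map h h'' (compA C T S) = compA D (map h' h'' T) (map h h' S) :=
  eq_map h h'' fun x y =>
    (congrArg (map h' h'' T).1 (map_apply h h' S x y)).trans (map_apply h' h'' T _ _)

theorem map_adj (S : adjointable C X X') : map h' h (adj C S) = adj D (map h h' S) := by
  refine (adj_eq D fun z w => ?_).symm
  -- The adjoint relation is first established with a simple tensor in one slot and everything in
  -- the other; conjugating and testing on simple tensors again frees the remaining slot.
  have h1 : ∀ x y, ipL D (τ' x y) ∘L (map h h' S).1 = ipL D ((map h' h (adj C S)).1 (τ' x y)) := by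
    intro x y
    refine h.clm_ext fun x' y' => ?_
    rw [ContinuousLinearMap.comp_apply, map_apply, ipL_apply, ipL_apply, map_apply, h'.ip_eq,
      h.ip_eq, ip_adj']
  have h2 : ipL D z ∘L (map h' h (adj C S)).1 = ipL D ((map h h' S).1 z) := by
    refine h'.clm_ext fun x y => ?_
    have := congrArg (fun f => star (f z)) (h1 x y)
    simp only [ContinuousLinearMap.comp_apply, ipL_apply, star_ip] at this ⊢
    exact this.symm
  exact (congrArg (fun f => f w) h2).symm

theorem map_add (S T : adjointable C X X') : map h h' (S + T) = map h h' S + map h h' T :=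
  eq_map h h' fun x y => by
    change (map h h' S).1 (τ x y) + (map h h' T).1 (τ x y) = τ' (S.1 x + T.1 x) y
    rw [map_apply, map_apply, _root_.map_add, LinearMap.add_apply]

theorem map_smul (c : ℂ) (S : adjointable C X X') : map h h' (c • S) = c • map h h' S :=
  eq_map h h' fun x y => by
    change c • (map h h' S).1 (τ x y) = τ' (c • S.1 x) y
    rw [map_apply, _root_.map_smul, LinearMap.smul_apply]

theorem norm_map_le (S : adjointable C X X') : ‖map h h' S‖ ≤ ‖S‖ := by
  refine ContinuousLinearMap.opNorm_le_bound _ (norm_nonneg S.1) fun z => ?_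
  refine h.denseRange_lift.induction_on
    (p := fun z => ‖(map h h' S).1 z‖ ≤ ‖S.1‖ * ‖z‖) z
    (isClosed_le (by fun_prop) (by fun_prop)) fun u => ?_
  have : (map h h' S).1 (TensorProduct.lift τ u) =
      TensorProduct.lift τ' (S.1.toLinearMap.rTensor Y u) := by
    induction u with
    | zero => simp
    | add u u' h h' => simp only [_root_.map_add, h, h']
    | tmul x y => exact map_apply h h' S x y
  rw [this, h.norm_lift, h'.norm_lift]
  refine (Real.sqrt_le_sqrt (norm_tensorForm_rTensor_le S u)).trans_eq ?_
  rw [Real.sqrt_mul (by positivity), Real.sqrt_sq (norm_nonneg S.1)]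

/-- The operation `S ↦ S ⊗ 1` as a bounded linear map. -/
noncomputable def mapL : adjointable C X X' →L[ℂ] adjointable D M M' :=
  LinearMap.mkContinuous ⟨⟨map h h', map_add h h'⟩, map_smul h h'⟩ 1
    fun S => by rw [one_mul]; exact norm_map_le h h' S

end IsTensorModel

end TensorModel

end HilbertModule

section Haar

variable {G : Type*} [Group G] [TopologicalSpace G] [IsTopologicalGroup G]
  [LocallyCompactSpace G] [MeasurableSpace G] [BorelSpace G]

/-! ### Haar integrals of compactly supported functions -/

theorem modular_pos (t : G) : 0 < modular t :=
  inv_pos.2 (NNReal.coe_pos.2 (Measure.modularCharacterFun_pos t))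

theorem modular_mul (s t : G) : modular (s * t) = modular s * modular t := by
  rw [modular, Measure.modularCharacterFun_map_mul, NNReal.coe_mul, mul_inv]; rfl

theorem modular_one : modular (1 : G) = 1 := by
  rw [modular, Measure.modularCharacterFun_map_one, NNReal.coe_one, inv_one]

theorem modular_inv (t : G) : modular t⁻¹ = (modular t)⁻¹ :=
  eq_inv_of_mul_eq_one_left (by rw [← modular_mul, inv_mul_cancel, modular_one])

/-- The image of Haar measure under a right translation is again left invariant. By uniqueness its
integrals of compactly supported continuous functions differ by a constant factor, which is the
modular character. -/
theorem integral_mul_right_real {f : G → ℝ} (hf : Continuous f) (hc : HasCompactSupport f) (t : G) :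
    ∫ s, f (s * t) ∂Measure.haar = (modular t)⁻¹ * ∫ s, f s ∂Measure.haar := by
  have h := Measure.integral_isMulLeftInvariant_eq_smul_of_hasCompactSupport
    (Measure.map (· * t) (Measure.haar : Measure G)) Measure.haar hf hc
  rw [← Measure.modularCharacterFun_eq_haarScalarFactor, integral_smul_nnreal_measure,
    integral_map (measurable_mul_const t).aemeasurable hf.aestronglyMeasurable] at h
  rw [h, modular, inv_inv]
  rfl

theorem exists_integral_pos : ∃ f : G → ℝ, Continuous f ∧ HasCompactSupport f ∧
    0 < ∫ s, f s ∂Measure.haar := by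
  obtain ⟨⟨f, f_cont⟩, f_comp, f_nonneg, f_one⟩ :
    ∃ f : C(G, ℝ), HasCompactSupport f ∧ 0 ≤ f ∧ f 1 ≠ 0 := exists_continuous_nonneg_pos 1
  exact ⟨f, f_cont, f_comp,
    f_cont.integral_pos_of_hasCompactSupport_nonneg_nonzero f_comp f_nonneg f_one⟩

/-- The support condition for kernels `f s t` that vanish unless `s ∈ K` and `t ∈ L s`. -/
theorem HasCompactSupport.kernel [T2Space G] {F : Type*} [Zero F] {f : G → G → F} {K L : Set G}
    (hK : IsCompact K) (hL : IsCompact L) (h : ∀ s t, f s t ≠ 0 → s ∈ K ∧ s⁻¹ * t ∈ L) :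
    HasCompactSupport f.uncurry := by
  refine HasCompactSupport.intro (hK.prod (hK.mul hL)) fun z hz => ?_
  by_contra h0
  obtain ⟨h1, h2⟩ := h z.1 z.2 h0
  exact hz ⟨h1, z.1, h1, _, h2, by simp⟩

theorem HasCompactSupport.kernel_prod [T2Space G] {F : Type*} [Zero F] {f : G → G → F}
    {K L : Set G} (hK : IsCompact K) (hL : IsCompact L) (h : ∀ s t, f s t ≠ 0 → s ∈ K ∧ t ∈ L) :
    HasCompactSupport f.uncurry := by
  refine HasCompactSupport.intro (hK.prod hL) fun z hz => ?_
  by_contra h0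
  exact hz (h z.1 z.2 h0)

theorem continuous_integral_of_hasCompactSupport {F : Type*} [NormedAddCommGroup F]
    [NormedSpace ℝ F] {f : G → G → F} (hf : Continuous f.uncurry)
    (hc : HasCompactSupport f.uncurry) :
    Continuous fun t => ∫ s, f s t ∂Measure.haar := by
  have h := continuousOn_integral_of_compact_support (μ := (Measure.haar : Measure G))
    (f := fun t s => f s t) (s := Set.univ) (hc.isCompact.image continuous_fst)
    (hf.comp continuous_swap).continuousOn fun t s _ hs => by
      by_contra h0
      exact hs ⟨(s, t), subset_tsupport _ h0, rfl⟩
  exact continuousOn_univ.1 h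

theorem hasCompactSupport_integral [T2Space G] {F : Type*} [NormedAddCommGroup F]
    [NormedSpace ℝ F] {f : G → G → F} (hc : HasCompactSupport f.uncurry) :
    HasCompactSupport fun t => ∫ s, f s t ∂Measure.haar := by
  refine HasCompactSupport.intro (hc.isCompact.image continuous_snd) fun t ht => ?_
  refine integral_eq_zero_of_ae (.of_forall fun s => ?_)
  by_contra h0
  exact ht ⟨(s, t), subset_tsupport _ h0, rfl⟩

/-- Δ(t) is the quotient of ∫ f(s) ds by ∫ f(s t) ds for any f of positive integral, and the
denominator depends continuously on t. -/
theorem continuous_modular [T2Space G] : Continuous (modular : G → ℝ) := by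
  obtain ⟨f, hf, hc, hpos⟩ := exists_integral_pos (G := G)
  have h : (modular : G → ℝ) = fun t => (∫ s, f s ∂Measure.haar) / ∫ s, f (s * t) ∂Measure.haar := by
    ext t
    rw [integral_mul_right_real hf hc]
    have := (modular_pos t).ne'
    field_simp
  rw [h]
  refine continuous_const.div ?_ fun t => ?_
  · refine continuous_iff_continuousAt.2 fun t₀ => ?_
    -- For t in a compact neighbourhood K of t₀ all functions s ↦ f(s t) are supported in the fixed
    -- compact set (supp f) K⁻¹.
    obtain ⟨K, hK, hKt⟩ := exists_compact_mem_nhds t₀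
    have := continuousOn_integral_of_compact_support (μ := (Measure.haar : Measure G))
      (f := fun t s => f (s * t)) (s := K) (hc.isCompact.mul hK.inv)
      (hf.comp (continuous_snd.mul continuous_fst)).continuousOn fun t s ht hs => by
        by_contra h0
        exact hs ⟨s * t, subset_tsupport _ h0, t⁻¹, Set.inv_mem_inv.2 ht, by simp⟩
    exact this.continuousAt hKt
  · rw [integral_mul_right_real hf hc]
    exact (mul_pos (inv_pos.2 (modular_pos t)) hpos).ne'

theorem continuous_modular_inv [T2Space G] : Continuous fun t : G => (modular t)⁻¹ :=
  continuous_modular.inv₀ fun t => (modular_pos t).ne'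

theorem continuous_modular_rpow [T2Space G] (r : ℝ) : Continuous fun t : G => modular t ^ r :=
  continuous_modular.rpow_const fun t => .inl (modular_pos t).ne'

/-- Multiply by ∫ g ≠ 0. Since Δ(s)⁻¹ ∫ g = ∫ g(t s) dt, Fubini and left invariance, each used
twice, turn the left side into (∫ g)(∫ f). The vector-valued formula thus rests on right translation
of scalar functions only. -/
theorem integral_modular_inv_smul_inv [T2Space G] {F : Type*} [NormedAddCommGroup F]
    [NormedSpace ℝ F] [CompleteSpace F] {f : G → F} (hf : Continuous f) (hc : HasCompactSupport f) :
    ∫ s, (modular s)⁻¹ • f s⁻¹ ∂Measure.haar = ∫ s, f s ∂Measure.haar := by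
  obtain ⟨g, hg, hgc, hpos⟩ := exists_integral_pos (G := G)
  have hK : IsCompact (tsupport f) := hc
  have hL : IsCompact (tsupport g) := hgc
  refine smul_right_injective F hpos.ne' ?_
  have h1 : ∀ s : G, (∫ t, g t ∂Measure.haar) • (modular s)⁻¹ • f s⁻¹ =
      ∫ t, g (t * s) • f s⁻¹ ∂Measure.haar := fun s => by
    rw [integral_smul_const, integral_mul_right_real hg hgc, smul_smul, mul_comm]
  calc (∫ t, g t ∂Measure.haar) • ∫ s, (modular s)⁻¹ • f s⁻¹ ∂Measure.haar
      = ∫ s, ∫ t, g (t * s) • f s⁻¹ ∂Measure.haar ∂Measure.haar := by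
        rw [← integral_smul]; simp only [h1]
    _ = ∫ t, ∫ s, g (t * s) • f s⁻¹ ∂Measure.haar ∂Measure.haar := by
        refine integral_integral_swap_of_hasCompactSupport
          (by change Continuous fun z : G × G => g (z.2 * z.1) • f z.1⁻¹; fun_prop) ?_
        refine HasCompactSupport.kernel_prod hK.inv (hL.mul hK) fun s t h => ?_
        have h2 := subset_tsupport _ (right_ne_zero_of_smul h)
        exact ⟨Set.mem_inv.2 h2, t * s, subset_tsupport _ (left_ne_zero_of_smul h), s⁻¹, h2, by simp⟩
    _ = ∫ t, ∫ s, g s • f (s⁻¹ * t) ∂Measure.haar ∂Measure.haar := by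
        refine integral_congr_ae (.of_forall fun t => ?_)
        refine Eq.trans ?_ (integral_mul_left_eq_self (fun s => g s • f (s⁻¹ * t)) t)
        simp
    _ = ∫ s, ∫ t, g s • f (s⁻¹ * t) ∂Measure.haar ∂Measure.haar := by
        refine (integral_integral_swap_of_hasCompactSupport
          (by change Continuous fun z : G × G => g z.1 • f (z.1⁻¹ * z.2); fun_prop) ?_).symm
        exact HasCompactSupport.kernel hL hK fun s t h =>
          ⟨subset_tsupport _ (left_ne_zero_of_smul h), subset_tsupport _ (right_ne_zero_of_smul h)⟩
    _ = (∫ t, g t ∂Measure.haar) • ∫ s, f s ∂Measure.haar := by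
        rw [← integral_smul_const]
        refine integral_congr_ae (.of_forall fun s => ?_)
        exact (integral_smul _ _).trans (congrArg _ (integral_mul_left_eq_self f s⁻¹))

/-- The substitution `s = r⁻¹ t`. -/
theorem integral_modular_inv_smul [T2Space G] {F : Type*} [NormedAddCommGroup F]
    [NormedSpace ℝ F] [CompleteSpace F] {f : G → F} (hf : Continuous f) (hc : HasCompactSupport f)
    (t : G) : ∫ s, (modular s)⁻¹ • f s ∂Measure.haar = ∫ r, f (r⁻¹ * t) ∂Measure.haar := by
  have h := integral_modular_inv_smul_inv (f := fun s => f s⁻¹) (hf.comp continuous_inv)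
    (hc.comp_homeomorph (Homeomorph.inv G))
  simp only [inv_inv] at h
  rw [h]
  refine Eq.trans ?_ (integral_mul_left_eq_self (fun s => f (s⁻¹ * t)) t)
  simp

end Haar

/-! ### Inductive limit approximation -/

section Inductive

variable {G : Type*} [TopologicalSpace G] [LocallyCompactSpace G] [T2Space G]
  {Y Z : Type*} [NormedAddCommGroup Y] [NormedSpace ℂ Y] [NormedAddCommGroup Z] [NormedSpace ℂ Z]

/-- The function `t ↦ χ t • y`. -/
noncomputable def ccSmul (χ : C_c(G, ℂ)) (y : Y) : C_c(G, Y) where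
  toFun t := χ t • y
  continuous_toFun := by fun_prop
  hasCompactSupport' := χ.hasCompactSupport.smul_right

/-- A partition of unity subordinate to sets on which φ varies by less than ε/2 does it, with the
values of φ replaced by nearby elements of the span. The compact set K is fixed before ε, so this is
density for uniform convergence with common compact support. -/
theorem exists_span_ccSmul_near {D : Set Y} (hD : Dense (Submodule.span ℂ D : Set Y))
    (φ : C_c(G, Y)) : ∃ K : Set G, IsCompact K ∧ ∀ ε > 0,
      ∃ h ∈ Submodule.span ℂ {h : C_c(G, Y) | ∃ χ, ∃ y ∈ D, h = ccSmul χ y},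
        (∀ t ∉ K, (φ - h) t = 0) ∧ ∀ t, ‖(φ - h) t‖ ≤ ε := by
  -- The cutoff ρ is 1 on the support of φ. Multiplying the partition functions by ρ confines all
  -- approximants to the compact set `tsupport ρ`, whatever ε is.
  obtain ⟨ρ, hρ1, -, hρc, hρ⟩ := exists_continuous_one_zero_of_isCompact
    φ.hasCompactSupport.isCompact isClosed_empty (Set.disjoint_empty _)
  refine ⟨tsupport ρ, hρc, fun ε hε => ?_⟩
  have hρφ : ∀ t, (ρ t : ℂ) • φ t = φ t := fun t => by
    by_cases ht : t ∈ tsupport φ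
    · rw [hρ1 ht]; simp
    · rw [image_eq_zero_of_notMem_tsupport ht, smul_zero]
  obtain ⟨S, hS⟩ := hρc.isCompact.elim_finite_subcover
    (fun s : G => {t | ‖φ t - φ s‖ < ε / 2})
    (fun s => isOpen_lt (by fun_prop) continuous_const)
    (fun s _ => Set.mem_iUnion.2 ⟨s, by simpa using half_pos hε⟩)
  let e := S.equivFin
  obtain ⟨χ, hχ1, hχ2, hχ3, hχ4⟩ := exists_continuous_sum_one_of_isOpen_isCompact
    (s := fun i : Fin S.card => {t | ‖φ t - φ (e.symm i)‖ < ε / 2})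
    (fun i => isOpen_lt (by fun_prop) continuous_const) hρc.isCompact (fun t ht => by
      obtain ⟨s, hs, h⟩ := Set.mem_iUnion₂.1 (hS ht)
      exact Set.mem_iUnion.2 ⟨e ⟨s, hs⟩, by simpa using h⟩)
  have hy : ∀ s : G, ∃ y ∈ Submodule.span ℂ D, ‖φ s - y‖ < ε / 2 := fun s => by
    obtain ⟨y, hy, h⟩ := Metric.mem_closure_iff.1 (hD (φ s)) (ε / 2) (half_pos hε)
    exact ⟨y, hy, by rwa [dist_eq_norm] at h⟩
  choose y hyD hy using hy
  let ψ : Fin S.card → C_c(G, ℂ) := fun i =>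
    { toFun := fun t => ((ρ t * χ i t : ℝ) : ℂ)
      continuous_toFun := by fun_prop
      hasCompactSupport' := (hρc.mul_right (f' := χ i)).comp_left (g := fun x : ℝ => (x : ℂ))
        Complex.ofReal_zero }
  have hspan : ∀ (χ : C_c(G, ℂ)) (y : Y), y ∈ Submodule.span ℂ D →
      ccSmul χ y ∈ Submodule.span ℂ {h : C_c(G, Y) | ∃ χ, ∃ y ∈ D, h = ccSmul χ y} := by
    intro χ y hy
    induction hy using Submodule.span_induction with
    | mem y hy => exact Submodule.subset_span ⟨χ, y, hy, rfl⟩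
    | zero => convert Submodule.zero_mem _; ext t; exact smul_zero _
    | add x y _ _ hx hy => convert Submodule.add_mem _ hx hy using 1; ext t; exact smul_add _ _ _
    | smul c x _ hx => convert Submodule.smul_mem _ c hx using 1; ext t; exact smul_comm _ _ _
  refine ⟨∑ i, ccSmul (ψ i) (y (e.symm i)),
    Submodule.sum_mem _ fun i _ => hspan _ _ (hyD _), fun t ht => ?_, fun t => ?_⟩
  · have h0 : ρ t = 0 := image_eq_zero_of_notMem_tsupport ht
    rw [CompactlySupportedContinuousMap.sub_apply, CompactlySupportedContinuousMap.sum_apply,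
      ← hρφ t, h0, Finset.sum_eq_zero fun i _ => ?_]
    · simp
    · change ((ρ t * χ i t : ℝ) : ℂ) • _ = (0 : Y)
      rw [h0]; simp
  · have h1 : (φ - ∑ i, ccSmul (ψ i) (y (e.symm i))) t =
        ∑ i, ((ρ t * χ i t : ℝ) : ℂ) • (φ t - y (e.symm i)) := by
      simp only [smul_sub, Finset.sum_sub_distrib]
      rw [CompactlySupportedContinuousMap.sub_apply, CompactlySupportedContinuousMap.sum_apply]
      congr 1
      rw [← Finset.sum_smul, ← Complex.ofReal_sum, ← Finset.mul_sum]
      by_cases ht : t ∈ tsupport ρ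
      · have := hχ2 ht
        simp only [Finset.sum_apply, Pi.one_apply] at this
        rw [this, mul_one, hρφ]
      · rw [← hρφ t, image_eq_zero_of_notMem_tsupport ht]; simp
    rw [h1]
    have h2 : ∀ i, ‖((ρ t * χ i t : ℝ) : ℂ) • (φ t - y (e.symm i))‖ ≤ ρ t * χ i t * ε := by
      intro i
      have h0 : 0 ≤ ρ t * χ i t := mul_nonneg (hρ t).1 (hχ3 i t).1
      rw [norm_smul, Complex.norm_real, Real.norm_of_nonneg h0]
      by_cases hi : χ i t = 0
      · simp [hi]
      · have h3 : ‖φ t - φ (e.symm i)‖ < ε / 2 := hχ1 i (subset_tsupport _ hi)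
        gcongr
        linarith [norm_sub_le_norm_sub_add_norm_sub (φ t) (φ (e.symm i)) (y (e.symm i)),
          hy (e.symm i)]
    refine (norm_sum_le_of_le _ fun i _ => h2 i).trans ?_
    rw [← Finset.sum_mul, ← Finset.mul_sum]
    by_cases ht : t ∈ tsupport ρ
    · have := hχ2 ht
      simp only [Finset.sum_apply, Pi.one_apply] at this
      rw [this, mul_one]
      exact mul_le_of_le_one_left hε.le (hρ t).2
    · rw [image_eq_zero_of_notMem_tsupport ht]; simp [hε.le]

/-- Continuity of a linear map on `C_c(G, Y)` for uniform convergence with supports in a common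
compact set. -/
def IsIndBounded (P : C_c(G, Y) →ₗ[ℂ] Z) : Prop :=
  ∀ K : Set G, IsCompact K → ∃ C : ℝ, 0 ≤ C ∧ ∀ (h : C_c(G, Y)) (ε : ℝ), 0 ≤ ε →
    (∀ t ∉ K, h t = 0) → (∀ t, ‖h t‖ ≤ ε) → ‖P h‖ ≤ C * ε

/-- The functions χ · y with y in a generating set span a dense subspace for the convergence that P
respects. Many of the operator identities and inclusions for general symbols or functions are
reduced in this way to elementary ones. -/
theorem IsIndBounded.mem_of_ccSmul {P : C_c(G, Y) →ₗ[ℂ] Z} (hP : IsIndBounded P) {D : Set Y}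
    (hD : Dense (Submodule.span ℂ D : Set Y)) {N : Submodule ℂ Z} (hN : IsClosed (N : Set Z))
    (h : ∀ χ, ∀ y ∈ D, P (ccSmul χ y) ∈ N) (φ : C_c(G, Y)) : P φ ∈ N := by
  obtain ⟨K, hK, hφ⟩ := exists_span_ccSmul_near hD φ
  obtain ⟨C, hC, hPC⟩ := hP K hK
  refine hN.closure_subset (Metric.mem_closure_iff.2 fun ε hε => ?_)
  obtain ⟨f, hf, h1, h2⟩ := hφ (ε / (C + 1)) (by positivity)
  refine ⟨P f, ?_, ?_⟩
  · have : Submodule.span ℂ {h : C_c(G, Y) | ∃ χ, ∃ y ∈ D, h = ccSmul χ y} ≤ N.comap P :=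
      Submodule.span_le.2 fun f ⟨χ, y, hy, hf⟩ => by rw [hf]; exact h χ y hy
    exact this hf
  · rw [dist_eq_norm, ← map_sub]
    refine (hPC _ _ (by positivity) h1 h2).trans_lt ?_
    rw [mul_div_assoc', div_lt_iff₀ (by positivity)]
    nlinarith

theorem IsIndBounded.sub {P Q : C_c(G, Y) →ₗ[ℂ] Z} (hP : IsIndBounded P) (hQ : IsIndBounded Q) :
    IsIndBounded (P - Q) := fun K hK => by
  obtain ⟨C, hC, h⟩ := hP K hK
  obtain ⟨C', hC', h'⟩ := hQ K hK
  refine ⟨C + C', by positivity, fun f ε hε h1 h2 => ?_⟩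
  rw [add_mul]
  exact (norm_sub_le _ _).trans (add_le_add (h f ε hε h1 h2) (h' f ε hε h1 h2))

theorem IsIndBounded.eq_of_ccSmul {P Q : C_c(G, Y) →ₗ[ℂ] Z} (hP : IsIndBounded P)
    (hQ : IsIndBounded Q) {D : Set Y} (hD : Dense (Submodule.span ℂ D : Set Y))
    (h : ∀ χ, ∀ y ∈ D, P (ccSmul χ y) = Q (ccSmul χ y)) : P = Q := by
  refine LinearMap.ext fun φ => sub_eq_zero.1 ?_
  refine (hP.sub hQ).mem_of_ccSmul hD (N := ⊥) isClosed_singleton (fun χ y hy => ?_) φ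
  rw [LinearMap.sub_apply, h χ y hy, sub_self]
  exact Submodule.zero_mem _

theorem IsIndBounded.clm_comp {W : Type*} [NormedAddCommGroup W] [NormedSpace ℂ W]
    {P : C_c(G, Y) →ₗ[ℂ] Z} (hP : IsIndBounded P) (T : Z →L[ℂ] W) :
    IsIndBounded (T.toLinearMap ∘ₗ P) := fun K hK => by
  obtain ⟨C, hC, h⟩ := hP K hK
  refine ⟨‖T‖ * C, by positivity, fun f ε hε h1 h2 => ?_⟩
  rw [mul_assoc]
  exact T.le_opNorm_of_le (h f ε hε h1 h2)

end Inductive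

namespace HilbertModule

/-! ### Compactly supported kernels and Fubini -/

section Kernel

variable {G : Type*} [Group G] [TopologicalSpace G] [IsTopologicalGroup G]
  [LocallyCompactSpace G] [T2Space G] [MeasurableSpace G] [BorelSpace G]
  {F : Type*} [NormedAddCommGroup F] [NormedSpace ℂ F]

theorem integrable_cc (f : C_c(G, F)) : Integrable f Measure.haar :=
  f.continuous.integrable_of_hasCompactSupport f.hasCompactSupport

/-- A slice of a compactly supported kernel. -/
noncomputable def kernelSlice (K : C_c(G × G, F)) (t : G) : C_c(G, F) where
  toFun r := K (r, t)
  continuous_toFun := by fun_prop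
  hasCompactSupport' :=
    HasCompactSupport.intro (K.hasCompactSupport.isCompact.image continuous_fst) fun r hr => by
      by_contra h0
      exact hr ⟨(r, t), subset_tsupport _ h0, rfl⟩

theorem integrable_kernel (K : C_c(G × G, F)) (t : G) :
    Integrable (fun r => K (r, t)) Measure.haar := integrable_cc (kernelSlice K t)

/-- Integration of a compactly supported kernel in the first variable. -/
noncomputable def kernelInt : C_c(G × G, F) →ₗ[ℂ] C_c(G, F) where
  toFun K :=
    { toFun := fun t => ∫ r, K (r, t) ∂Measure.haar
      continuous_toFun := continuous_integral_of_hasCompactSupport (f := fun r t => K (r, t))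
        K.continuous K.hasCompactSupport
      hasCompactSupport' := hasCompactSupport_integral (f := fun r t => K (r, t))
        K.hasCompactSupport }
  map_add' K L := CompactlySupportedContinuousMap.ext fun t =>
    integral_add (integrable_kernel K t) (integrable_kernel L t)
  map_smul' c _ := CompactlySupportedContinuousMap.ext fun _ => integral_smul c _

theorem integral_kernel_swap (K : C_c(G × G, F)) :
    ∫ t, ∫ r, K (r, t) ∂Measure.haar ∂Measure.haar =
      ∫ r, ∫ t, K (r, t) ∂Measure.haar ∂Measure.haar :=
  (integral_integral_swap_of_hasCompactSupport (f := fun r t => K (r, t))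
    K.continuous K.hasCompactSupport).symm

theorem norm_kernelInt_le (K : C_c(G × G, F)) {n : G → ℝ} (hn : Integrable n Measure.haar)
    (t : G) (h : ∀ r, ‖K (r, t)‖ ≤ n r) : ‖kernelInt K t‖ ≤ ∫ r, n r ∂Measure.haar :=
  norm_integral_le_of_norm_le hn (.of_forall h)

end Kernel

/-! ### Integrals commute with the inner product and the module action -/

section Integral

variable {B E : Type*} [NonUnitalCStarAlgebra B] [NormedAddCommGroup E] [NormedSpace ℂ E]
  [HilbertModule B E] {T : Type*} [MeasurableSpace T] {μ : Measure T}

theorem ip_integral (x : E) {f : T → E} (hf : Integrable f μ) :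
    (ip x (∫ t, f t ∂μ) : B) = ∫ t, ip x (f t) ∂μ := by
  have : CompleteSpace E := HilbertModule.toCompleteSpace B
  exact ((ipL B x).integral_comp_comm hf).symm

theorem integral_ip (x : E) {f : T → E} (hf : Integrable f μ) :
    (ip (∫ t, f t ∂μ) x : B) = ∫ t, ip (f t) x ∂μ := by
  rw [← star_ip, ip_integral x hf]
  refine ((starL' ℝ : B ≃L[ℝ] B).toContinuousLinearMap.integral_comp_comm
    ((ipL B x).integrable_comp hf)).symm.trans ?_
  exact integral_congr_ae (.of_forall fun t => star_ip _ _)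

theorem integral_ract {f : T → E} (hf : Integrable f μ) (b : B) :
    ract (∫ t, f t ∂μ) b = ∫ t, ract (f t) b ∂μ := by
  have : CompleteSpace E := HilbertModule.toCompleteSpace B
  exact (((ractL B E).flip b).integral_comp_comm hf).symm

theorem ract_integral (x : E) {f : T → B} (hf : Integrable f μ) :
    ract x (∫ t, f t ∂μ) = ∫ t, ract x (f t) ∂μ := by
  have : CompleteSpace E := HilbertModule.toCompleteSpace B
  exact ((ractL B E x).integral_comp_comm hf).symm

end Integral

/-! ### Isometry and joint continuity of the actions -/

section Action

variable {G B E : Type*} [Group G] [TopologicalSpace G] [NonUnitalCStarAlgebra B]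
  [NormedAddCommGroup E] [NormedSpace ℂ E] [HilbertModule B E] {β : CStarAction G B}
  (γ : ModuleAction β E)

theorem norm_action (t : G) (x : E) : ‖γ.toFun t x‖ = ‖x‖ :=
  le_antisymm (norm_action_le γ t x) (by
    have := norm_action_le γ t⁻¹ (γ.toFun t x)
    rwa [inv_action] at this)

/-- Strong continuity handles the group variable at a fixed vector; since each γ_t is isometric, the
vector may move as well. -/
theorem _root_.Continuous.action {T : Type*} [TopologicalSpace T] {f : T → G} {g : T → E}
    (hf : Continuous f) (hg : Continuous g) : Continuous fun z => γ.toFun (f z) (g z) := by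
  refine continuous_iff_continuousAt.2 fun z => Metric.tendsto_nhds.2 fun ε hε => ?_
  have h1 := Metric.tendsto_nhds.1 (((γ.continuous (g z)).comp hf).tendsto z) (ε / 2) (half_pos hε)
  have h2 := Metric.tendsto_nhds.1 (hg.tendsto z) (ε / 2) (half_pos hε)
  filter_upwards [h1, h2] with w hw1 hw2
  have h3 : dist (γ.toFun (f w) (g w)) (γ.toFun (f w) (g z)) = dist (g w) (g z) := by
    rw [dist_eq_norm, ← map_sub, norm_action, dist_eq_norm]
  exact (dist_triangle _ _ _).trans_lt (by
    rw [h3]; exact (add_lt_add hw2 hw1).trans_eq (add_halves ε))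

theorem _root_.Continuous.cstarAction {T : Type*} [TopologicalSpace T] {f : T → G} {g : T → B}
    (hf : Continuous f) (hg : Continuous g) : Continuous fun z => β.toFun (f z) (g z) :=
  Continuous.action β.self hf hg

theorem action_integral {T : Type*} [MeasurableSpace T] {μ : Measure T} (t : G) {f : T → E}
    (hf : Integrable f μ) : γ.toFun t (∫ s, f s ∂μ) = ∫ s, γ.toFun t (f s) ∂μ := by
  have : CompleteSpace E := HilbertModule.toCompleteSpace B
  exact ((actionL γ t).integral_comp_comm hf).symm

end Action

/-! ### The Hilbert module L²(G, E) -/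

section L2

variable {G : Type*} [Group G] [TopologicalSpace G] [IsTopologicalGroup G]
  [LocallyCompactSpace G] [T2Space G] [MeasurableSpace G] [BorelSpace G]
  {B E : Type*} [NonUnitalCStarAlgebra B] [NormedAddCommGroup E] [NormedSpace ℂ E]
  [HilbertModule B E]

variable (G B E) in
theorem denseRange_toL2 : DenseRange (toL2 G B E) :=
  Completion.denseRange_coe (α := (l2Pre G B E).Space)

theorem ip_toL2 (f g : C_c(G, E)) :
    (ip (toL2 G B E f) (toL2 G B E g) : B) = ∫ t, ip (f t) (g t) ∂Measure.haar :=
  (l2Pre G B E).ipC_coe f g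

theorem clm_ext_L2 {Z : Type*} [NormedAddCommGroup Z] [NormedSpace ℂ Z]
    {S T : L2 G B E →L[ℂ] Z} (h : ∀ f, S (toL2 G B E f) = T (toL2 G B E f)) : S = T :=
  ContinuousLinearMap.ext fun x => congrFun
    ((denseRange_toL2 G B E).equalizer S.continuous T.continuous (funext h)) x

theorem isIndBounded_toL2 : IsIndBounded (toL2 G B E) := fun K hK => by
  refine ⟨√(Measure.haar.real K), Real.sqrt_nonneg _, fun h ε hε h1 h2 => ?_⟩
  have hb : ‖(ip (toL2 G B E h) (toL2 G B E h) : B)‖ ≤ ε ^ 2 * Measure.haar.real K := by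
    rw [ip_toL2, ← setIntegral_eq_integral_of_forall_compl_eq_zero (s := K) fun t ht => by
      rw [h1 t ht, ip_zero_right]]
    refine norm_setIntegral_le_of_norm_le_const hK.measure_lt_top fun t _ => ?_
    exact (norm_ip_le B _ _).trans (by rw [pow_two]; gcongr <;> exact h2 t)
  rw [norm_eq_sqrt (B := B)]
  refine (Real.sqrt_le_sqrt hb).trans_eq ?_
  rw [Real.sqrt_mul (by positivity), Real.sqrt_sq hε, mul_comm]

/-- Left translation by `r` on `C_c(G, E)`. -/
def shift (r : G) (f : C_c(G, E)) : C_c(G, E) where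
  toFun t := f (r⁻¹ * t)
  continuous_toFun := by fun_prop
  hasCompactSupport' := f.hasCompactSupport.comp_homeomorph (Homeomorph.mulLeft r⁻¹)

variable (B) in
theorem norm_toL2_shift (r : G) (f : C_c(G, E)) :
    ‖toL2 G B E (shift r f)‖ = ‖toL2 G B E f‖ := by
  rw [norm_eq_sqrt (B := B), norm_eq_sqrt (B := B) (toL2 G B E f), ip_toL2, ip_toL2]
  congr 2
  exact integral_mul_left_eq_self (fun t => (ip (f t) (f t) : B)) r⁻¹

end L2

/-! ### The operators M_ξ -/

section Symbol

variable {G : Type*} [Group G] [TopologicalSpace G] [IsTopologicalGroup G]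
  [LocallyCompactSpace G] [T2Space G] [MeasurableSpace G] [BorelSpace G]
  {B E : Type*} [NonUnitalCStarAlgebra B] [NormedAddCommGroup E] [NormedSpace ℂ E]
  [HilbertModule B E] {β : CStarAction G B} (γ : ModuleAction β E)

/-- The map `f ↦ (t ↦ γ_t⁻¹(ξ) f(t))`. -/
noncomputable def creation (ξ : E) : C_c(G, B) →ₗ[ℂ] C_c(G, E) where
  toFun f :=
    { toFun := fun t => ract (γ.toFun t⁻¹ ξ) (f t)
      continuous_toFun := (Continuous.action γ continuous_inv continuous_const).ract f.continuous
      hasCompactSupport' := f.hasCompactSupport.mono fun t ht h0 =>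
        ht (by simp only [h0, ract_zero]) }
  map_add' f g := CompactlySupportedContinuousMap.ext fun t => ract_add _ _ _
  map_smul' c f := CompactlySupportedContinuousMap.ext fun t => ract_smul _ _ _

theorem creation_apply (ξ : E) (f : C_c(G, B)) (t : G) :
    creation γ ξ f t = ract (γ.toFun t⁻¹ ξ) (f t) := rfl

/-- The map `h ↦ (t ↦ ⟨γ_t⁻¹(ξ), h(t)⟩)`. -/
noncomputable def annihilation (ξ : E) (h : C_c(G, E)) : C_c(G, B) where
  toFun t := ip (γ.toFun t⁻¹ ξ) (h t)
  continuous_toFun := (Continuous.action γ continuous_inv continuous_const).ip h.continuous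
  hasCompactSupport' := h.hasCompactSupport.mono fun t ht h0 =>
    ht (by simp only [h0, ip_zero_right])

theorem ip_creation (ξ : E) (f : C_c(G, B)) (h : C_c(G, E)) :
    (ip (toL2 G B E (creation γ ξ f)) (toL2 G B E h) : B) =
      ip (toL2 G B B f) (toL2 G B B (annihilation γ ξ h)) := by
  rw [ip_toL2, ip_toL2]
  exact integral_congr_ae (.of_forall fun t => ip_ract_left _ _ _)

/-- The inequality f(t)⋆ β_t⁻¹⟨ξ, ξ⟩ f(t) ≤ ‖ξ‖² f(t)⋆ f(t) is integrated as an inequality of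
positive elements of B, and norms are taken only afterwards: the L²-norm is the norm of an integral,
not an integral of norms. -/
theorem norm_creation_le (ξ : E) (f : C_c(G, B)) :
    ‖toL2 G B E (creation γ ξ f)‖ ≤ ‖ξ‖ * ‖toL2 G B B f‖ := by
  refine le_of_sq_le_sq ?_ (by positivity)
  rw [norm_sq (B := B), mul_pow, norm_sq (B := B) (toL2 G B B f), ip_toL2, ip_toL2]
  let _ := CStarAlgebra.spectralOrder B
  have _ := CStarAlgebra.spectralOrderedRing B
  have hn : ‖ξ‖ ^ 2 * ‖∫ t, (ip (f t) (f t) : B) ∂Measure.haar‖ =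
      ‖∫ t, (‖ξ‖ ^ 2) • (ip (f t) (f t) : B) ∂Measure.haar‖ := by
    rw [integral_smul, norm_smul, Real.norm_of_nonneg (by positivity)]
  rw [hn]
  refine CStarAlgebra.norm_le_norm_of_nonneg_of_le
    (integral_nonneg fun t => exists_star_mul_self_iff.1 (ip_self _))
    (integral_mono (integrable_ip B _ _) ((integrable_ip B f f).smul _) fun t => ?_)
  change (ip (ract (γ.toFun t⁻¹ ξ) (f t)) (ract (γ.toFun t⁻¹ ξ) (f t)) : B) ≤
    ‖ξ‖ ^ 2 • (star (f t) * f t)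
  rw [ip_ract, ip_ract_left]
  have h1 : ‖ξ‖ ^ 2 = ‖(ip (γ.toFun t⁻¹ ξ) (γ.toFun t⁻¹ ξ) : B)‖ := by
    rw [← norm_sq, norm_action]
  rw [h1]
  have h0 : (0 : B) ≤ ip (γ.toFun t⁻¹ ξ) (γ.toFun t⁻¹ ξ) := exists_star_mul_self_iff.1 (ip_self _)
  exact CStarAlgebra.star_left_conjugate_le_norm_smul

theorem exists_creationOp (ξ : E) : ∃ T : adjointable B (L2 G B B) (L2 G B E),
    ∀ f, T.1 (toL2 G B B f) = toL2 G B E (creation γ ξ f) := by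
  have : CompleteSpace (L2 G B E) := HilbertModule.toCompleteSpace B
  let P : C_c(G, B) →ₗ[ℂ] L2 G B E := toL2 G B E ∘ₗ creation γ ξ
  have hP : ∀ f, P.extendOfNorm (toL2 G B B) (toL2 G B B f) = P f :=
    LinearMap.extendOfNorm_eq (denseRange_toL2 G B B) ⟨_, norm_creation_le γ ξ⟩
  refine ⟨⟨P.extendOfNorm (toL2 G B B), mem_adjointable_of_dense (Set.range (toL2 G B E))
    ((denseRange_toL2 G B E).mono Submodule.subset_span) ?_⟩, hP⟩
  rintro _ ⟨h, rfl⟩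
  refine ⟨toL2 G B B (annihilation γ ξ h), fun x => ?_⟩
  refine (denseRange_toL2 G B B).induction_on
    (p := fun x => (ip (P.extendOfNorm (toL2 G B B) x) (toL2 G B E h) : B) =
      ip x (toL2 G B B (annihilation γ ξ h))) x (isClosed_eq
        ((P.extendOfNorm (toL2 G B B)).continuous.ip continuous_const)
        (continuous_id.ip continuous_const)) fun f => ?_
  rw [hP]
  exact ip_creation γ ξ f h

/-- The operator `M_ξ : L²(G, B) → L²(G, E)`, `(M_ξ f)(t) = γ_t⁻¹(ξ) f(t)`. -/
noncomputable def creationOp (ξ : E) : adjointable B (L2 G B B) (L2 G B E) :=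
  (exists_creationOp γ ξ).choose

theorem creationOp_toL2 (ξ : E) (f : C_c(G, B)) :
    (creationOp γ ξ).1 (toL2 G B B f) = toL2 G B E (creation γ ξ f) :=
  (exists_creationOp γ ξ).choose_spec f

/-- Pointwise this is ⟨γ_t⁻¹ξ, γ_t⁻¹η⟩ = β_t⁻¹⟨ξ, η⟩. It is the reason why inner products in E ⋊_r G
fall into B ⋊_r G. -/
theorem starMul_creationOp (ξ η : E) :
    starMul (creationOp γ ξ) (creationOp γ η) = creationOp β.self (ip ξ η : B) := by
  have key : ∀ f g : C_c(G, B), (ip (toL2 G B B f)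
      ((starMul (creationOp γ ξ) (creationOp γ η)).1 (toL2 G B B g)) : B) =
      ip (toL2 G B B f) ((creationOp β.self (ip ξ η : B)).1 (toL2 G B B g)) := fun f g => by
    rw [starMul_apply, creationOp_toL2, creationOp_toL2, creationOp_toL2, ip_toL2, ip_toL2]
    refine integral_congr_ae (.of_forall fun t => ?_)
    change (ip (ract (γ.toFun t⁻¹ ξ) (f t)) (ract (γ.toFun t⁻¹ η) (g t)) : B) =
      star (f t) * (β.toFun t⁻¹ (ip ξ η) * g t)
    rw [ip_ract, ip_ract_left, γ.map_ip, mul_assoc]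
  refine Subtype.ext (clm_ext_L2 fun g => ext_ip B fun x => ?_)
  exact (denseRange_toL2 G B B).induction_on (p := fun x => (ip x _ : B) = ip x _) x
    (isClosed_eq (continuous_id.ip continuous_const) (continuous_id.ip continuous_const))
    fun f => key f g

end Symbol

/-! ### Laurent operators: adjoints and the L¹-bound -/

section Laurent

variable {G : Type*} [Group G] [TopologicalSpace G] [IsTopologicalGroup G]
  [LocallyCompactSpace G] [T2Space G] [MeasurableSpace G] [BorelSpace G]
  {B E : Type*} [NonUnitalCStarAlgebra B] [NormedAddCommGroup E] [NormedSpace ℂ E]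
  [HilbertModule B E] {β : CStarAction G B} (γ : ModuleAction β E)

/-- The kernel `(r, t) ↦ γ_t⁻¹(φ(r)) f(r⁻¹ t)`. -/
noncomputable def laurentKernel (φ : C_c(G, E)) (f : C_c(G, B)) : C_c(G × G, E) where
  toFun z := ract (γ.toFun z.2⁻¹ (φ z.1)) (f (z.1⁻¹ * z.2))
  continuous_toFun := (Continuous.action γ (by fun_prop) (by fun_prop)).ract (by fun_prop)
  hasCompactSupport' := HasCompactSupport.kernel (f := fun r t => ract (γ.toFun t⁻¹ (φ r))
    (f (r⁻¹ * t))) φ.hasCompactSupport f.hasCompactSupport fun r t h =>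
      ⟨subset_tsupport _ fun h0 => h (by rw [h0, map_zero, zero_ract]),
        subset_tsupport _ fun h0 => h (by rw [h0, ract_zero])⟩

/-- The map `(φ, f) ↦ (t ↦ ∫ γ_t⁻¹(φ(r)) f(r⁻¹ t) dr)`. -/
noncomputable def laurentFun : C_c(G, E) →ₗ[ℂ] C_c(G, B) →ₗ[ℂ] C_c(G, E) :=
  (LinearMap.mk₂ ℂ (laurentKernel γ)
    (fun φ ψ f => CompactlySupportedContinuousMap.ext fun z => by
      change ract (γ.toFun z.2⁻¹ (φ z.1 + ψ z.1)) _ = ract _ _ + ract _ _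
      rw [map_add, add_ract])
    (fun c φ f => CompactlySupportedContinuousMap.ext fun z => by
      change ract (γ.toFun z.2⁻¹ (c • φ z.1)) _ = c • ract _ _
      rw [map_smul, smul_ract])
    (fun φ f g => CompactlySupportedContinuousMap.ext fun z => ract_add _ _ _)
    (fun c φ f => CompactlySupportedContinuousMap.ext fun z => ract_smul _ _ _)).compr₂ kernelInt

theorem laurentFun_apply (φ : C_c(G, E)) (f : C_c(G, B)) (t : G) :
    laurentFun γ φ f t = ∫ r, ract (γ.toFun t⁻¹ (φ r)) (f (r⁻¹ * t)) ∂Measure.haar := rfl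

theorem laurentFun_eq (φ : C_c(G, E)) (f : C_c(G, B)) (t : G) :
    laurentFun γ φ f t =
      ∫ s, (modular s)⁻¹ • ract (γ.toFun t⁻¹ (φ (t * s⁻¹))) (f s) ∂Measure.haar := by
  have : CompleteSpace E := HilbertModule.toCompleteSpace B
  rw [integral_modular_inv_smul (f := fun s => ract (γ.toFun t⁻¹ (φ (t * s⁻¹))) (f s))
    ((Continuous.action γ (by fun_prop) (by fun_prop)).ract f.continuous)
    (f.hasCompactSupport.mono fun s hs h0 => hs (by simp only [h0, ract_zero])) t]
  rw [laurentFun_apply]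
  simp

/-- The kernel of the adjoint: `(r, s) ↦ ⟨γ_(r s)⁻¹(φ(r)), h(r s)⟩`. -/
noncomputable def laurentAdjKernel (φ h : C_c(G, E)) : C_c(G × G, B) where
  toFun z := ip (γ.toFun (z.1 * z.2)⁻¹ (φ z.1)) (h (z.1 * z.2))
  continuous_toFun := (Continuous.action γ (by fun_prop) (by fun_prop)).ip (by fun_prop)
  hasCompactSupport' := HasCompactSupport.kernel_prod
    (f := fun r s => (ip (γ.toFun (r * s)⁻¹ (φ r)) (h (r * s)) : B))
    φ.hasCompactSupport.isCompact (φ.hasCompactSupport.isCompact.inv.mul h.hasCompactSupport.isCompact) fun r s h' => by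
      have hr : r ∈ tsupport φ := subset_tsupport _ fun h0 => h' (by rw [h0, map_zero, ip_zero_left])
      exact ⟨hr, r⁻¹, Set.inv_mem_inv.2 hr, r * s,
        subset_tsupport _ fun h0 => h' (by rw [h0, ip_zero_right]), by simp⟩

/-- The map `h ↦ (s ↦ ∫ ⟨γ_(r s)⁻¹(φ(r)), h(r s)⟩ dr)`. -/
noncomputable def laurentAdj (φ h : C_c(G, E)) : C_c(G, B) := kernelInt (laurentAdjKernel γ φ h)

theorem laurentAdj_apply (φ h : C_c(G, E)) (s : G) : laurentAdj γ φ h s =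
    ∫ r, (ip (γ.toFun (r * s)⁻¹ (φ r)) (h (r * s)) : B) ∂Measure.haar := rfl

/-- Weak form of λ_φ = ∫ M_φ(r) L_r dr, where L_r is left translation. Both the adjoint and the norm
estimate of λ_φ come from this representation. -/
theorem ip_laurentFun_eq (φ h : C_c(G, E)) (f : C_c(G, B)) :
    (ip (toL2 G B E (laurentFun γ φ f)) (toL2 G B E h) : B) =
      ∫ r, ip (toL2 G B E (creation γ (φ r) (shift r f))) (toL2 G B E h) ∂Measure.haar := by
  let K : C_c(G × G, B) :=
    { toFun := fun z => ip (laurentKernel γ φ f z) (h z.2)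
      continuous_toFun := (laurentKernel γ φ f).continuous.ip (by fun_prop)
      hasCompactSupport' := (laurentKernel γ φ f).hasCompactSupport.mono fun z hz h0 =>
        hz (by simp only [h0, ip_zero_left]) }
  have h1 : (ip (toL2 G B E (laurentFun γ φ f)) (toL2 G B E h) : B) =
      ∫ t, ∫ r, K (r, t) ∂Measure.haar ∂Measure.haar := by
    rw [ip_toL2]
    exact integral_congr_ae (.of_forall fun t =>
      integral_ip (h t) (integrable_kernel (laurentKernel γ φ f) t))
  rw [h1, integral_kernel_swap]
  exact integral_congr_ae (.of_forall fun r =>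
    (ip_toL2 (creation γ (φ r) (shift r f)) h).symm)

theorem ip_laurentFun (φ h : C_c(G, E)) (f : C_c(G, B)) :
    (ip (toL2 G B E (laurentFun γ φ f)) (toL2 G B E h) : B) =
      ip (toL2 G B B f) (toL2 G B B (laurentAdj γ φ h)) := by
  let K : C_c(G × G, B) :=
    { toFun := fun z => star (f z.2) * laurentAdjKernel γ φ h z
      continuous_toFun := by fun_prop
      hasCompactSupport' := (laurentAdjKernel γ φ h).hasCompactSupport.mul_left }
  have h1 : (ip (toL2 G B B f) (toL2 G B B (laurentAdj γ φ h)) : B) =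
      ∫ s, ∫ r, K (r, s) ∂Measure.haar ∂Measure.haar := by
    rw [ip_toL2]
    exact integral_congr_ae (.of_forall fun s =>
      ip_integral (f s) (integrable_kernel (laurentAdjKernel γ φ h) s))
  rw [ip_laurentFun_eq, h1, integral_kernel_swap]
  refine integral_congr_ae (.of_forall fun r => ?_)
  refine (ip_toL2 _ _).trans ?_
  -- Replace the integration variable by r s, so that f is evaluated at s and can be taken out of
  -- the integral over r.
  rw [← integral_mul_left_eq_self _ r]
  refine integral_congr_ae (.of_forall fun s => ?_)
  change (ip (ract (γ.toFun (r * s)⁻¹ (φ r)) (f (r⁻¹ * (r * s)))) (h (r * s)) : B) =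
    star (f s) * ip (γ.toFun (r * s)⁻¹ (φ r)) (h (r * s))
  rw [ip_ract_left, inv_mul_cancel_left]

/-- Left translations are isometric and ‖M_ξ‖ ≤ ‖ξ‖, so the integral representation yields the
L¹-norm of the symbol. One factor ‖λ_φ f‖ is cancelled by `norm_le_of_ip`. -/
theorem norm_laurentFun_le (φ : C_c(G, E)) (f : C_c(G, B)) :
    ‖toL2 G B E (laurentFun γ φ f)‖ ≤ (∫ r, ‖φ r‖ ∂Measure.haar) * ‖toL2 G B B f‖ := by
  refine norm_le_of_ip B (mul_nonneg (integral_nonneg fun _ => norm_nonneg _) (norm_nonneg _)) ?_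
  rw [ip_laurentFun_eq, ← integral_mul_const, ← integral_mul_const]
  refine norm_integral_le_of_norm_le (((integrable_cc φ).norm.mul_const _).mul_const _)
    (.of_forall fun r => ?_)
  refine (norm_ip_le B _ _).trans ?_
  gcongr
  exact (norm_creation_le γ _ _).trans_eq (by rw [norm_toL2_shift])

theorem exists_laurentOp (φ : C_c(G, E)) : ∃ T : adjointable B (L2 G B B) (L2 G B E),
    ∀ f, T.1 (toL2 G B B f) = toL2 G B E (laurentFun γ φ f) := by
  have : CompleteSpace (L2 G B E) := HilbertModule.toCompleteSpace B
  let P : C_c(G, B) →ₗ[ℂ] L2 G B E := toL2 G B E ∘ₗ laurentFun γ φ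
  have hP : ∀ f, P.extendOfNorm (toL2 G B B) (toL2 G B B f) = P f :=
    LinearMap.extendOfNorm_eq (denseRange_toL2 G B B) ⟨_, norm_laurentFun_le γ φ⟩
  refine ⟨⟨P.extendOfNorm (toL2 G B B), mem_adjointable_of_dense (Set.range (toL2 G B E))
    ((denseRange_toL2 G B E).mono Submodule.subset_span) ?_⟩, hP⟩
  rintro _ ⟨h, rfl⟩
  refine ⟨toL2 G B B (laurentAdj γ φ h), fun x => ?_⟩
  refine (denseRange_toL2 G B B).induction_on
    (p := fun x => (ip (P.extendOfNorm (toL2 G B B) x) (toL2 G B E h) : B) =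
      ip x (toL2 G B B (laurentAdj γ φ h))) x (isClosed_eq
        ((P.extendOfNorm (toL2 G B B)).continuous.ip continuous_const)
        (continuous_id.ip continuous_const)) fun f => ?_
  rw [hP]
  exact ip_laurentFun γ φ h f

/-- The Laurent operator `λ_φ` with symbol `φ ∈ C_c(G, E)`, as a linear function of `φ`. -/
noncomputable def laurentOp : C_c(G, E) →ₗ[ℂ] adjointable B (L2 G B B) (L2 G B E) where
  toFun φ := (exists_laurentOp γ φ).choose
  map_add' φ ψ := Subtype.ext <| clm_ext_L2 fun f => by
    change (exists_laurentOp γ (φ + ψ)).choose.1 (toL2 G B B f) =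
      (exists_laurentOp γ φ).choose.1 (toL2 G B B f) +
      (exists_laurentOp γ ψ).choose.1 (toL2 G B B f)
    rw [(exists_laurentOp γ (φ + ψ)).choose_spec, (exists_laurentOp γ φ).choose_spec,
      (exists_laurentOp γ ψ).choose_spec, map_add, LinearMap.add_apply, map_add]
  map_smul' c φ := Subtype.ext <| clm_ext_L2 fun f => by
    change (exists_laurentOp γ (c • φ)).choose.1 (toL2 G B B f) =
      c • (exists_laurentOp γ φ).choose.1 (toL2 G B B f)
    rw [(exists_laurentOp γ (c • φ)).choose_spec, (exists_laurentOp γ φ).choose_spec,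
      map_smul, LinearMap.smul_apply, map_smul]

theorem laurentOp_toL2 (φ : C_c(G, E)) (f : C_c(G, B)) :
    (laurentOp γ φ).1 (toL2 G B B f) = toL2 G B E (laurentFun γ φ f) :=
  (exists_laurentOp γ φ).choose_spec f

theorem norm_laurentOp_le (φ : C_c(G, E)) : ‖laurentOp γ φ‖ ≤ ∫ r, ‖φ r‖ ∂Measure.haar := by
  have h0 : 0 ≤ ∫ r, ‖φ r‖ ∂Measure.haar := integral_nonneg fun _ => norm_nonneg _
  refine ContinuousLinearMap.opNorm_le_bound _ h0 fun x => ?_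
  refine (denseRange_toL2 G B B).induction_on
    (p := fun x => ‖(laurentOp γ φ).1 x‖ ≤ (∫ r, ‖φ r‖ ∂Measure.haar) * ‖x‖) x
    (isClosed_le (by fun_prop) (by fun_prop)) fun f => ?_
  rw [laurentOp_toL2]
  exact norm_laurentFun_le γ φ f

theorem isLaurent_laurentOp (φ : C_c(G, E)) : IsLaurent γ φ (laurentOp γ φ).1 := fun f =>
  ⟨laurentFun γ φ f, laurentFun_eq γ φ f, laurentOp_toL2 γ φ f⟩

/-- The symbol prescribes the operator on the dense image of C_c(G, B), so the predicate `IsLaurent`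
may be traded for the function `laurentOp`. -/
theorem IsLaurent.eq {φ : C_c(G, E)} {T : adjointable B (L2 G B B) (L2 G B E)}
    (h : IsLaurent γ φ T.1) : T = laurentOp γ φ :=
  Subtype.ext <| clm_ext_L2 fun f => by
    obtain ⟨g, hg, hT⟩ := h f
    rw [hT, laurentOp_toL2]
    congr 1
    ext t
    rw [hg, laurentFun_eq]

theorem integral_norm_le {Y : Type*} [NormedAddCommGroup Y] {K : Set G} (hK : IsCompact K)
    {h : G → Y} {ε : ℝ} (h1 : ∀ t ∉ K, h t = 0) (h2 : ∀ t, ‖h t‖ ≤ ε) :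
    ∫ t, ‖h t‖ ∂Measure.haar ≤ Measure.haar.real K * ε := by
  rw [← setIntegral_eq_integral_of_forall_compl_eq_zero (s := K) fun t ht => by
    rw [h1 t ht, norm_zero]]
  refine (le_abs_self _).trans ?_
  rw [mul_comm]
  exact norm_setIntegral_le_of_norm_le_const (f := fun t => ‖h t‖) hK.measure_lt_top
    fun t _ => by rw [norm_norm]; exact h2 t

theorem isIndBounded_laurentOp :
    IsIndBounded (Z := adjointable B (L2 G B B) (L2 G B E)) (laurentOp γ) := fun K hK =>
  ⟨Measure.haar.real K, measureReal_nonneg, fun _ _ _ h1 h2 =>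
    (norm_laurentOp_le γ _).trans (integral_norm_le hK h1 h2)⟩

end Laurent

section Crossed

variable {G : Type*} [Group G] [TopologicalSpace G] [IsTopologicalGroup G]
  [LocallyCompactSpace G] [T2Space G] [MeasurableSpace G] [BorelSpace G]
  {B E : Type*} [NonUnitalCStarAlgebra B] [NormedAddCommGroup E] [NormedSpace ℂ E]
  [HilbertModule B E]

/-! ### The reduced crossed product -/

/-- The Laurent operator with symbol in `C_c(G, B)` as an element of `L(L²(G, B))`. -/
noncomputable def laurentEnd (β : CStarAction G B) (h : C_c(G, B)) : adjointableEnd B (L2 G B B) :=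
  (laurentOp β.self h : adjointable B (L2 G B B) (L2 G B B))

theorem laurentEnd_toL2 (β : CStarAction G B) (h f : C_c(G, B)) :
    (laurentEnd β h).1 (toL2 G B B f) = toL2 G B B (laurentFun β.self h f) :=
  laurentOp_toL2 β.self h f

theorem laurentEnd_mem (β : CStarAction G B) (h : C_c(G, B)) : laurentEnd β h ∈ crossedAlg β :=
  NonUnitalStarSubalgebra.le_topologicalClosure _
    (NonUnitalStarAlgebra.subset_adjoin ℂ _ ⟨h, isLaurent_laurentOp β.self h⟩)

theorem IsLaurent.eq_end {β : CStarAction G B} {φ : C_c(G, B)} {T : adjointableEnd B (L2 G B B)}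
    (h : IsLaurent β.self φ T.1) : T = laurentEnd β φ :=
  IsLaurent.eq (T := (T : adjointable B (L2 G B B) (L2 G B B))) β.self h

/-- The involution `h⋆(r) = Δ(r)⁻¹ β_r(h(r⁻¹)⋆)` on `C_c(G, B)`. -/
noncomputable def ccStar (β : CStarAction G B) (h : C_c(G, B)) : C_c(G, B) where
  toFun r := (modular r)⁻¹ • β.toFun r (star (h r⁻¹))
  continuous_toFun := continuous_modular_inv.smul (Continuous.cstarAction continuous_id (by fun_prop))
  hasCompactSupport' := (h.hasCompactSupport.comp_homeomorph (Homeomorph.inv G)).mono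
    fun r hr h0 => hr (by
      change h r⁻¹ = 0 at h0
      simp only [h0, star_zero, map_zero, smul_zero])

/-- Inverting the variable r in the adjoint kernel produces the factor Δ(r)⁻¹ of the involution.
Hence the adjoint of a Laurent operator with symbol in C_c(G, B) is again one. -/
theorem laurentAdj_self (β : CStarAction G B) (h f : C_c(G, B)) :
    laurentAdj β.self h f = laurentFun β.self (ccStar β h) f := by
  ext s
  rw [laurentAdj_apply, laurentFun_apply]
  have h1 := integral_modular_inv_smul_inv
    (kernelSlice (laurentAdjKernel β.self h f) s).continuous
    (kernelSlice (laurentAdjKernel β.self h f) s).hasCompactSupport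
  refine h1.symm.trans (integral_congr_ae (.of_forall fun r => ?_))
  change (modular r)⁻¹ • (star (β.toFun (r⁻¹ * s)⁻¹ (h r⁻¹)) * f (r⁻¹ * s)) =
    β.toFun s⁻¹ ((modular r)⁻¹ • β.toFun r (star (h r⁻¹))) * f (r⁻¹ * s)
  rw [← Complex.coe_smul ((modular r)⁻¹) (β.toFun r _), map_smul, Complex.coe_smul, ← β.map_mul,
    ← map_star, smul_mul_assoc, mul_inv_rev, inv_inv]

theorem star_laurentEnd (β : CStarAction G B) (h : C_c(G, B)) :
    star (laurentEnd β h) = laurentEnd β (ccStar β h) := by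
  refine Subtype.ext (clm_ext_L2 fun g => ext_ip B fun x => ?_)
  refine (denseRange_toL2 G B B).induction_on (p := fun x =>
    (ip x ((star (laurentEnd β h)).1 (toL2 G B B g)) : B) =
      ip x ((laurentEnd β (ccStar β h)).1 (toL2 G B B g))) x
    (isClosed_eq (continuous_id.ip continuous_const) (continuous_id.ip continuous_const))
    fun f => ?_
  rw [laurentEnd_toL2, ← laurentAdj_self, ← ip_laurentFun, ← laurentEnd_toL2, ← star_coe_eq,
    star_star]

/-- A closed subalgebra of `L(L²(G, B))` containing the Laurent operators contains
`B ⋊_r G`. -/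
theorem crossedAlg_le (β : CStarAction G B) (P : NonUnitalSubalgebra ℂ (adjointableEnd B (L2 G B B)))
    (hP : IsClosed (P : Set (adjointableEnd B (L2 G B B)))) (h : ∀ φ, laurentEnd β φ ∈ P)
    {c : adjointableEnd B (L2 G B B)} (hc : c ∈ crossedAlg β) : c ∈ P := by
  refine closure_minimal ?_ hP hc
  intro T hT
  have h1 : T ∈ (NonUnitalStarAlgebra.adjoin ℂ {T : adjointableEnd B (L2 G B B) |
      ∃ φ : C_c(G, B), IsLaurent β.self φ T.1}).toNonUnitalSubalgebra := hT
  -- The generated *-algebra is the algebra generated by the Laurent operators and their adjoints,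
  -- and these adjoints are Laurent operators themselves.
  rw [NonUnitalStarAlgebra.adjoin_toNonUnitalSubalgebra] at h1
  refine NonUnitalAlgebra.adjoin_le (S := P) ?_ h1
  rintro T (⟨φ, hφ⟩ | ⟨φ, hφ⟩)
  · rw [IsLaurent.eq_end hφ]; exact h φ
  · rw [← star_star T, IsLaurent.eq_end hφ, star_laurentEnd]; exact h _

/-! ### Laurent operators with symbols in a Hilbert module -/

variable {β : CStarAction G B} (γ : ModuleAction β E)

/-- The function `t ↦ ξ h(t)`. -/
noncomputable def ccRact (ξ : E) (h : C_c(G, B)) : C_c(G, E) where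
  toFun t := ract ξ (h t)
  continuous_toFun := continuous_const.ract h.continuous
  hasCompactSupport' := h.hasCompactSupport.mono fun t ht h0 => ht (by simp only [h0, ract_zero])

theorem ccSmul_ract (χ : C_c(G, ℂ)) (ξ : E) (b : B) :
    ccSmul χ (ract ξ b) = ccRact ξ (ccSmul χ b) :=
  CompactlySupportedContinuousMap.ext fun _ => (ract_smul _ _ _).symm

variable (B E) in
theorem dense_span_ract : Dense (Submodule.span ℂ {y : E | ∃ ξ, ∃ b : B, y = ract ξ b} : Set E) :=
  fun x => Metric.mem_closure_iff.2 fun ε hε => by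
    obtain ⟨b, hb⟩ := exists_ract_near B x hε
    exact ⟨_, Submodule.subset_span ⟨x, b, rfl⟩, by rwa [dist_eq_norm]⟩

/-- The link between E ⋊_r G and the operators M_ξ: a symbol of the form ξ h splits off an element
of B ⋊_r G. By `dense_span_ract` such symbols suffice to approximate all others. The case E = B
shows that M_b λ_k is a Laurent operator of B ⋊_r G. -/
theorem mulEnd_creationOp (ξ : E) (h : C_c(G, B)) :
    mulEnd (creationOp γ ξ) (laurentEnd β h) = laurentOp γ (ccRact ξ h) := by
  refine Subtype.ext (clm_ext_L2 fun f => ?_)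
  change (creationOp γ ξ).1 ((laurentEnd β h).1 (toL2 G B B f)) = _
  rw [laurentEnd_toL2, creationOp_toL2, laurentOp_toL2]
  congr 1
  ext t
  rw [creation_apply, laurentFun_apply, laurentFun_apply]
  refine (ract_integral _ (integrable_kernel (laurentKernel β.self h f) t)).trans ?_
  refine integral_congr_ae (.of_forall fun r => ?_)
  change ract (γ.toFun t⁻¹ ξ) (β.toFun t⁻¹ (h r) * f (r⁻¹ * t)) =
    ract (γ.toFun t⁻¹ (ract ξ (h r))) (f (r⁻¹ * t))
  rw [γ.map_ract, ract_mul]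

theorem starMul_mulEnd_mulEnd {H K : Type*} [NormedAddCommGroup H] [NormedSpace ℂ H]
    [HilbertModule B H] [NormedAddCommGroup K] [NormedSpace ℂ K] [HilbertModule B K]
    (S T : adjointable B H K) (c d : adjointableEnd B H) :
    starMul (mulEnd S c) (mulEnd T d) = star c * (starMul S T * d) := by
  rw [starMul_mulEnd, ← star_starMul, starMul_mulEnd, star_mul, star_starMul, mul_assoc]

/-- For symbols ξ h and η k the product is λ_h⋆ M_⟨ξ,η⟩ λ_k = λ_h⋆ λ_(⟨ξ,η⟩ k), visibly in B ⋊_r G.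
General symbols follow by approximation in one variable at a time. -/
theorem starMul_laurentOp_mem (φ ψ : C_c(G, E)) :
    starMul (laurentOp γ φ) (laurentOp γ ψ) ∈ crossedAlg β := by
  have hcl : IsClosed ((crossedAlg β).toNonUnitalSubalgebra.toSubmodule :
      Set (adjointableEnd B (L2 G B B))) := inferInstanceAs
    (IsClosed (crossedAlg β : Set (adjointableEnd B (L2 G B B))))
  have key : ∀ S : adjointable B (L2 G B B) (L2 G B E),
      (∀ ξ h, starMul S (laurentOp γ (ccRact ξ h)) ∈ crossedAlg β) →
      ∀ ψ, starMul S (laurentOp γ ψ) ∈ crossedAlg β := fun S hS ψ =>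
    ((isIndBounded_laurentOp γ).clm_comp (starMulL S)).mem_of_ccSmul (dense_span_ract B E) hcl
      (by rintro χ _ ⟨ξ, b, rfl⟩; rw [ccSmul_ract]; exact hS _ _) ψ
  refine key _ (fun ξ h => ?_) ψ
  rw [← star_starMul]
  refine star_mem (key _ (fun η k => ?_) φ)
  rw [← mulEnd_creationOp, ← mulEnd_creationOp, starMul_mulEnd_mulEnd]
  refine mul_mem (star_mem (laurentEnd_mem β h)) ?_
  have : starMul (creationOp γ ξ) (creationOp γ η) * laurentEnd β k =
      laurentEnd β (ccRact (ip ξ η : B) k) := by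
    rw [starMul_creationOp]
    exact mulEnd_creationOp β.self (ip ξ η : B) k
  rw [this]
  exact laurentEnd_mem β _

theorem hasCrossedModule : HasCrossedModule γ where
  exists_op φ := ⟨laurentOp γ φ, isLaurent_laurentOp γ φ⟩
  admissible := by
    rintro S ⟨φ, hφ⟩ T ⟨ψ, hψ⟩
    rw [IsLaurent.eq γ hφ, IsLaurent.eq γ hψ]
    exact starMul_laurentOp_mem γ φ ψ

/-- The operators in `E ⋊_r G`. -/
noncomputable abbrev crossedSpan : Submodule ℂ (adjointable B (L2 G B B) (L2 G B E)) :=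
  spanSubmodule (crossedAlg β) (laurents γ)

theorem laurentOp_mem (φ : C_c(G, E)) : laurentOp γ φ ∈ crossedSpan γ :=
  mem_spanSubmodule _ (hasCrossedModule γ).admissible ⟨φ, isLaurent_laurentOp γ φ⟩

/-- The c ∈ B ⋊_r G with M_ξ c ∈ E ⋊_r G form a closed subalgebra, and it contains λ_h because M_ξ
λ_h is a Laurent operator. -/
theorem mulEnd_creationOp_mem (ξ : E) {c : adjointableEnd B (L2 G B B)} (hc : c ∈ crossedAlg β) :
    mulEnd (creationOp γ ξ) c ∈ crossedSpan γ := by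
  let P : NonUnitalSubalgebra ℂ (adjointableEnd B (L2 G B B)) :=
    { carrier := {c | c ∈ crossedAlg β ∧ mulEnd (creationOp γ ξ) c ∈ crossedSpan γ}
      add_mem' := fun {a b} ha hb => ⟨add_mem ha.1 hb.1, by
        have : mulEnd (creationOp γ ξ) (a + b) =
            mulEnd (creationOp γ ξ) a + mulEnd (creationOp γ ξ) b :=
          Subtype.ext (ContinuousLinearMap.comp_add _ _ _)
        rw [this]; exact add_mem ha.2 hb.2⟩
      zero_mem' := ⟨zero_mem _, by
        have : mulEnd (creationOp γ ξ) 0 = 0 := Subtype.ext (ContinuousLinearMap.comp_zero _)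
        rw [this]; exact zero_mem _⟩
      mul_mem' := fun {a b} ha hb => ⟨mul_mem ha.1 hb.1, mulEnd_mem ha.2 hb.1⟩
      smul_mem' := fun z a ha => ⟨SMulMemClass.smul_mem z ha.1, by
        have : mulEnd (creationOp γ ξ) (z • a) = z • mulEnd (creationOp γ ξ) a :=
          Subtype.ext (ContinuousLinearMap.comp_smul _ _ _)
        rw [this]; exact Submodule.smul_mem _ z ha.2⟩ }
  refine (crossedAlg_le β P ?_ (fun h => ⟨laurentEnd_mem β h, ?_⟩) hc).2
  · have hC : IsClosed (crossedAlg β : Set (adjointableEnd B (L2 G B B))) := inferInstance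
    refine hC.inter ?_
    exact (Submodule.isClosed_topologicalClosure _).preimage
      (compL (creationOp γ ξ) : adjointable B (L2 G B B) (L2 G B B) →L[ℂ] _).continuous
  · rw [mulEnd_creationOp]; exact laurentOp_mem γ _

/-- A closed subspace containing all `M_ξ λ_h c` contains `E ⋊_r G`. -/
theorem crossedSpan_le {Q : Submodule ℂ (adjointable B (L2 G B B) (L2 G B E))}
    (hQ : IsClosed (Q : Set (adjointable B (L2 G B B) (L2 G B E))))
    (h : ∀ (ξ : E), ∀ c ∈ crossedAlg β, mulEnd (creationOp γ ξ) c ∈ Q) : crossedSpan γ ≤ Q := by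
  refine Submodule.topologicalClosure_minimal _ (Submodule.span_le.2 ?_) hQ
  rintro _ ⟨T, ⟨φ, hφ⟩, c, hc, rfl⟩
  rw [IsLaurent.eq γ hφ]
  -- By approximation the symbol may be taken of the form ξ h, and then λ_(ξ h) c = M_ξ(λ_h c) is
  -- covered by the hypothesis.
  refine (isIndBounded_laurentOp γ).mem_of_ccSmul (dense_span_ract B E)
    (N := Q.comap (mulEndL (K := L2 G B E) c).toLinearMap)
    (hQ.preimage (mulEndL (K := L2 G B E) c).continuous) ?_ φ
  rintro χ _ ⟨ξ, b, rfl⟩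
  rw [ccSmul_ract]
  change mulEnd (laurentOp γ (ccRact ξ (ccSmul χ b))) c ∈ Q
  rw [← mulEnd_creationOp, mulEnd_mulEnd]
  exact h _ _ (mul_mem (laurentEnd_mem β _) hc)

end Crossed

end HilbertModule

/-! ### Approximation with respect to Haar measure -/

section Approximation

variable {G : Type*} [Group G] [TopologicalSpace G] [IsTopologicalGroup G]
  [LocallyCompactSpace G] [T2Space G] [MeasurableSpace G] [BorelSpace G]
  {Y : Type*} [NormedAddCommGroup Y] [NormedSpace ℂ Y]

/-- A continuous function whose integrals against `C_c(G)` lie in a closed subspace takes values in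
this subspace. -/
theorem mem_of_forall_integral_smul [CompleteSpace Y] {w : G → Y} (hw : Continuous w) {N : Submodule ℂ Y}
    (hN : IsClosed (N : Set Y)) (h : ∀ χ : C_c(G, ℂ), ∫ t, χ t • w t ∂Measure.haar ∈ N) (s : G) :
    w s ∈ N := by
  refine hN.closure_subset (Metric.mem_closure_iff.2 fun ε hε => ?_)
  -- A bump function at s that vanishes where w is not within ε/2 of w(s); the normalised integral
  -- of χ w is then an average of values close to w(s).
  obtain ⟨χ, hχ1, hχ0, hχc, hχ⟩ := exists_continuous_one_zero_of_isCompact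
    (isCompact_singleton (x := s)) (t := {t | ‖w t - w s‖ < ε / 2}ᶜ)
    (isOpen_lt (by fun_prop) continuous_const).isClosed_compl (by simpa using half_pos hε)
  have hpos : 0 < ∫ t, χ t ∂Measure.haar :=
    χ.continuous.integral_pos_of_hasCompactSupport_nonneg_nonzero hχc (fun t => (hχ t).1)
      (x := s) (by rw [hχ1 rfl]; exact one_ne_zero)
  set c := ∫ t, χ t ∂Measure.haar
  let ψ : C_c(G, ℂ) :=
    { toFun := fun t => (χ t : ℂ)
      continuous_toFun := by fun_prop
      hasCompactSupport' := hχc.comp_left (g := fun x : ℝ => (x : ℂ)) Complex.ofReal_zero }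
  have hi : Integrable (fun t => χ t • w t) Measure.haar :=
    (χ.continuous.smul hw).integrable_of_hasCompactSupport hχc.smul_right
  have hi' : Integrable (fun t => χ t) Measure.haar :=
    χ.continuous.integrable_of_hasCompactSupport hχc
  have h1 : ∫ t, ψ t • w t ∂Measure.haar = ∫ t, χ t • w t ∂Measure.haar :=
    integral_congr_ae (.of_forall fun t => Complex.coe_smul (χ t) (w t))
  have h2 : ‖∫ t, χ t • w t ∂Measure.haar - c • w s‖ ≤ c * (ε / 2) := by
    rw [← integral_smul_const, ← integral_sub hi (hi'.smul_const _), ← integral_mul_const]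
    refine norm_integral_le_of_norm_le (hi'.mul_const _) (.of_forall fun t => ?_)
    rw [← smul_sub, norm_smul, Real.norm_of_nonneg (hχ t).1]
    by_cases ht : ‖w t - w s‖ < ε / 2
    · gcongr; exact (hχ t).1
    · rw [hχ0 (show t ∈ _ from ht)]; simp
  refine ⟨((c⁻¹ : ℝ) : ℂ) • ∫ t, ψ t • w t ∂Measure.haar, N.smul_mem _ (h ψ), ?_⟩
  rw [dist_comm, dist_eq_norm, h1, Complex.coe_smul]
  have h3 : c⁻¹ • ∫ t, χ t • w t ∂Measure.haar - w s =
      c⁻¹ • (∫ t, χ t • w t ∂Measure.haar - c • w s) := by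
    rw [smul_sub, smul_smul, inv_mul_cancel₀ hpos.ne', one_smul]
  rw [h3, norm_smul, Real.norm_of_nonneg (inv_nonneg.2 hpos.le)]
  calc c⁻¹ * _ ≤ c⁻¹ * (c * (ε / 2)) := by gcongr
    _ < ε := by rw [inv_mul_cancel_left₀ hpos.ne']; exact half_lt_self hε

/-- A set A of finite measure carries the integral up to ε/2; inner regularity gives a compact K ⊆ A
with A \ K small, and absolute continuity bounds the rest. No σ-compactness of G is involved. -/
theorem exists_isCompact_setLIntegral_compl_lt {k : G → ENNReal}
    (hk : ∫⁻ t, k t ∂Measure.haar ≠ ⊤) {ε : ENNReal} (hε : ε ≠ 0) :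
    ∃ K : Set G, IsCompact K ∧ ∫⁻ t in Kᶜ, k t ∂Measure.haar < ε := by
  have hε' : ε / 2 ≠ 0 := (ENNReal.half_pos hε).ne'
  obtain ⟨A, hA, hAfin, hAk⟩ := exists_setLIntegral_compl_lt hk hε'
  obtain ⟨δ, hδ, hδk⟩ := exists_pos_setLIntegral_lt_of_measure_lt hk hε'
  obtain ⟨K, hKA, hK, hAK⟩ := hA.exists_isCompact_sdiff_lt hAfin.ne hδ.ne'
  refine ⟨K, hK, ?_⟩
  have h2 : Kᶜ ⊆ (A \ K) ∪ Aᶜ := fun t ht => by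
    by_cases hA : t ∈ A
    · exact .inl ⟨hA, ht⟩
    · exact .inr hA
  calc ∫⁻ t in Kᶜ, k t ∂Measure.haar ≤ ∫⁻ t in (A \ K) ∪ Aᶜ, k t ∂Measure.haar :=
        lintegral_mono_set h2
    _ ≤ ∫⁻ t in A \ K, k t ∂Measure.haar + ∫⁻ t in Aᶜ, k t ∂Measure.haar :=
        lintegral_union_le _ _ _
    _ < ε / 2 + ε / 2 := ENNReal.add_lt_add (hδk _ hAK) hAk
    _ = ε := ENNReal.add_halves ε

/-- Compactly supported continuous cutoff functions approximate the identity on integrable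
functions. -/
theorem exists_cutoff {k : G → Y} (hk : Integrable k Measure.haar) {ε : ℝ} (hε : 0 < ε) :
    ∃ χ : G → ℝ, Continuous χ ∧ HasCompactSupport χ ∧
      ∫ t, ‖k t - χ t • k t‖ ∂Measure.haar ≤ ε := by
  obtain ⟨K, hK, hKk⟩ := exists_isCompact_setLIntegral_compl_lt hk.2.ne
    (ENNReal.ofReal_pos.2 hε).ne'
  obtain ⟨χ, hχ1, -, hχc, hχ⟩ := exists_continuous_one_zero_of_isCompact hK isClosed_empty
    (Set.disjoint_empty _)
  refine ⟨χ, χ.continuous, hχc, ?_⟩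
  have hm := hk.1.sub ((χ.continuous.stronglyMeasurable_of_hasCompactSupport
    hχc).aestronglyMeasurable.smul hk.1)
  refine (integral_norm_eq_lintegral_enorm hm).trans_le ?_
  refine ENNReal.toReal_le_of_le_ofReal hε.le (le_trans ?_ hKk.le)
  rw [← lintegral_indicator hK.measurableSet.compl]
  refine lintegral_mono fun t => ?_
  by_cases ht : t ∈ K
  · change ‖k t - χ t • k t‖ₑ ≤ _
    rw [hχ1 ht]; simp
  · rw [Set.indicator_of_mem (show t ∈ Kᶜ from ht)]
    refine enorm_le_iff_norm_le.2 ?_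
    have : (k - ⇑χ • k) t = (1 - χ t) • k t := by rw [sub_smul, one_smul]; rfl
    rw [this, norm_smul, Real.norm_of_nonneg (sub_nonneg.2 (hχ t).2)]
    exact mul_le_of_le_one_left (norm_nonneg _) (sub_le_self _ (hχ t).1)

/-- A continuous function dominated by an integrable one is integrable. -/
theorem integrable_of_continuous_of_norm_le {Z : Type*} [NormedAddCommGroup Z] {k : G → Y}
    (hk : Integrable k Measure.haar) {k' : G → Z} (hk' : Continuous k') {C : ℝ}
    (h : ∀ s, ‖k' s‖ ≤ C * ‖k s‖) : Integrable k' Measure.haar := by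
  have hex : ∀ n : ℕ, ∃ K : Set G, IsCompact K ∧
      ∫⁻ t in Kᶜ, ‖k t‖ₑ ∂Measure.haar < ((n : ENNReal) + 1)⁻¹ := fun n =>
    exists_isCompact_setLIntegral_compl_lt hk.2.ne (by simp)
  choose K hK hKk using hex
  -- Measurability is the point: on a group that is not σ-compact, a continuous function need not be
  -- a.e. strongly measurable. But k vanishes a.e. off the σ-compact set U, hence so does k', and on
  -- U continuity suffices.
  set U := ⋃ n, K n
  have hU : MeasurableSet U := MeasurableSet.iUnion fun n => (hK n).measurableSet
  have h0 : ∫⁻ t in Uᶜ, ‖k t‖ₑ ∂Measure.haar = 0 := by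
    have h3 : Filter.Tendsto (fun n : ℕ => ((n : ENNReal) + 1)⁻¹) Filter.atTop (𝓝 0) := by
      simpa only [Nat.cast_add, Nat.cast_one] using
        (Filter.tendsto_add_atTop_iff_nat 1).2 ENNReal.tendsto_inv_nat_nhds_zero
    refine le_antisymm (ge_of_tendsto' h3 fun n => ?_) zero_le
    exact (lintegral_mono_set (Set.compl_subset_compl.2 (Set.subset_iUnion K n))).trans (hKk n).le
  have h1 : ∀ᵐ t ∂Measure.haar, t ∈ Uᶜ → k' t = 0 := by
    rw [← ae_restrict_iff' hU.compl]
    filter_upwards [(lintegral_eq_zero_iff' hk.1.enorm.restrict).1 h0] with t ht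
    have : k t = 0 := enorm_eq_zero.1 ht
    exact norm_le_zero_iff.1 ((h t).trans_eq (by rw [this, norm_zero, mul_zero]))
  have hm : AEStronglyMeasurable k' Measure.haar := by
    have h2 : AEStronglyMeasurable (U.indicator k') Measure.haar := by
      rw [aestronglyMeasurable_indicator_iff hU, aestronglyMeasurable_iUnion_iff]
      exact fun n => hk'.continuousOn.aestronglyMeasurable_of_isCompact (hK n)
        (hK n).measurableSet
    refine h2.congr ?_
    filter_upwards [h1] with t ht
    by_cases htU : t ∈ U
    · rw [Set.indicator_of_mem htU]
    · rw [Set.indicator_of_notMem htU, ht htU]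
  refine (hk.norm.const_mul C).mono' hm (.of_forall h)

end Approximation

namespace HilbertModule

section L1Symbol

variable {G : Type*} [Group G] [TopologicalSpace G] [IsTopologicalGroup G]
  [LocallyCompactSpace G] [T2Space G] [MeasurableSpace G] [BorelSpace G]
  {B E : Type*} [NonUnitalCStarAlgebra B] [NormedAddCommGroup E] [NormedSpace ℂ E]
  [HilbertModule B E] (β : CStarAction G B)

/-! ### Operators with continuous integrable symbols -/

/-- The kernel `(t, r) ↦ f(t)⋆ β_t⁻¹(k(r)) g(r⁻¹ t)`. -/
noncomputable def symbolKernel (f g : C_c(G, B)) {k : G → B} (hk : Continuous k) :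
    C_c(G × G, B) where
  toFun z := star (f z.1) * (β.toFun z.1⁻¹ (k z.2) * g (z.2⁻¹ * z.1))
  continuous_toFun := (by fun_prop : Continuous fun z : G × G => star (f z.1)).mul
    ((Continuous.cstarAction (by fun_prop) (by fun_prop)).mul (by fun_prop))
  hasCompactSupport' := by
    -- The symbol k need not have compact support: f confines the first variable to supp f, and then
    -- g confines the second to (supp f)(supp g)⁻¹.
    refine HasCompactSupport.intro (f.hasCompactSupport.isCompact.prod
      (f.hasCompactSupport.isCompact.mul g.hasCompactSupport.isCompact.inv)) fun z hz => ?_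
    by_contra h0
    have h1 : z.1 ∈ tsupport f := subset_tsupport _ fun h => h0 (by rw [h, star_zero, zero_mul])
    have h2 : z.2⁻¹ * z.1 ∈ tsupport g := subset_tsupport _ fun h =>
      h0 (by rw [h, mul_zero, mul_zero])
    exact hz ⟨h1, z.1, h1, (z.2⁻¹ * z.1)⁻¹, Set.inv_mem_inv.2 h2, by simp⟩

/-- The function `r ↦ ⟨f, k(r) (r · g)⟩` of which the form of the operator with symbol `k` is the
integral. -/
noncomputable def symbolForm (k : G → B) (f g : C_c(G, B)) (r : G) : B :=
  ip (toL2 G B B f) (toL2 G B B (creation β.self (k r) (shift r g)))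

theorem kernelInt_symbolKernel (f g : C_c(G, B)) {k : G → B} (hk : Continuous k) (r : G) :
    kernelInt (symbolKernel β f g hk) r = symbolForm β k f g r :=
  (ip_toL2 (B := B) f (creation β.self (k r) (shift r g))).symm

theorem integrable_symbolForm (f g : C_c(G, B)) {k : G → B} (hk : Continuous k) :
    Integrable (symbolForm β k f g) Measure.haar :=
  (integrable_cc (kernelInt (symbolKernel β f g hk))).congr
    (.of_forall fun r => kernelInt_symbolKernel β f g hk r)

/-- Integrated over r, this bounds the change of the form by the L¹-distance of the symbols, which
allows limits in the symbol. -/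
theorem norm_symbolForm_sub_le (k k' : G → B) (f g : C_c(G, B)) (r : G) :
    ‖symbolForm β k f g r - symbolForm β k' f g r‖ ≤
      ‖k r - k' r‖ * (‖toL2 G B B f‖ * ‖toL2 G B B g‖) := by
  have h1 : symbolForm β k f g r - symbolForm β k' f g r =
      ip (toL2 G B B f) (toL2 G B B (creation β.self (k r - k' r) (shift r g))) := by
    have : creation β.self (k r - k' r) (shift r g) =
        creation β.self (k r) (shift r g) - creation β.self (k' r) (shift r g) := by
      ext t
      change β.toFun t⁻¹ (k r - k' r) * _ = β.toFun t⁻¹ (k r) * _ - β.toFun t⁻¹ (k' r) * _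
      rw [map_sub, sub_mul]
    rw [this, map_sub, ip_sub_right]; rfl
  rw [h1]
  refine (norm_ip_le B _ _).trans ?_
  refine (mul_le_mul_of_nonneg_left (norm_creation_le β.self _ _) (norm_nonneg _)).trans_eq ?_
  rw [norm_toL2_shift]
  ring

theorem ip_laurentEnd (k f g : C_c(G, B)) :
    (ip (toL2 G B B f) ((laurentEnd β k).1 (toL2 G B B g)) : B) =
      ∫ r, symbolForm β k f g r ∂Measure.haar := by
  rw [laurentEnd_toL2, ← star_ip, ip_laurentFun_eq]
  refine ((starL' ℝ : B ≃L[ℝ] B).toContinuousLinearMap.integral_comp_comm ?_).symm.trans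
    (integral_congr_ae (.of_forall fun r => star_ip _ _))
  refine ((starL' ℝ : B ≃L[ℝ] B).integrable_comp_iff).1
    ((integrable_symbolForm β f g k.continuous).congr (.of_forall fun r => (star_ip _ _).symm))

theorem norm_laurentEnd_sub_le (k k' : C_c(G, B)) :
    ‖laurentEnd β k - laurentEnd β k'‖ ≤ ∫ r, ‖k r - k' r‖ ∂Measure.haar := by
  have h : laurentEnd β k - laurentEnd β k' =
      (laurentOp β.self (k - k') : adjointable B (L2 G B B) (L2 G B B)) :=
    ((laurentOp β.self).map_sub k k').symm
  rw [h]
  exact norm_laurentOp_le β.self (k - k')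

/-- A continuous integrable function is the symbol of an operator in `B ⋊_r G`. -/
theorem exists_mem_crossedAlg {k : G → B} (hk : Continuous k) (hi : Integrable k Measure.haar) :
    ∃ S ∈ crossedAlg β, ∀ f g, (ip (toL2 G B B f) (S.1 (toL2 G B B g)) : B) =
      ∫ r, symbolForm β k f g r ∂Measure.haar := by
  -- Cutting off k gives compactly supported symbols converging to it in L¹. Their Laurent operators
  -- are Cauchy since the operator norm is at most the L¹-norm.
  have hex : ∀ n : ℕ, ∃ k' : C_c(G, B), ∫ r, ‖k r - k' r‖ ∂Measure.haar ≤ 1 / (n + 1 : ℝ) := by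
    intro n
    obtain ⟨χ, hχ, hχc, h⟩ := exists_cutoff hi (ε := 1 / (n + 1 : ℝ)) (by positivity)
    exact ⟨⟨⟨fun t => χ t • k t, hχ.smul hk⟩, hχc.smul_right⟩, h⟩
  choose u hu using hex
  have hin : ∀ n, Integrable (fun r => k r - u n r) Measure.haar := fun n =>
    hi.sub (integrable_cc (u n))
  have hsub : ∀ n m, ∫ r, ‖u n r - u m r‖ ∂Measure.haar ≤ 1 / (n + 1 : ℝ) + 1 / (m + 1 : ℝ) := by
    intro n m
    refine le_trans ?_ (add_le_add (hu n) (hu m))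
    rw [← integral_add (hin n).norm (hin m).norm]
    refine integral_mono ((integrable_cc (u n)).sub (integrable_cc (u m))).norm
      ((hin n).norm.add (hin m).norm) fun r => ?_
    change ‖u n r - u m r‖ ≤ ‖k r - u n r‖ + ‖k r - u m r‖
    rw [norm_sub_rev (k r) (u n r)]
    exact norm_sub_le_norm_sub_add_norm_sub _ _ _
  have hc : CauchySeq fun n => laurentEnd β (u n) := by
    refine cauchySeq_of_le_tendsto_0 (fun N : ℕ => 1 / (N + 1 : ℝ) + 1 / (N + 1 : ℝ))
      (fun n m N hn hm => ?_) ?_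
    · rw [dist_eq_norm]
      refine (norm_laurentEnd_sub_le β _ _).trans ((hsub n m).trans ?_)
      gcongr
    · simpa using (tendsto_one_div_add_atTop_nhds_zero_nat (𝕜 := ℝ)).add
        (tendsto_one_div_add_atTop_nhds_zero_nat (𝕜 := ℝ))
  obtain ⟨S, hS⟩ := cauchySeq_tendsto_of_complete hc
  have hC : IsClosed (crossedAlg β : Set (adjointableEnd B (L2 G B B))) := inferInstance
  refine ⟨S, hC.mem_of_tendsto hS (.of_forall fun n => laurentEnd_mem β _), fun f g => ?_⟩
  have h1 : Filter.Tendsto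
      (fun n => (ip (toL2 G B B f) ((laurentEnd β (u n)).1 (toL2 G B B g)) : B)) Filter.atTop
      (𝓝 (ip (toL2 G B B f) (S.1 (toL2 G B B g)))) := by
    have hcont : Continuous fun T : adjointableEnd B (L2 G B B) =>
        (ip (toL2 G B B f) (T.1 (toL2 G B B g)) : B) := continuous_const.ip
      (((ContinuousLinearMap.apply ℂ (L2 G B B) (toL2 G B B g)).continuous).comp
        continuous_subtype_val)
    exact (hcont.tendsto S).comp hS
  refine tendsto_nhds_unique h1 ?_
  simp only [ip_laurentEnd]
  rw [tendsto_iff_norm_sub_tendsto_zero]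
  have hb := (tendsto_one_div_add_atTop_nhds_zero_nat (𝕜 := ℝ)).mul_const
    (‖toL2 G B B f‖ * ‖toL2 G B B g‖)
  rw [zero_mul] at hb
  refine squeeze_zero (fun _ => norm_nonneg _) (fun n => ?_) hb
  have he := integral_sub (integrable_symbolForm β f g hk)
    (integrable_symbolForm β f g (u n).continuous)
  refine (norm_sub_rev _ _).trans_le ((congrArg norm he).symm.trans_le ?_)
  refine (norm_integral_le_of_norm_le ((hin n).norm.mul_const _)
    (.of_forall fun r => norm_symbolForm_sub_le β k (u n) f g r)).trans ?_
  rw [integral_mul_const]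
  gcongr
  exact hu n

end L1Symbol

section Ket

variable {G : Type*} [Group G] [TopologicalSpace G] [IsTopologicalGroup G]
  [LocallyCompactSpace G] [T2Space G] [MeasurableSpace G] [BorelSpace G]
  {B E : Type*} [NonUnitalCStarAlgebra B] [NormedAddCommGroup E] [NormedSpace ℂ E]
  [HilbertModule B E] {β : CStarAction G B} (γ : ModuleAction β E)

/-! ### Square-integrability of relatively `L¹` subspaces -/

/-- The function `t ↦ Δ(t)^(-1/2) γ_t⁻¹(ξ) f(t)`. -/
noncomputable def ketIntegrand (ξ : E) (f : C_c(G, B)) : C_c(G, E) where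
  toFun t := modular t ^ (-(1 / 2) : ℝ) • ract (γ.toFun t⁻¹ ξ) (f t)
  continuous_toFun := (continuous_modular_rpow _).smul (creation γ ξ f).continuous
  hasCompactSupport' := (creation γ ξ f).hasCompactSupport.smul_left

/-- The map `f ↦ ∫ Δ(t)^(-1/2) γ_t⁻¹(ξ) f(t) dt`. -/
noncomputable def ketFun (ξ : E) : C_c(G, B) →ₗ[ℂ] E where
  toFun f := ∫ t, ketIntegrand γ ξ f t ∂Measure.haar
  map_add' f g := by
    rw [← integral_add (integrable_cc _) (integrable_cc _)]
    refine integral_congr_ae (.of_forall fun t => ?_)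
    change modular t ^ (-(1 / 2) : ℝ) • ract (γ.toFun t⁻¹ ξ) (f t + g t) =
      modular t ^ (-(1 / 2) : ℝ) • ract (γ.toFun t⁻¹ ξ) (f t) +
        modular t ^ (-(1 / 2) : ℝ) • ract (γ.toFun t⁻¹ ξ) (g t)
    rw [ract_add, smul_add]
  map_smul' c f := by
    rw [RingHom.id_apply, ← integral_smul]
    refine integral_congr_ae (.of_forall fun t => ?_)
    change modular t ^ (-(1 / 2) : ℝ) • ract (γ.toFun t⁻¹ ξ) (c • f t) =
      c • modular t ^ (-(1 / 2) : ℝ) • ract (γ.toFun t⁻¹ ξ) (f t)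
    rw [ract_smul, smul_comm]

theorem isKet_iff {ξ : E} {T : L2 G B B →L[ℂ] E} :
    IsKet γ ξ T ↔ ∀ f, T (toL2 G B B f) = ketFun γ ξ f := Iff.rfl

/-- The function `r ↦ Δ(r)^(-1/2) ⟨ξ, γ_r(η)⟩`. -/
noncomputable def ketSymbol (ξ η : E) (r : G) : B :=
  modular r ^ (-(1 / 2) : ℝ) • (ip ξ (γ.toFun r η) : B)

theorem continuous_ketSymbol (ξ η : E) : Continuous (ketSymbol γ ξ η) :=
  (continuous_modular_rpow _).smul (continuous_const.ip (γ.continuous η))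

/-- Write the left side as a double integral over s and t and substitute t = r⁻¹ s. The powers of Δ
collapse to Δ(r)^(-1/2), and equivariance turns ⟨γ_s⁻¹ξ, γ_t⁻¹η⟩ into β_s⁻¹⟨ξ, γ_r η⟩. So |ξ⟫⋆|η⟫ is
convolution by `ketSymbol`. -/
theorem ip_ketFun (ξ η : E) (f g : C_c(G, B)) :
    (ip (ketFun γ ξ f) (ketFun γ η g) : B) =
      ∫ r, symbolForm β (ketSymbol γ ξ η) f g r ∂Measure.haar := by
  have hk := continuous_ketSymbol γ ξ η
  have h1 : ∫ r, symbolForm β (ketSymbol γ ξ η) f g r ∂Measure.haar =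
      ∫ s, ∫ r, symbolKernel β f g hk (s, r) ∂Measure.haar ∂Measure.haar := by
    rw [← integral_kernel_swap]
    exact integral_congr_ae (.of_forall fun r => (kernelInt_symbolKernel β f g hk r).symm)
  rw [h1]
  refine (integral_ip _ (integrable_cc (ketIntegrand γ ξ f))).trans ?_
  refine integral_congr_ae (.of_forall fun s => ?_)
  refine (ip_integral _ (integrable_cc (ketIntegrand γ η g))).trans ?_
  -- The extra factor Δ(t) compensates the Δ(t)⁻¹ in `integral_modular_inv_smul`.
  let H : G → B := fun t => (modular t * modular s ^ (-(1 / 2) : ℝ) * modular t ^ (-(1 / 2) : ℝ)) •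
    (star (f s) * (ip (γ.toFun s⁻¹ ξ) (γ.toFun t⁻¹ η) * g t))
  have hHc : HasCompactSupport H := g.hasCompactSupport.mono fun t ht h0 => ht (by
    simp only [H, h0, mul_zero, smul_zero])
  have hH : Continuous H := by
    refine Continuous.smul (f := fun t : G => modular t * modular s ^ (-(1 / 2) : ℝ) *
      modular t ^ (-(1 / 2) : ℝ)) ((continuous_modular.mul continuous_const).mul
      (continuous_modular_rpow _)) (continuous_const.mul (Continuous.mul ?_ g.continuous))
    exact continuous_const.ip (Continuous.action γ continuous_inv continuous_const)
  refine Eq.trans ?_ ((integral_modular_inv_smul hH hHc s).trans ?_)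
  · refine integral_congr_ae (.of_forall fun t => ?_)
    change (ip (modular s ^ (-(1 / 2) : ℝ) • ract (γ.toFun s⁻¹ ξ) (f s))
      (modular t ^ (-(1 / 2) : ℝ) • ract (γ.toFun t⁻¹ η) (g t)) : B) = _
    have hm : (modular t)⁻¹ * (modular t * modular s ^ (-(1 / 2) : ℝ) *
        modular t ^ (-(1 / 2) : ℝ)) = modular t ^ (-(1 / 2) : ℝ) * modular s ^ (-(1 / 2) : ℝ) := by
      have := (modular_pos t).ne'
      field_simp
    simp only [H]
    rw [smul_smul, hm, mul_smul, ← Complex.coe_smul, ← Complex.coe_smul, ip_smul_right,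
      ip_smul_left, ip_ract, ip_ract_left, mul_assoc]
    simp only [Complex.star_def, Complex.conj_ofReal, Complex.coe_smul]
  · refine integral_congr_ae (.of_forall fun r => ?_)
    change (modular (r⁻¹ * s) * modular s ^ (-(1 / 2) : ℝ) * modular (r⁻¹ * s) ^ (-(1 / 2) : ℝ)) •
      (star (f s) * (ip (γ.toFun s⁻¹ ξ) (γ.toFun (r⁻¹ * s)⁻¹ η) * g (r⁻¹ * s))) =
      star (f s) * (β.toFun s⁻¹ (modular r ^ (-(1 / 2) : ℝ) • ip ξ (γ.toFun r η)) * g (r⁻¹ * s))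
    have hm : modular (r⁻¹ * s) * modular s ^ (-(1 / 2) : ℝ) * modular (r⁻¹ * s) ^ (-(1 / 2) : ℝ) =
        modular r ^ (-(1 / 2) : ℝ) := by
      have hr := modular_pos r
      have hs := modular_pos s
      rw [modular_mul, modular_inv, Real.mul_rpow (inv_pos.2 hr).le hs.le,
        Real.inv_rpow hr.le, Real.rpow_neg hr.le, Real.rpow_neg hs.le, ← Real.sqrt_eq_rpow,
        ← Real.sqrt_eq_rpow]
      have h1 := Real.sqrt_pos.2 hr
      have h2 := Real.sqrt_pos.2 hs
      have h3 := Real.sq_sqrt hr.le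
      have h4 := Real.sq_sqrt hs.le
      field_simp
      rw [h3, h4]
      field_simp
    rw [hm, ← Complex.coe_smul (_ : ℝ) (ip ξ (γ.toFun r η) : B), map_smul, Complex.coe_smul,
      smul_mul_assoc, mul_smul_comm, ← γ.map_ip, mul_inv_rev, inv_inv, γ.map_mul s⁻¹ r]

/-- Taking g = χ b with χ concentrated near the identity puts η b into the closed span, and the
elements η b approximate η. -/
theorem dense_span_ketFun {R : Set E} (hR : Dense (R : Set E)) :
    Dense (Submodule.span ℂ {x | ∃ η ∈ R, ∃ g, x = ketFun γ η g} : Set E) := by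
  have : CompleteSpace E := HilbertModule.toCompleteSpace B
  set N := (Submodule.span ℂ {x | ∃ η ∈ R, ∃ g, x = ketFun γ η g}).topologicalClosure
  have hN : IsClosed (N : Set E) := Submodule.isClosed_topologicalClosure _
  have h1 : ∀ η ∈ R, ∀ b : B, ract η b ∈ N := by
    intro η hη b
    have := mem_of_forall_integral_smul (N := N)
      (w := fun t => modular t ^ (-(1 / 2) : ℝ) • ract (γ.toFun t⁻¹ η) b)
      ((continuous_modular_rpow _).smul ((Continuous.action γ continuous_inv
        continuous_const).ract continuous_const)) hN (fun χ => ?_) 1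
    · simpa only [modular_one, Real.one_rpow, one_smul, inv_one, γ.map_one] using this
    · refine Submodule.le_topologicalClosure _ (Submodule.subset_span ⟨η, hη, ccSmul χ b, ?_⟩)
      refine integral_congr_ae (.of_forall fun t => ?_)
      change χ t • modular t ^ (-(1 / 2) : ℝ) • ract (γ.toFun t⁻¹ η) b =
        modular t ^ (-(1 / 2) : ℝ) • ract (γ.toFun t⁻¹ η) (χ t • b)
      rw [ract_smul, smul_comm]
  have h2 : R ⊆ N := fun η hη => hN.closure_subset (Metric.mem_closure_iff.2 fun ε hε => by
    obtain ⟨b, hb⟩ := exists_ract_near B η hε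
    exact ⟨_, h1 η hη b, by rwa [dist_eq_norm]⟩)
  intro x
  exact hN.closure_subset_iff.2 h2 (hR x)

/-- Boundedness: ‖|ξ⟫f‖² = ‖⟨f, S f⟩‖ for the convolution operator S with the symbol of the pair (ξ,
ξ). Adjointability: on |η⟫g with η ∈ R the adjoint is given by convolving g with the symbol of (ξ,
η), and these vectors span a dense subspace because R is dense. -/
theorem exists_ketOp {R : Set E} (hR : Dense R) (h : RelativelyL1 γ R) {ξ : E} (hξ : ξ ∈ R) :
    ∃ T : adjointable B (L2 G B B) E, IsKet γ ξ T.1 := by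
  have : CompleteSpace E := HilbertModule.toCompleteSpace B
  have hb : ∃ C, ∀ f, ‖ketFun γ ξ f‖ ≤ C * ‖toL2 G B B f‖ := by
    obtain ⟨S, -, hS⟩ := exists_mem_crossedAlg β (continuous_ketSymbol γ ξ ξ) (h ξ hξ ξ hξ).1
    refine ⟨√‖S.1‖, fun f => ?_⟩
    refine le_of_sq_le_sq ?_ (by positivity)
    rw [norm_sq (B := B), ip_ketFun, ← hS, mul_pow, Real.sq_sqrt (norm_nonneg _)]
    refine (norm_ip_le B _ _).trans ?_
    refine (mul_le_mul_of_nonneg_left (S.1.le_opNorm _) (norm_nonneg _)).trans_eq ?_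
    ring
  have hV : ∀ f, (ketFun γ ξ).extendOfNorm (toL2 G B B) (toL2 G B B f) = ketFun γ ξ f :=
    LinearMap.extendOfNorm_eq (denseRange_toL2 G B B) hb
  refine ⟨⟨(ketFun γ ξ).extendOfNorm (toL2 G B B), mem_adjointable_of_dense _
    (dense_span_ketFun γ hR) ?_⟩, hV⟩
  rintro _ ⟨η, hη, g, rfl⟩
  obtain ⟨S, -, hS⟩ := exists_mem_crossedAlg β (continuous_ketSymbol γ ξ η) (h ξ hξ η hη).1
  refine ⟨S.1 (toL2 G B B g), fun x => ?_⟩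
  refine (denseRange_toL2 G B B).induction_on
    (p := fun x => (ip ((ketFun γ ξ).extendOfNorm (toL2 G B B) x) (ketFun γ η g) : B) =
      ip x (S.1 (toL2 G B B g))) x (isClosed_eq
        (((ketFun γ ξ).extendOfNorm (toL2 G B B)).continuous.ip continuous_const)
        (continuous_id.ip continuous_const)) fun f => ?_
  rw [hV, hS, ip_ketFun]

theorem IsKet.eq {ξ : E} {S T : adjointable B (L2 G B B) E} (hS : IsKet γ ξ S.1)
    (hT : IsKet γ ξ T.1) : S = T :=
  Subtype.ext (clm_ext_L2 fun f => (hS f).trans (hT f).symm)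

/-- A dense relatively `L¹` subspace is relatively continuous. -/
theorem RelativelyL1.relativelyContinuous {R : Set E} (hR : Dense R) (h : RelativelyL1 γ R) :
    RelativelyContinuous γ R where
  squareIntegrable _ hξ := exists_ketOp γ hR h hξ
  admissible := by
    rintro S ⟨ξ, hξ, hS⟩ T ⟨η, hη, hT⟩
    obtain ⟨Q, hQ, hQ'⟩ := exists_mem_crossedAlg β (continuous_ketSymbol γ ξ η) (h ξ hξ η hη).1
    have key : ∀ f g : C_c(G, B), (ip (toL2 G B B f) ((starMul S T).1 (toL2 G B B g)) : B) =
        ip (toL2 G B B f) (Q.1 (toL2 G B B g)) := fun f g => by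
      rw [starMul_apply, (isKet_iff γ).1 hS, (isKet_iff γ).1 hT, ip_ketFun, hQ']
    have : starMul S T = Q := by
      refine Subtype.ext (clm_ext_L2 fun g => ext_ip B fun x => ?_)
      exact (denseRange_toL2 G B B).induction_on (p := fun x => (ip x _ : B) = ip x _) x
        (isClosed_eq (continuous_id.ip continuous_const) (continuous_id.ip continuous_const))
        fun f => key f g
    rw [this]
    exact hQ

end Ket

/-! ### Continuity of interior tensor products, and the model A ⊗_φ E = E -/

section Continuity

variable {A D B E M : Type*} [NonUnitalCStarAlgebra A] [NonUnitalCStarAlgebra B]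
  [NormedAddCommGroup D] [NormedSpace ℂ D] [HilbertModule A D]
  [NormedAddCommGroup E] [NormedSpace ℂ E] [HilbertModule B E]
  [NormedAddCommGroup M] [NormedSpace ℂ M] [HilbertModule B M]
  {φ : A →⋆ₙₐ[ℂ] adjointableEnd B E} {τ : D →ₗ[ℂ] E →ₗ[ℂ] M}

/-- The bilinear map of an interior tensor product as a bounded bilinear map. -/
noncomputable def IsTensorModel.toCLM (h : IsTensorModel φ τ) : D →L[ℂ] E →L[ℂ] M :=
  LinearMap.mkContinuous₂ τ 1 fun x y => by rw [one_mul]; exact h.norm_le x y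

theorem IsTensorModel.continuous (h : IsTensorModel φ τ) {T : Type*} [TopologicalSpace T]
    {f : T → D} {g : T → E} (hf : Continuous f) (hg : Continuous g) :
    Continuous fun z => τ (f z) (g z) :=
  h.toCLM.continuous₂.comp (hf.prodMk hg)

/-- The bilinear map `(a, e) ↦ φ(a) e`. -/
noncomputable def actionBilin (φ : A →⋆ₙₐ[ℂ] adjointableEnd B E) : A →ₗ[ℂ] E →ₗ[ℂ] E :=
  LinearMap.mk₂ ℂ (fun a e => (φ a).1 e) (fun a b e => by rw [map_add]; rfl)
    (fun c a e => by rw [map_smul]; rfl) (fun a e e' => map_add _ _ _)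
    fun c a e => map_smul _ _ _

/-- The inner product identity holds for every *-homomorphism φ; nondegeneracy is precisely the
density condition. -/
theorem isTensorModel_actionBilin
    (hφ : Dense (Submodule.span ℂ {x : E | ∃ (a : A) (ξ : E), x = (φ a).1 ξ} : Set E)) :
    IsTensorModel φ (actionBilin φ) where
  ip_eq a e a' e' := by
    change (ip ((φ a).1 e) ((φ a').1 e') : B) = ip e ((φ (star a * a')).1 e')
    rw [map_mul, map_star, ← star_star (φ a), star_coe_eq, star_star]
    rfl
  dense := hφ

/-- The bounded linear map `a ↦ ⟨e, φ(a) e'⟩`. -/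
noncomputable def coefficientL (φ : A →⋆ₙₐ[ℂ] adjointableEnd B E) (e e' : E) : A →L[ℂ] B :=
  LinearMap.mkContinuous ⟨⟨fun a => ip e ((φ a).1 e'), fun a b => by
    rw [map_add]; exact ip_add_right _ _ _⟩, fun c a => by
    change (ip e ((φ (c • a)).1 e') : B) = c • ip e ((φ a).1 e')
    rw [map_smul]; exact ip_smul_right _ _ _⟩ (‖e‖ * ‖e'‖) fun a => by
      refine (norm_ip_le B _ _).trans ?_
      rw [mul_assoc, mul_comm ‖e'‖]
      gcongr
      refine ((φ a).1.le_opNorm e').trans ?_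
      gcongr
      exact NonUnitalStarAlgHom.norm_apply_le φ a

theorem coefficientL_apply (e e' : E) (a : A) :
    coefficientL φ e e' a = (ip e ((φ a).1 e') : B) := rfl

end Continuity

section L2Tensor

variable {G : Type*} [Group G] [TopologicalSpace G] [IsTopologicalGroup G]
  [LocallyCompactSpace G] [T2Space G] [MeasurableSpace G] [BorelSpace G]
  {A D B E M : Type*} [NonUnitalCStarAlgebra A] [NonUnitalCStarAlgebra B]
  [NormedAddCommGroup D] [NormedSpace ℂ D] [HilbertModule A D]
  [NormedAddCommGroup E] [NormedSpace ℂ E] [HilbertModule B E]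
  [NormedAddCommGroup M] [NormedSpace ℂ M] [HilbertModule B M]
  {φ : A →⋆ₙₐ[ℂ] adjointableEnd B E} {τ : D →ₗ[ℂ] E →ₗ[ℂ] M}

/-! ### Interior tensor products of `L²(G, D)` -/

/-- The map `f ↦ (t ↦ τ(f(t), e))`. -/
noncomputable def ccTensor (h : IsTensorModel φ τ) : C_c(G, D) →ₗ[ℂ] E →ₗ[ℂ] C_c(G, M) :=
  LinearMap.mk₂ ℂ (fun f e =>
    { toFun := fun t => τ (f t) e
      continuous_toFun := h.continuous f.continuous continuous_const
      hasCompactSupport' := f.hasCompactSupport.mono fun t ht h0 => ht (by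
        simp only [h0, map_zero, LinearMap.zero_apply]) })
    (fun f g e => CompactlySupportedContinuousMap.ext fun t => LinearMap.map_add₂ τ _ _ _)
    (fun c f e => CompactlySupportedContinuousMap.ext fun t => LinearMap.map_smul₂ τ _ _ _)
    (fun f e e' => CompactlySupportedContinuousMap.ext fun t => (τ (f t)).map_add e e')
    (fun c f e => CompactlySupportedContinuousMap.ext fun t => (τ (f t)).map_smul c e)

theorem ccTensor_apply (h : IsTensorModel φ τ) (f : C_c(G, D)) (e : E) (t : G) :
    ccTensor h f e t = τ (f t) e := rfl

theorem ip_ccTensor (h : IsTensorModel φ τ) (f g : C_c(G, D)) (e e' : E) :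
    (ip (toL2 G B M (ccTensor h f e)) (toL2 G B M (ccTensor h g e')) : B) =
      ip e ((φ (ip (toL2 G A D f) (toL2 G A D g))).1 e') := by
  rw [ip_toL2, ip_toL2, ← coefficientL_apply,
    ← (coefficientL φ e e').integral_comp_comm (integrable_ip A f g)]
  exact integral_congr_ae (.of_forall fun t => h.ip_eq _ _ _ _)

theorem norm_ccTensor_le (h : IsTensorModel φ τ) (f : C_c(G, D)) (e : E) :
    ‖toL2 G B M (ccTensor h f e)‖ ≤ ‖e‖ * ‖toL2 G A D f‖ := by
  refine le_of_sq_le_sq ?_ (by positivity)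
  rw [norm_sq (B := B), ip_ccTensor, ← coefficientL_apply, mul_pow,
    norm_sq (B := A) (toL2 G A D f), pow_two]
  exact ((coefficientL φ e e).le_opNorm _).trans (by
    gcongr
    exact LinearMap.mkContinuous_norm_le _ (by positivity) _)

theorem exists_l2Tensor (h : IsTensorModel φ τ) (e : E) : ∃ T : L2 G A D →L[ℂ] L2 G B M,
    ∀ f, T (toL2 G A D f) = toL2 G B M (ccTensor h f e) := by
  have : CompleteSpace (L2 G B M) := HilbertModule.toCompleteSpace B
  let P : C_c(G, D) →ₗ[ℂ] L2 G B M := toL2 G B M ∘ₗ (ccTensor h).flip e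
  exact ⟨P.extendOfNorm (toL2 G A D), LinearMap.extendOfNorm_eq (denseRange_toL2 G A D)
    ⟨_, fun f => norm_ccTensor_le h f e⟩⟩

/-- The bilinear map `L²(G, D) × E → L²(G, M)` induced by `τ : D × E → M`. -/
noncomputable def l2Tensor (h : IsTensorModel φ τ) : L2 G A D →ₗ[ℂ] E →ₗ[ℂ] L2 G B M :=
  LinearMap.mk₂ ℂ (fun f e => (exists_l2Tensor h e).choose f) (fun f g e => map_add _ _ _)
    (fun c f e => map_smul _ _ _)
    (fun f e e' => by
      have : (exists_l2Tensor (G := G) h (e + e')).choose =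
          (exists_l2Tensor h e).choose + (exists_l2Tensor h e').choose := clm_ext_L2 fun f => by
        rw [add_apply, (exists_l2Tensor h _).choose_spec,
          (exists_l2Tensor h _).choose_spec, (exists_l2Tensor h _).choose_spec, map_add, map_add]
      rw [this]; rfl)
    (fun c f e => by
      have : (exists_l2Tensor (G := G) h (c • e)).choose = c • (exists_l2Tensor h e).choose :=
        clm_ext_L2 fun f => by
          rw [smul_apply, (exists_l2Tensor h _).choose_spec,
            (exists_l2Tensor h _).choose_spec, map_smul, map_smul]
      rw [this]; rfl)

theorem l2Tensor_toL2 (h : IsTensorModel φ τ) (f : C_c(G, D)) (e : E) :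
    l2Tensor h (toL2 G A D f) e = toL2 G B M (ccTensor h f e) :=
  (exists_l2Tensor h e).choose_spec f

theorem dense_of_toL2 {N : Submodule ℂ (L2 G B M)} (h : ∀ f, toL2 G B M f ∈ N.topologicalClosure) :
    Dense (N : Set (L2 G B M)) := fun x => by
  refine (denseRange_toL2 G B M).induction_on (p := fun x => x ∈ closure (N : Set (L2 G B M))) x
    isClosed_closure h

theorem ccTensor_ccSmul (h : IsTensorModel φ τ) (χ : C_c(G, ℂ)) (d : D) (e : E) :
    ccTensor h (ccSmul χ d) e = ccSmul χ (τ d e) :=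
  CompactlySupportedContinuousMap.ext fun _ => LinearMap.map_smul₂ τ _ _ _

/-- L²(G, D) ⊗_φ E = L²(G, D ⊗_φ E): the inner products agree because a ↦ ⟨e, φ(a)e'⟩ passes through
integrals, and the range contains all χ · τ(d, e). For D = A it says that L²(G, A) ⊗_φ E = L²(G, E),
which is what lets operators on L²(G, A) act on L²(G, E). -/
theorem isTensorModel_l2Tensor (h : IsTensorModel φ τ) :
    IsTensorModel φ (l2Tensor (G := G) h) where
  ip_eq f e g e' := by
    have hc : ∀ e, Continuous fun f => l2Tensor (G := G) h f e := fun e =>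
      (exists_l2Tensor (G := G) h e).choose.continuous
    refine (denseRange_toL2 G A D).induction_on (p := fun f =>
      (ip (l2Tensor h f e) (l2Tensor h g e') : B) = ip e ((φ (ip f g)).1 e')) f
      (isClosed_eq ((hc e).ip continuous_const)
        ((coefficientL φ e e').continuous.comp (continuous_id.ip continuous_const))) fun f => ?_
    refine (denseRange_toL2 G A D).induction_on (p := fun g =>
      (ip (l2Tensor h (toL2 G A D f) e) (l2Tensor h g e') : B) =
        ip e ((φ (ip (toL2 G A D f) g)).1 e')) g
      (isClosed_eq (continuous_const.ip (hc e'))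
        ((coefficientL φ e e').continuous.comp (continuous_const.ip continuous_id))) fun g => ?_
    rw [l2Tensor_toL2, l2Tensor_toL2, ip_ccTensor]
  dense := dense_of_toL2 fun f => isIndBounded_toL2.mem_of_ccSmul h.dense
    (Submodule.isClosed_topologicalClosure _) (by
      rintro χ _ ⟨d, e, rfl⟩
      refine Submodule.le_topologicalClosure _ (Submodule.subset_span ⟨toL2 G A D (ccSmul χ d), e, ?_⟩)
      rw [l2Tensor_toL2, ccTensor_ccSmul]) f

end L2Tensor

section Amplification

variable {G : Type*} [Group G] [TopologicalSpace G] [IsTopologicalGroup G]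
  [LocallyCompactSpace G] [T2Space G] [MeasurableSpace G] [BorelSpace G]
  {A D B E M : Type*} [NonUnitalCStarAlgebra A] [NonUnitalCStarAlgebra B]
  [NormedAddCommGroup D] [NormedSpace ℂ D] [HilbertModule A D]
  [NormedAddCommGroup E] [NormedSpace ℂ E] [HilbertModule B E]
  [NormedAddCommGroup M] [NormedSpace ℂ M] [HilbertModule B M]
  {φ : A →⋆ₙₐ[ℂ] adjointableEnd B E} {τ : D →ₗ[ℂ] E →ₗ[ℂ] M}
  {α : CStarAction G A} {β : CStarAction G B}

/-! ### Amplified Laurent operators -/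

variable (h : IsTensorModel φ (actionBilin φ))

/-- The kernel `(r, t) ↦ φ(α_t⁻¹(f(r))) g(r⁻¹ t)`. -/
noncomputable def leftKernel (h : IsTensorModel φ (actionBilin φ)) (α : CStarAction G A)
    (f : C_c(G, A)) (g : C_c(G, E)) : C_c(G × G, E) where
  toFun z := (φ (α.toFun z.2⁻¹ (f z.1))).1 (g (z.1⁻¹ * z.2))
  continuous_toFun := h.continuous (Continuous.cstarAction (by fun_prop) (by fun_prop))
    (by fun_prop)
  hasCompactSupport' := HasCompactSupport.kernel
    (f := fun r t => (φ (α.toFun t⁻¹ (f r))).1 (g (r⁻¹ * t)))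
    f.hasCompactSupport g.hasCompactSupport fun r t h =>
      ⟨subset_tsupport _ fun h0 => h (by rw [h0, map_zero, map_zero]; rfl),
        subset_tsupport _ fun h0 => h (by rw [h0, map_zero])⟩

/-- The map `g ↦ (t ↦ ∫ φ(α_t⁻¹(f(r))) g(r⁻¹ t) dr)`. -/
noncomputable def leftFun (α : CStarAction G A) (f : C_c(G, A)) : C_c(G, E) →ₗ[ℂ] C_c(G, E) :=
  kernelInt ∘ₗ
    { toFun := leftKernel h α f
      map_add' := fun g g' => CompactlySupportedContinuousMap.ext fun z =>
        (φ (α.toFun z.2⁻¹ (f z.1))).1.map_add (g (z.1⁻¹ * z.2)) (g' (z.1⁻¹ * z.2))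
      map_smul' := fun c g => CompactlySupportedContinuousMap.ext fun z =>
        (φ (α.toFun z.2⁻¹ (f z.1))).1.map_smul c (g (z.1⁻¹ * z.2)) }

theorem leftFun_apply (f : C_c(G, A)) (g : C_c(G, E)) (t : G) :
    leftFun h α f g t = ∫ r, (φ (α.toFun t⁻¹ (f r))).1 (g (r⁻¹ * t)) ∂Measure.haar := rfl

theorem norm_leftKernel_le (f : C_c(G, A)) (g : C_c(G, E)) (r t : G) :
    ‖leftKernel h α f g (r, t)‖ ≤ ‖f r‖ * ‖g (r⁻¹ * t)‖ :=
  (h.norm_le (α.toFun t⁻¹ (f r)) (g (r⁻¹ * t))).trans_eq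
    (congrArg (· * _) (norm_action α.self t⁻¹ (f r)))

theorem isIndBounded_leftFun (f : C_c(G, A)) : IsIndBounded (toL2 G B E ∘ₗ leftFun h α f) := by
  intro K hK
  -- If g is supported in K, its image is supported in (supp f) K, and is bounded there by ‖f‖₁
  -- times the supremum of ‖g‖.
  obtain ⟨C, hC, hCb⟩ := isIndBounded_toL2 (G := G) (B := B) (E := E) _
    (f.hasCompactSupport.isCompact.mul hK)
  refine ⟨C * ∫ r, ‖f r‖ ∂Measure.haar,
    mul_nonneg hC (integral_nonneg fun _ => norm_nonneg _), fun g ε hε h1 h2 => ?_⟩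
  rw [mul_assoc]
  refine hCb _ _ (mul_nonneg (integral_nonneg fun _ => norm_nonneg _) hε) (fun t ht => ?_)
    fun t => ?_
  · refine integral_eq_zero_of_ae (.of_forall fun r => ?_)
    change leftKernel h α f g (r, t) = 0
    rw [← norm_le_zero_iff]
    refine (norm_leftKernel_le h f g r t).trans_eq ?_
    by_cases hr : r ∈ tsupport f
    · rw [h1, norm_zero, mul_zero]
      exact fun hK' => ht ⟨r, hr, r⁻¹ * t, hK', by simp⟩
    · rw [image_eq_zero_of_notMem_tsupport hr, norm_zero, zero_mul]
  · refine (norm_kernelInt_le (leftKernel h α f g) ((integrable_cc f).norm.mul_const ε) t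
      fun r => (norm_leftKernel_le h f g r t).trans ?_).trans_eq (integral_mul_const _ _)
    gcongr
    exact h2 _

/-- The amplification `T ↦ T ⊗ 1` of operators on `L²(G, A)` to `L²(G, E)`. -/
noncomputable abbrev amplify (T : adjointableEnd A (L2 G A A)) : adjointable B (L2 G B E) (L2 G B E) :=
  IsTensorModel.map (isTensorModel_l2Tensor h) (isTensorModel_l2Tensor h)
    (T : adjointable A (L2 G A A) (L2 G A A))

/-- The operator λ_f ⊗ 1 is known on simple tensors, and these include the functions χ · φ(a)e.
Since φ is nondegenerate, inductive limit approximation extends the formula to all of C_c(G, E). -/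
theorem amplify_laurentEnd (f : C_c(G, A)) (g : C_c(G, E)) :
    (amplify h (laurentEnd α f)).1 (toL2 G B E g) = toL2 G B E (leftFun h α f g) := by
  have key := (isIndBounded_toL2.clm_comp (amplify h (laurentEnd α f)).1).eq_of_ccSmul
    (isIndBounded_leftFun (α := α) h f) h.dense (by
      rintro χ _ ⟨a, e, rfl⟩
      change (amplify h (laurentEnd α f)).1 (toL2 G B E (ccSmul χ (actionBilin φ a e))) =
        toL2 G B E (leftFun h α f (ccSmul χ (actionBilin φ a e)))
      rw [← ccTensor_ccSmul h, ← l2Tensor_toL2]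
      refine (IsTensorModel.map_apply (isTensorModel_l2Tensor h) (isTensorModel_l2Tensor h)
        (laurentEnd α f : adjointable A (L2 G A A) (L2 G A A)) _ _).trans ?_
      refine (congrArg (fun z => l2Tensor h z e) (laurentEnd_toL2 α f (ccSmul χ a))).trans ?_
      rw [l2Tensor_toL2]
      congr 1
      ext t
      rw [ccTensor_apply, leftFun_apply, laurentFun_apply]
      refine ((h.toCLM.flip e).integral_comp_comm
        (integrable_kernel (laurentKernel α.self f (ccSmul χ a)) t)).symm.trans
        (integral_congr_ae (.of_forall fun r => ?_))
      change (φ (α.toFun t⁻¹ (f r) * ccSmul χ a (r⁻¹ * t))).1 e =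
        (φ (α.toFun t⁻¹ (f r))).1 ((φ (ccSmul χ a (r⁻¹ * t))).1 e)
      rw [map_mul]; rfl)
  exact congrArg (fun P => P g) key

/-! ### Amplified kets -/

/-- The integrand `t ↦ Δ(t)^(-1/2) τ(δ_t⁻¹(d), g(t))`. -/
noncomputable def ketTensorIntegrand (hτ : IsTensorModel φ τ) (δ : ModuleAction α D) (d : D)
    (g : C_c(G, E)) : C_c(G, M) where
  toFun t := modular t ^ (-(1 / 2) : ℝ) • τ (δ.toFun t⁻¹ d) (g t)
  continuous_toFun := (continuous_modular_rpow _).smul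
    (hτ.continuous (Continuous.action δ continuous_inv continuous_const) g.continuous)
  hasCompactSupport' := g.hasCompactSupport.mono fun t ht h0 => ht (by
    simp only [h0, map_zero, smul_zero])

/-- The map `g ↦ ∫ Δ(t)^(-1/2) τ(δ_t⁻¹(d), g(t)) dt`. -/
noncomputable def ketTensorFun (hτ : IsTensorModel φ τ) (δ : ModuleAction α D) (d : D) :
    C_c(G, E) →ₗ[ℂ] M where
  toFun g := ∫ t, ketTensorIntegrand hτ δ d g t ∂Measure.haar
  map_add' f g := by
    rw [← integral_add (integrable_cc _) (integrable_cc _)]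
    refine integral_congr_ae (.of_forall fun t => ?_)
    change modular t ^ (-(1 / 2) : ℝ) • τ (δ.toFun t⁻¹ d) (f t + g t) =
      modular t ^ (-(1 / 2) : ℝ) • τ (δ.toFun t⁻¹ d) (f t) +
        modular t ^ (-(1 / 2) : ℝ) • τ (δ.toFun t⁻¹ d) (g t)
    rw [map_add, smul_add]
  map_smul' c f := by
    rw [RingHom.id_apply, ← integral_smul]
    refine integral_congr_ae (.of_forall fun t => ?_)
    change modular t ^ (-(1 / 2) : ℝ) • τ (δ.toFun t⁻¹ d) (c • f t) =
      c • modular t ^ (-(1 / 2) : ℝ) • τ (δ.toFun t⁻¹ d) (f t)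
    rw [map_smul, smul_comm]

theorem isIndBounded_ketTensorFun (hτ : IsTensorModel φ τ) (δ : ModuleAction α D) (d : D) :
    IsIndBounded (ketTensorFun hτ δ d) := by
  intro K hK
  obtain ⟨C, hC⟩ := hK.exists_bound_of_continuousOn
    (continuous_modular_rpow (G := G) (-(1 / 2))).continuousOn
  refine ⟨|C| * ‖d‖ * Measure.haar.real K, by positivity, fun g ε hε h1 h2 => ?_⟩
  refine (norm_integral_le_integral_norm _).trans
    ((integral_norm_le hK (ε := |C| * ‖d‖ * ε) (fun t ht => ?_) fun t => ?_).trans_eq (by ring))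
  · change modular t ^ (-(1 / 2) : ℝ) • τ (δ.toFun t⁻¹ d) (g t) = 0
    rw [h1 t ht, map_zero, smul_zero]
  · change ‖modular t ^ (-(1 / 2) : ℝ) • τ (δ.toFun t⁻¹ d) (g t)‖ ≤ _
    by_cases ht : t ∈ K
    · rw [norm_smul, mul_assoc]
      refine mul_le_mul ((hC t ht).trans (le_abs_self C)) ?_ (norm_nonneg _) (abs_nonneg _)
      refine (hτ.norm_le _ _).trans ?_
      rw [norm_action]
      gcongr
      exact h2 t
    · rw [h1 t ht, map_zero, smul_zero, norm_zero]
      positivity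

/-- The argument of `amplify_laurentEnd`, now for |d⟫ ⊗ 1: both sides are continuous for inductive
limit convergence and agree on the functions χ · φ(a)e. -/
theorem map_isKet (hτ : IsTensorModel φ τ) {δ : ModuleAction α D} {d : D}
    {T : adjointable A (L2 G A A) D} (hT : IsKet δ d T.1) (g : C_c(G, E)) :
    (IsTensorModel.map (isTensorModel_l2Tensor h) hτ T).1 (toL2 G B E g) = ketTensorFun hτ δ d g := by
  have hM : CompleteSpace M := HilbertModule.toCompleteSpace B
  have hD : CompleteSpace D := HilbertModule.toCompleteSpace A
  have key := (isIndBounded_toL2.clm_comp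
    (IsTensorModel.map (isTensorModel_l2Tensor h) hτ T).1).eq_of_ccSmul
    (isIndBounded_ketTensorFun hτ δ d) h.dense (by
      rintro χ _ ⟨a, e, rfl⟩
      change (IsTensorModel.map (isTensorModel_l2Tensor h) hτ T).1
        (toL2 G B E (ccSmul χ (actionBilin φ a e))) =
        ketTensorFun hτ δ d (ccSmul χ (actionBilin φ a e))
      rw [← ccTensor_ccSmul h, ← l2Tensor_toL2, IsTensorModel.map_apply, (isKet_iff δ).1 hT]
      refine ((hτ.toCLM.flip e).integral_comp_comm
        (integrable_cc (ketIntegrand δ d (ccSmul χ a)))).symm.trans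
        (integral_congr_ae (.of_forall fun t => ?_))
      change τ (modular t ^ (-(1 / 2) : ℝ) • ract (δ.toFun t⁻¹ d) (ccSmul χ a t)) e =
        modular t ^ (-(1 / 2) : ℝ) • τ (δ.toFun t⁻¹ d) ((φ (ccSmul χ a t)).1 e)
      rw [← Complex.coe_smul, LinearMap.map_smul₂, hτ.ract_left, Complex.coe_smul])
  exact congrArg (fun P => P g) key

/-- If `τ` is equivariant, then `(|d⟫ ⊗ 1) M_e = |τ(d, e)⟫`. -/
theorem isKet_map_creationOp (hτ : IsTensorModel φ τ) {δ : ModuleAction α D}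
    {γ : ModuleAction β E} {μ : ModuleAction β M}
    (heq : ∀ t d e, μ.toFun t (τ d e) = τ (δ.toFun t d) (γ.toFun t e)) {d : D}
    {T : adjointable A (L2 G A A) D} (hT : IsKet δ d T.1) (e : E) :
    IsKet μ (τ d e) (compA B (IsTensorModel.map (isTensorModel_l2Tensor h) hτ T)
      (creationOp γ e)).1 := fun f => by
  change (IsTensorModel.map (isTensorModel_l2Tensor h) hτ T).1
    ((creationOp γ e).1 (toL2 G B B f)) = _
  rw [creationOp_toL2, map_isKet h hτ hT]
  refine integral_congr_ae (.of_forall fun t => ?_)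
  change modular t ^ (-(1 / 2) : ℝ) • τ (δ.toFun t⁻¹ d) (ract (γ.toFun t⁻¹ e) (f t)) =
    modular t ^ (-(1 / 2) : ℝ) • ract (μ.toFun t⁻¹ (τ d e)) (f t)
  rw [hτ.ract_right, heq]

end Amplification

/-! ### Composition on the right and moving adjoints across -/

section CompR

variable {B H K M : Type*} [NonUnitalCStarAlgebra B] [NormedAddCommGroup H] [NormedSpace ℂ H]
  [HilbertModule B H] [NormedAddCommGroup K] [NormedSpace ℂ K] [HilbertModule B K]
  [NormedAddCommGroup M] [NormedSpace ℂ M] [HilbertModule B M]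

/-- Composition with a fixed operator on the right, as a bounded linear map. -/
noncomputable def compR (S : adjointable B H K) : adjointable B K M →L[ℂ] adjointable B H M :=
  LinearMap.mkContinuous ⟨⟨fun T => compA B T S, fun _ _ =>
    Subtype.ext (ContinuousLinearMap.add_comp _ _ _)⟩, fun _ _ =>
    Subtype.ext (ContinuousLinearMap.smul_comp _ _ _)⟩ ‖S‖
    fun _ => (ContinuousLinearMap.opNorm_comp_le _ _).trans_eq (mul_comm _ _)

theorem compR_apply (S : adjointable B H K) (T : adjointable B K M) :
    compR S T = compA B T S := rfl

theorem starMul_compA_left (T : adjointable B K M) (S : adjointable B H K) (S' : adjointable B H M) :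
    starMul (compA B T S) S' = starMul S (compA B (adj B T) S') :=
  end_ext fun x y => by
    rw [starMul_apply, starMul_apply]
    exact ip_adj T _ _

end CompR

section LeftAction

variable {G : Type*} [Group G] [TopologicalSpace G] [IsTopologicalGroup G]
  [LocallyCompactSpace G] [T2Space G] [MeasurableSpace G] [BorelSpace G]
  {A B E : Type*} [NonUnitalCStarAlgebra A] [NonUnitalCStarAlgebra B]
  [NormedAddCommGroup E] [NormedSpace ℂ E] [HilbertModule B E]
  {φ : A →⋆ₙₐ[ℂ] adjointableEnd B E} {α : CStarAction G A} {β : CStarAction G B}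

/-! ### The left action on `E ⋊_r G` -/

variable (h : IsTensorModel φ (actionBilin φ)) (γ : ModuleAction β E)

/-- The kernel `(s, t) ↦ φ(f(s)) γ_s(x(s⁻¹ t))`. -/
noncomputable def inducedKernel (f : C_c(G, A)) (x : C_c(G, E)) : C_c(G × G, E) where
  toFun z := (φ (f z.1)).1 (γ.toFun z.1 (x (z.1⁻¹ * z.2)))
  continuous_toFun := h.continuous (by fun_prop : Continuous fun z : G × G => f z.1)
    (Continuous.action γ (by fun_prop) (by fun_prop))
  hasCompactSupport' := HasCompactSupport.kernel
    (f := fun s t => (φ (f s)).1 (γ.toFun s (x (s⁻¹ * t))))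
    f.hasCompactSupport x.hasCompactSupport fun r t h =>
      ⟨subset_tsupport _ fun h0 => h (by rw [h0, map_zero]; rfl),
        subset_tsupport _ fun h0 => h (by rw [h0, map_zero, map_zero])⟩

/-- The action `(f x)(t) = ∫ φ(f(s)) γ_s(x(s⁻¹ t)) ds` of `C_c(G, A)` on `C_c(G, E)`. -/
noncomputable def inducedSymbol (f : C_c(G, A)) (x : C_c(G, E)) : C_c(G, E) :=
  kernelInt (inducedKernel h γ f x)

theorem inducedSymbol_apply (f : C_c(G, A)) (x : C_c(G, E)) (t : G) : inducedSymbol h γ f x t =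
    ∫ s, (φ (f s)).1 (γ.toFun s (x (s⁻¹ * t))) ∂Measure.haar := rfl

variable {γ}

/-- An associativity of convolutions, f(x g) = (f x) g, proved by Fubini, a left translation and the
equivariance of φ. -/
theorem leftFun_laurentFun (hφ : ∀ t a, φ (α.toFun t a) = adHom γ t (φ a)) (f : C_c(G, A))
    (x : C_c(G, E)) (g : C_c(G, B)) :
    leftFun h α f (laurentFun γ x g) = laurentFun γ (inducedSymbol h γ f x) g := by
  have : CompleteSpace E := HilbertModule.toCompleteSpace B
  ext t
  let K : C_c(G × G, E) :=
    { toFun := fun z => ract (γ.toFun t⁻¹ (inducedKernel h γ f x z)) (g (z.2⁻¹ * t))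
      continuous_toFun := (Continuous.action γ continuous_const (by fun_prop)).ract (by fun_prop)
      hasCompactSupport' := (inducedKernel h γ f x).hasCompactSupport.mono fun z hz h0 =>
        hz (by simp only [h0, map_zero, zero_ract]) }
  have h1 : laurentFun γ (inducedSymbol h γ f x) g t =
      ∫ s, ∫ r, K (r, s) ∂Measure.haar ∂Measure.haar := by
    refine integral_congr_ae (.of_forall fun s => ?_)
    change ract (γ.toFun t⁻¹ (∫ r, inducedKernel h γ f x (r, s) ∂Measure.haar)) (g (s⁻¹ * t)) = _
    have hi := integrable_kernel (inducedKernel h γ f x) s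
    rw [action_integral γ _ hi]
    exact integral_ract ((actionL γ t⁻¹).integrable_comp hi) _
  rw [h1, integral_kernel_swap]
  refine integral_congr_ae (.of_forall fun r => ?_)
  change (φ (α.toFun t⁻¹ (f r))).1
    (∫ s, laurentKernel γ x g (s, r⁻¹ * t) ∂Measure.haar) = ∫ s, K (r, s) ∂Measure.haar
  -- After moving φ under the integral, s is replaced by r⁻¹ s, so that g is evaluated at s⁻¹ t on
  -- both sides.
  rw [← ContinuousLinearMap.integral_comp_comm _ (integrable_kernel (laurentKernel γ x g) _),
    ← integral_mul_left_eq_self _ r⁻¹]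
  refine integral_congr_ae (.of_forall fun s => ?_)
  change (φ (α.toFun t⁻¹ (f r))).1
      (ract (γ.toFun (r⁻¹ * t)⁻¹ (x (r⁻¹ * s))) (g ((r⁻¹ * s)⁻¹ * (r⁻¹ * t)))) =
    ract (γ.toFun t⁻¹ ((φ (f r)).1 (γ.toFun r (x (r⁻¹ * s))))) (g (s⁻¹ * t))
  rw [map_ract ⟨_, (φ (α.toFun t⁻¹ (f r))).2⟩, hφ]
  have h2 : (r⁻¹ * s)⁻¹ * (r⁻¹ * t) = s⁻¹ * t := by group
  rw [h2]
  congr 1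
  change γ.toFun t⁻¹ ((φ (f r)).1 (γ.toFun t⁻¹⁻¹ (γ.toFun (r⁻¹ * t)⁻¹ (x (r⁻¹ * s))))) = _
  rw [← γ.map_mul t⁻¹⁻¹]
  congr 4
  group

/-- This identifies composition with T ⊗ 1 as the left action of A ⋊_r G prescribed on symbols. -/
theorem amplify_laurentEnd_laurentOp (hφ : ∀ t a, φ (α.toFun t a) = adHom γ t (φ a))
    (f : C_c(G, A)) (x : C_c(G, E)) :
    compA B (amplify h (laurentEnd α f)) (laurentOp γ x) = laurentOp γ (inducedSymbol h γ f x) :=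
  Subtype.ext <| clm_ext_L2 fun g => by
    change (amplify h (laurentEnd α f)).1 ((laurentOp γ x).1 (toL2 G B B g)) = _
    rw [laurentOp_toL2, laurentOp_toL2, amplify_laurentEnd, leftFun_laurentFun h hφ]

theorem amplify_mul (S T : adjointableEnd A (L2 G A A)) :
    amplify h (S * T) = compA B (amplify h S) (amplify h T) :=
  IsTensorModel.map_comp _ _ _ (S : adjointable A (L2 G A A) (L2 G A A))
    (T : adjointable A (L2 G A A) (L2 G A A))

theorem amplify_star (T : adjointableEnd A (L2 G A A)) :
    amplify h (star T) = adj B (amplify h T) :=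
  IsTensorModel.map_adj _ _ (T : adjointable A (L2 G A A) (L2 G A A))

theorem amplify_add (S T : adjointableEnd A (L2 G A A)) :
    amplify h (S + T) = amplify h S + amplify h T :=
  IsTensorModel.map_add _ _ (S : adjointable A (L2 G A A) (L2 G A A))
    (T : adjointable A (L2 G A A) (L2 G A A))

theorem amplify_smul (c : ℂ) (T : adjointableEnd A (L2 G A A)) :
    amplify h (c • T) = c • amplify h T :=
  IsTensorModel.map_smul _ _ c (T : adjointable A (L2 G A A) (L2 G A A))

/-- The T for which T ⊗ 1 preserves E ⋊_r G form a closed subalgebra, so Laurent operators suffice.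
Their amplifications send Laurent operators to Laurent operators and commute with right
multiplication by B ⋊_r G. -/
theorem compA_amplify_mem (hφ : ∀ t a, φ (α.toFun t a) = adHom γ t (φ a))
    {T : adjointableEnd A (L2 G A A)} (hT : T ∈ crossedAlg α)
    {X : adjointable B (L2 G B B) (L2 G B E)} (hX : X ∈ crossedSpan γ) :
    compA B (amplify h T) X ∈ crossedSpan γ := by
  let P : NonUnitalSubalgebra ℂ (adjointableEnd A (L2 G A A)) :=
    { carrier := {T | ∀ X ∈ crossedSpan γ, compA B (amplify h T) X ∈ crossedSpan γ}
      add_mem' := fun {S T} hS hT X hX => by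
        rw [amplify_add, ← compR_apply, map_add]
        exact add_mem (hS X hX) (hT X hX)
      zero_mem' := fun X hX => by
        have : amplify h (0 : adjointableEnd A (L2 G A A)) = 0 := by
          rw [← zero_smul ℂ (0 : adjointableEnd A (L2 G A A)), amplify_smul, zero_smul]
        rw [this, ← compR_apply, map_zero]
        exact zero_mem _
      mul_mem' := fun {S T} hS hT X hX => by
        rw [amplify_mul]
        exact hS _ (hT X hX)
      smul_mem' := fun c T hT X hX => by
        rw [amplify_smul, ← compR_apply, map_smul]
        exact Submodule.smul_mem _ c (hT X hX) }
  have hcl : IsClosed (crossedSpan γ : Set (adjointable B (L2 G B B) (L2 G B E))) :=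
    Submodule.isClosed_topologicalClosure _
  refine crossedAlg_le α P ?_ (fun f X hX => ?_) hT X hX
  · have : (P : Set (adjointableEnd A (L2 G A A))) = ⋂ X ∈ crossedSpan γ,
        (fun T : adjointableEnd A (L2 G A A) => compA B (amplify h T) X) ⁻¹' crossedSpan γ := by
      ext T
      simp only [Set.mem_iInter]
      rfl
    rw [this]
    refine isClosed_biInter fun X _ => hcl.preimage ?_
    exact (compR (M := L2 G B E) X).continuous.comp
      (IsTensorModel.mapL (isTensorModel_l2Tensor h) (isTensorModel_l2Tensor h)).continuous
  · let N : Submodule ℂ (adjointable B (L2 G B B) (L2 G B E)) :=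
      (crossedSpan γ).comap (compL (amplify h (laurentEnd α f))).toLinearMap
    have hN : IsClosed (N : Set (adjointable B (L2 G B B) (L2 G B E))) :=
      hcl.preimage (compL (amplify h (laurentEnd α f))).continuous
    refine Submodule.topologicalClosure_minimal (t := N) _ (Submodule.span_le.2 ?_) hN hX
    rintro _ ⟨T, ⟨x, hx⟩, c, hc, rfl⟩
    change compA B (amplify h (laurentEnd α f)) (mulEnd T c) ∈ crossedSpan γ
    rw [← mulEnd_compA, IsLaurent.eq γ hx, amplify_laurentEnd_laurentOp h hφ]
    exact mulEnd_mem (laurentOp_mem γ _) hc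

variable (hφ : ∀ t a, φ (α.toFun t a) = adHom γ t (φ a)) (hX : HasCrossedModule γ)

/-- The operator `X ↦ (T ⊗ 1) X` on `E ⋊_r G`. -/
noncomputable def inducedOp (T : CrossedProduct α) : CrossedModule hX →L[ℂ] CrossedModule hX :=
  ((compL (amplify h T.op) :
    adjointable B (L2 G B B) (L2 G B E) →L[ℂ] adjointable B (L2 G B B) (L2 G B E)).comp
      (crossedSpan γ).subtypeL).codRestrict (crossedSpan γ)
        fun X => compA_amplify_mem h hφ T.2 X.2

theorem CrossedModule.ext {X Y : CrossedModule hX} (h : X.op = Y.op) : X = Y := Subtype.ext h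

/-- Inner products in E ⋊_r G are operator products, so this is just (T ⊗ 1)⋆ = T⋆ ⊗ 1. -/
theorem isAdjoint_inducedOp (T : CrossedProduct α) :
    IsAdjoint (CrossedProduct β) (inducedOp h hφ hX T) (inducedOp h hφ hX (star T)) := fun X Y => by
  refine Subtype.ext ?_
  change starMul (compA B (amplify h T.op) X.op) Y.op =
    starMul X.op (compA B (amplify h (star T.op)) Y.op)
  rw [starMul_compA_left, amplify_star]

/-- The left action of `A ⋊_r G` on `E ⋊_r G`. -/
noncomputable def induced :
    CrossedProduct α →⋆ₙₐ[ℂ] adjointableEnd (CrossedProduct β) (CrossedModule hX) where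
  toFun T := ⟨inducedOp h hφ hX T, _, isAdjoint_inducedOp h hφ hX T⟩
  map_smul' c T := Subtype.ext <| ContinuousLinearMap.ext fun X => CrossedModule.ext hX <| by
    change compA B (amplify h (c • T.op)) X.op = c • compA B (amplify h T.op) X.op
    rw [amplify_smul, ← compR_apply, map_smul, compR_apply]
  map_zero' := Subtype.ext <| ContinuousLinearMap.ext fun X => CrossedModule.ext hX <| by
    change compA B (amplify h 0) X.op = 0
    rw [← zero_smul ℂ (0 : adjointableEnd A (L2 G A A)), amplify_smul, zero_smul, ← compR_apply,
      map_zero]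
  map_add' S T := Subtype.ext <| ContinuousLinearMap.ext fun X => CrossedModule.ext hX <| by
    change compA B (amplify h (S.op + T.op)) X.op =
      compA B (amplify h S.op) X.op + compA B (amplify h T.op) X.op
    rw [amplify_add, ← compR_apply, map_add, compR_apply, compR_apply]
  map_mul' S T := Subtype.ext <| ContinuousLinearMap.ext fun X => CrossedModule.ext hX <| by
    change compA B (amplify h (S.op * T.op)) X.op =
      compA B (amplify h S.op) (compA B (amplify h T.op) X.op)
    rw [amplify_mul]
    rfl
  map_star' T := (adj_eq (CrossedProduct β) (T := (⟨inducedOp h hφ hX T, _,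
    isAdjoint_inducedOp h hφ hX T⟩ : adjointable (CrossedProduct β) _ _)) (S :=
      ⟨inducedOp h hφ hX (star T), _, isAdjoint_inducedOp h hφ hX (star T)⟩)
    (isAdjoint_inducedOp h hφ hX T)).symm

theorem isInduced_induced : IsInduced γ α φ hX (induced h hφ hX) := fun f x => by
  refine ⟨(⟨laurentEnd α f, laurentEnd_mem α f⟩ : crossedAlg α),
    (⟨laurentOp γ x, laurentOp_mem γ x⟩ : crossedSpan γ),
    (⟨laurentOp γ (inducedSymbol h γ f x), laurentOp_mem γ _⟩ : crossedSpan γ),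
    inducedSymbol h γ f x, isLaurent_laurentOp α.self f, isLaurent_laurentOp γ x,
    isLaurent_laurentOp γ _, inducedSymbol_apply h γ f x, ?_⟩
  exact CrossedModule.ext hX (amplify_laurentEnd_laurentOp h hφ f x)

end LeftAction

section RelativelyL1

variable {G : Type*} [Group G] [TopologicalSpace G] [IsTopologicalGroup G]
  [LocallyCompactSpace G] [T2Space G] [MeasurableSpace G] [BorelSpace G]
  {B M : Type*} [NonUnitalCStarAlgebra B]
  [NormedAddCommGroup M] [NormedSpace ℂ M] [HilbertModule B M]

/-! ### Spans of relatively `L¹` sets -/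

theorem MemL1Δ.add {k k' : G → B} (hk : MemL1Δ k) (hk' : MemL1Δ k') :
    MemL1Δ fun s => k s + k' s := by
  refine ⟨hk.1.add hk'.1, (hk.2.1.add hk'.2.1).congr (.of_forall fun s => ?_),
    (hk.2.2.add hk'.2.2).congr (.of_forall fun s => ?_)⟩
  · exact (smul_add _ _ _).symm
  · exact (smul_add _ _ _).symm

theorem MemL1Δ.const_smul {k : G → B} (hk : MemL1Δ k) (c : ℂ) : MemL1Δ fun s => c • k s := by
  refine ⟨hk.1.smul c, (hk.2.1.smul c).congr (.of_forall fun s => ?_),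
    (hk.2.2.smul c).congr (.of_forall fun s => ?_)⟩
  · exact smul_comm _ _ _
  · exact smul_comm _ _ _

theorem memL1Δ_zero : MemL1Δ fun _ : G => (0 : B) := by
  refine ⟨integrable_zero _ _ _, ?_, ?_⟩ <;> simp

/-- The pointwise estimate survives multiplication by powers of Δ. Measurability is supplied by
continuity together with the domination. -/
theorem MemL1Δ.of_norm_le {A : Type*} [NonUnitalCStarAlgebra A] {k : G → A} (hk : MemL1Δ k)
    {k' : G → B} (hk' : Continuous k') {C : ℝ} (h : ∀ s, ‖k' s‖ ≤ C * ‖k s‖) : MemL1Δ k' := by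
  have key : ∀ r : ℝ, ∀ s : G, ‖modular s ^ r • k' s‖ ≤ C * ‖modular s ^ r • k s‖ := fun r s => by
    rw [norm_smul, norm_smul, mul_left_comm]
    exact mul_le_mul_of_nonneg_left (h s) (norm_nonneg _)
  exact ⟨integrable_of_continuous_of_norm_le hk.1 hk' h,
    integrable_of_continuous_of_norm_le hk.2.1 ((continuous_modular_rpow _).smul hk') (key _),
    integrable_of_continuous_of_norm_le hk.2.2 ((continuous_modular_rpow _).smul hk') (key _)⟩

theorem ketSymbol_add_left {β : CStarAction G B} (μ : ModuleAction β M) (x y z : M) (s : G) :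
    ketSymbol μ (x + y) z s = ketSymbol μ x z s + ketSymbol μ y z s := by
  rw [ketSymbol, ip_add_left, smul_add]; rfl

theorem ketSymbol_smul_left {β : CStarAction G B} (μ : ModuleAction β M) (c : ℂ) (x z : M) (s : G) :
    ketSymbol μ (c • x) z s = star c • ketSymbol μ x z s := by
  rw [ketSymbol, ip_smul_left, smul_comm]; rfl

theorem ketSymbol_zero_left {β : CStarAction G B} (μ : ModuleAction β M) (z : M) (s : G) :
    ketSymbol μ 0 z s = 0 := by
  rw [ketSymbol, ip_zero_left, smul_zero]

theorem ketSymbol_add_right {β : CStarAction G B} (μ : ModuleAction β M) (x y z : M) (s : G) :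
    ketSymbol μ x (y + z) s = ketSymbol μ x y s + ketSymbol μ x z s := by
  rw [ketSymbol, map_add, ip_add_right, smul_add]; rfl

theorem ketSymbol_smul_right {β : CStarAction G B} (μ : ModuleAction β M) (c : ℂ) (x z : M) (s : G) :
    ketSymbol μ x (c • z) s = c • ketSymbol μ x z s := by
  rw [ketSymbol, map_smul, ip_smul_right, smul_comm]; rfl

theorem ketSymbol_zero_right {β : CStarAction G B} (μ : ModuleAction β M) (z : M) (s : G) :
    ketSymbol μ z 0 s = 0 := by
  rw [ketSymbol, map_zero, ip_zero_right, smul_zero]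

theorem RelativelyL1.span {β : CStarAction G B} {μ : ModuleAction β M} {S : Set M}
    (h : RelativelyL1 μ S) : RelativelyL1 μ (Submodule.span ℂ S : Set M) := by
  intro ξ hξ η hη
  change MemL1Δ (fun s => ketSymbol μ ξ η s)
  induction hξ using Submodule.span_induction with
  | zero => simp only [ketSymbol_zero_left]; exact memL1Δ_zero
  | add x y _ _ hx hy => simp only [ketSymbol_add_left]; exact hx.add hy
  | smul c x _ hx => simp only [ketSymbol_smul_left]; exact hx.const_smul _
  | mem x hx =>
    induction hη using Submodule.span_induction with
    | zero => simp only [ketSymbol_zero_right]; exact memL1Δ_zero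
    | add y z _ _ hy hz => simp only [ketSymbol_add_right]; exact hy.add hz
    | smul c y _ hy => simp only [ketSymbol_smul_right]; exact hy.const_smul _
    | mem y hy => exact h x hx y hy

/-- Together with `IsKet.smul` and `isKet_zero`, this carries kets from simple tensors to their span
in `dense_span_tensorF`. -/
theorem IsKet.add {β : CStarAction G B} {μ : ModuleAction β M} {ξ η : M}
    {S T : adjointable B (L2 G B B) M} (hS : IsKet μ ξ S.1) (hT : IsKet μ η T.1) :
    IsKet μ (ξ + η) (S + T).1 := fun f => by
  change S.1 _ + T.1 _ = _
  rw [hS f, hT f]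
  refine (integral_add (integrable_cc (ketIntegrand μ ξ f))
    (integrable_cc (ketIntegrand μ η f))).symm.trans (integral_congr_ae (.of_forall fun t => ?_))
  change modular t ^ (-(1 / 2) : ℝ) • ract (μ.toFun t⁻¹ ξ) (f t) +
    modular t ^ (-(1 / 2) : ℝ) • ract (μ.toFun t⁻¹ η) (f t) =
    modular t ^ (-(1 / 2) : ℝ) • ract (μ.toFun t⁻¹ (ξ + η)) (f t)
  rw [map_add, add_ract, smul_add]

theorem IsKet.smul {β : CStarAction G B} {μ : ModuleAction β M} {ξ : M}
    {T : adjointable B (L2 G B B) M} (hT : IsKet μ ξ T.1) (c : ℂ) :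
    IsKet μ (c • ξ) (c • T).1 := fun f => by
  change c • T.1 _ = _
  rw [hT f, ← integral_smul]
  refine integral_congr_ae (.of_forall fun t => ?_)
  change c • modular t ^ (-(1 / 2) : ℝ) • ract (μ.toFun t⁻¹ ξ) (f t) =
    modular t ^ (-(1 / 2) : ℝ) • ract (μ.toFun t⁻¹ (c • ξ)) (f t)
  rw [map_smul, smul_ract, smul_comm]

theorem isKet_zero {β : CStarAction G B} (μ : ModuleAction β M) :
    IsKet μ 0 (0 : adjointable B (L2 G B B) M).1 := fun f => by
  change 0 = _
  simp only [map_zero, zero_ract, smul_zero, integral_zero]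

end RelativelyL1

section Induction

variable {G : Type*} [Group G] [TopologicalSpace G] [IsTopologicalGroup G]
  [LocallyCompactSpace G] [T2Space G] [MeasurableSpace G] [BorelSpace G]
  {A D B E M : Type*} [NonUnitalCStarAlgebra A] [NonUnitalCStarAlgebra B]
  [NormedAddCommGroup D] [NormedSpace ℂ D] [HilbertModule A D]
  [NormedAddCommGroup E] [NormedSpace ℂ E] [HilbertModule B E]
  [NormedAddCommGroup M] [NormedSpace ℂ M] [HilbertModule B M]
  {φ : A →⋆ₙₐ[ℂ] adjointableEnd B E} {τ : D →ₗ[ℂ] E →ₗ[ℂ] M}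
  {α : CStarAction G A} {β : CStarAction G B} {δ : ModuleAction α D} {γ : ModuleAction β E}
  {μ : ModuleAction β M}

/-! ### Induction of relatively `L¹` subspaces along interior tensor products -/

variable (τ) in
/-- The span of `τ(R × E)`. -/
def inducedSubspace (R : Submodule ℂ D) : Submodule ℂ M :=
  Submodule.span ℂ {z | ∃ d ∈ R, ∃ e, z = τ d e}

theorem dense_inducedSubspace (hτ : IsTensorModel φ τ) {R : Submodule ℂ D}
    (hR : Dense (R : Set D)) : Dense (inducedSubspace τ R : Set M) := by
  intro z
  have hle : Submodule.span ℂ {z | ∃ d e, z = τ d e} ≤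
      (inducedSubspace τ R).topologicalClosure := by
    refine Submodule.span_le.2 ?_
    rintro _ ⟨d, e, rfl⟩
    have hcl : IsClosed {d | τ d e ∈ (inducedSubspace τ R).topologicalClosure} :=
      (Submodule.isClosed_topologicalClosure _).preimage
        (hτ.continuous continuous_id continuous_const)
    have hsub : (R : Set D) ⊆ {d | τ d e ∈ (inducedSubspace τ R).topologicalClosure} :=
      fun d hd => subset_closure (Submodule.subset_span ⟨d, hd, e, rfl⟩)
    exact closure_minimal hsub hcl (hR d)
  exact closure_minimal hle (Submodule.isClosed_topologicalClosure _) (hτ.dense z)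

theorem ketSymbol_tensor (hτ : IsTensorModel φ τ)
    (heq : ∀ t d e, μ.toFun t (τ d e) = τ (δ.toFun t d) (γ.toFun t e)) (d d' : D) (e e' : E)
    (s : G) : ketSymbol μ (τ d e) (τ d' e') s =
      coefficientL φ e (γ.toFun s e') (ketSymbol δ d d' s) := by
  rw [ketSymbol, ketSymbol, heq, hτ.ip_eq, ← coefficientL_apply, ← Complex.coe_smul,
    ← Complex.coe_smul, map_smul]

/-- On simple tensors the symbol is s ↦ ⟨e, φ(k(s)) γ_s(e')⟩ with k the symbol of (d, d'). Its norm
is at most ‖e‖ ‖e'‖ ‖k(s)‖, as φ is contractive and γ_s isometric. -/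
theorem relativelyL1_inducedSubspace (hτ : IsTensorModel φ τ)
    (heq : ∀ t d e, μ.toFun t (τ d e) = τ (δ.toFun t d) (γ.toFun t e)) {R : Submodule ℂ D}
    (hR : RelativelyL1 δ (R : Set D)) : RelativelyL1 μ (inducedSubspace τ R : Set M) := by
  refine RelativelyL1.span ?_
  rintro _ ⟨d, hd, e, rfl⟩ _ ⟨d', hd', e', rfl⟩
  refine (hR d hd d' hd').of_norm_le (C := ‖e‖ * ‖e'‖) (continuous_ketSymbol μ _ _) fun s => ?_
  change ‖ketSymbol μ (τ d e) (τ d' e') s‖ ≤ _ * ‖ketSymbol δ d d' s‖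
  rw [ketSymbol_tensor hτ heq, ← norm_action γ s e']
  exact ContinuousLinearMap.le_of_opNorm_le _
    (LinearMap.mkContinuous_norm_le _ (by positivity) _) _

variable (h : IsTensorModel φ (actionBilin φ)) (hτ : IsTensorModel φ τ)
  (hφ : ∀ t a, φ (α.toFun t a) = adHom γ t (φ a))
  (heq : ∀ t d e, μ.toFun t (τ d e) = τ (δ.toFun t d) (γ.toFun t e))

/-- The amplification `T ↦ T ⊗ 1` of operators `L²(G, A) → D` to operators `L²(G, E) → M`. -/
noncomputable abbrev amplifyTo (T : adjointable A (L2 G A A) D) : adjointable B (L2 G B E) M :=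
  IsTensorModel.map (isTensorModel_l2Tensor h) hτ T

theorem amplifyTo_mulEnd (T : adjointable A (L2 G A A) D) (c : adjointableEnd A (L2 G A A)) :
    amplifyTo h hτ (mulEnd T c) = compA B (amplifyTo h hτ T) (amplify h c) :=
  IsTensorModel.map_comp _ _ _ T (c : adjointable A (L2 G A A) (L2 G A A))

theorem amplify_starMul (S T : adjointable A (L2 G A A) D) :
    amplify h (starMul S T) = compA B (adj B (amplifyTo h hτ S)) (amplifyTo h hτ T) := by
  refine (IsTensorModel.map_comp (isTensorModel_l2Tensor h) hτ (isTensorModel_l2Tensor h)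
    (adj A S) T).trans ?_
  rw [IsTensorModel.map_adj]

/-- The operators in `F(R)`. -/
noncomputable abbrev ketSpan (δ : ModuleAction α D) (R : Set D) :
    Submodule ℂ (adjointable A (L2 G A A) D) := spanSubmodule (crossedAlg α) (kets δ R)

/-- By continuity S may be taken of the form |d⟫ c. The factor c ⊗ 1 is absorbed into X, and then X
may be taken of the form M_e c'. What remains is (|d⟫ ⊗ 1) M_e c' = |τ(d, e)⟫ c', a generator of the
target. -/
theorem compA_amplifyTo_mem (hφ : ∀ t a, φ (α.toFun t a) = adHom γ t (φ a))
    (heq : ∀ t d e, μ.toFun t (τ d e) = τ (δ.toFun t d) (γ.toFun t e)) {R : Submodule ℂ D}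
    {S : adjointable A (L2 G A A) D}
    (hS : S ∈ ketSpan δ (R : Set D)) {X : adjointable B (L2 G B B) (L2 G B E)}
    (hX : X ∈ crossedSpan γ) :
    compA B (amplifyTo h hτ S) X ∈ ketSpan μ (inducedSubspace τ R : Set M) := by
  have hcl : IsClosed (ketSpan μ (inducedSubspace τ R : Set M) :
      Set (adjointable B (L2 G B B) M)) := Submodule.isClosed_topologicalClosure _
  let L : adjointable A (L2 G A A) D →L[ℂ] adjointable B (L2 G B B) M :=
    (compR X).comp (IsTensorModel.mapL (isTensorModel_l2Tensor h) hτ)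
  refine Submodule.topologicalClosure_minimal
    (t := (ketSpan μ (inducedSubspace τ R : Set M)).comap L.toLinearMap) _
    (Submodule.span_le.2 ?_) (hcl.preimage L.continuous) hS
  rintro _ ⟨T, ⟨d, hd, hT⟩, c, hc, rfl⟩
  change compA B (amplifyTo h hτ (mulEnd T c)) X ∈ ketSpan μ (inducedSubspace τ R : Set M)
  rw [amplifyTo_mulEnd]
  refine crossedSpan_le γ
    (Q := (ketSpan μ (inducedSubspace τ R : Set M)).comap (compL (amplifyTo h hτ T)).toLinearMap)
    (hcl.preimage (compL (amplifyTo h hτ T)).continuous) (fun e c hc => ?_)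
    (compA_amplify_mem h hφ hc hX)
  exact subset_closure (Submodule.subset_span ⟨compA B (amplifyTo h hτ T) (creationOp γ e),
    ⟨τ d e, Submodule.subset_span ⟨d, hd, e, rfl⟩, isKet_map_creationOp h hτ heq hT e⟩,
    c, hc, rfl⟩)

variable {R : Submodule ℂ D} (hR : RelativelyContinuous δ (R : Set D))
  (hR' : RelativelyContinuous μ (inducedSubspace τ R : Set M)) (hX : HasCrossedModule γ)

/-- The operator underlying an element of `F(R)`. -/
noncomputable def opF {R : Set D} {hR : RelativelyContinuous δ R} (S : F hR) :
    adjointable A (L2 G A A) D := Generated.op S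

/-- The bilinear map `(S, X) ↦ (S ⊗ 1) X` from `F(R) × (E ⋊_r G)` to `F(span τ(R × E))`. -/
noncomputable def tensorF : F hR →ₗ[ℂ] CrossedModule hX →ₗ[ℂ] F hR' :=
  LinearMap.mk₂ ℂ (fun S X => (⟨compA B (amplifyTo h hτ (opF S)) X.op,
      compA_amplifyTo_mem h hτ hφ heq S.2 X.2⟩ : ketSpan μ (inducedSubspace τ R : Set M)))
    (fun S S' X => Subtype.ext <| by
      change compA B (amplifyTo h hτ (opF S + opF S')) X.op =
        compA B (amplifyTo h hτ (opF S)) X.op + compA B (amplifyTo h hτ (opF S')) X.op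
      rw [amplifyTo, IsTensorModel.map_add, ← compR_apply, map_add]; rfl)
    (fun c S X => Subtype.ext <| by
      change compA B (amplifyTo h hτ (c • opF S)) X.op =
        c • compA B (amplifyTo h hτ (opF S)) X.op
      rw [amplifyTo, IsTensorModel.map_smul, ← compR_apply, map_smul]; rfl)
    (fun S X X' => Subtype.ext ((compL (amplifyTo h hτ (opF S))).map_add X.op X'.op))
    (fun c S X => Subtype.ext ((compL (amplifyTo h hτ (opF S))).map_smul c X.op))

/-- Functoriality and compatibility with adjoints give X⋆(S⋆S' ⊗ 1)X', in which the middle factor is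
the left action of ⟨S, S'⟩. -/
theorem ip_tensorF (S : F hR) (X : CrossedModule hX) (S' : F hR) (X' : CrossedModule hX) :
    (ip (tensorF h hτ hφ heq hR hR' hX S X) (tensorF h hτ hφ heq hR hR' hX S' X') :
      CrossedProduct β) = ip X ((induced h hφ hX (ip S S')).1 X') := by
  refine Subtype.ext ?_
  change starMul (compA B (amplifyTo h hτ (opF S)) X.op) (compA B (amplifyTo h hτ (opF S')) X'.op) =
    starMul X.op (compA B (amplify h (starMul (opF S) (opF S'))) X'.op)
  rw [starMul_compA_left, amplify_starMul h hτ]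
  rfl

/-- The generator |τ(d, e)⟫ c is the image of the pair |d⟫ ∈ F(R) and M_e c ∈ E ⋊_r G; that |d⟫
itself belongs to F(R) is `mem_spanSubmodule`. -/
theorem dense_span_tensorF : Dense (Submodule.span ℂ
    {z | ∃ S X, z = tensorF h hτ hφ heq hR hR' hX S X} : Set (F hR')) := by
  set W := Submodule.span ℂ {z | ∃ S X, z = tensorF h hτ hφ heq hR hR' hX S X}
  let ι : F hR' →ₗ[ℂ] adjointable B (L2 G B B) M :=
    (ketSpan μ (inducedSubspace τ R : Set M)).subtype
  -- Elements of R' are linear combinations of simple tensors, so a ket with the required property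
  -- is built along the span. Uniqueness of kets then identifies it with any given one.
  have hex : ∀ ξ ∈ inducedSubspace τ R, ∃ T : adjointable B (L2 G B B) M, IsKet μ ξ T.1 ∧
      ∀ c ∈ crossedAlg β, mulEnd T c ∈ W.map ι := by
    intro ξ hξ
    induction hξ using Submodule.span_induction with
    | zero =>
      refine ⟨0, isKet_zero μ, fun c _ => ?_⟩
      have : mulEnd (0 : adjointable B (L2 G B B) M) c = 0 := (mulEndL (K := M) c).map_zero
      rw [this]
      exact zero_mem _
    | add x y _ _ hx hy =>
      obtain ⟨S, hS, hS'⟩ := hx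
      obtain ⟨T, hT, hT'⟩ := hy
      refine ⟨S + T, hS.add hT, fun c hc => ?_⟩
      have : mulEnd (S + T) c = mulEnd S c + mulEnd T c := (mulEndL (K := M) c).map_add S T
      rw [this]
      exact add_mem (hS' c hc) (hT' c hc)
    | smul z x _ hx =>
      obtain ⟨T, hT, hT'⟩ := hx
      refine ⟨z • T, hT.smul z, fun c hc => ?_⟩
      have : mulEnd (z • T) c = z • mulEnd T c := (mulEndL (K := M) c).map_smul z T
      rw [this]
      exact Submodule.smul_mem _ z (hT' c hc)
    | mem x hx =>
      obtain ⟨d, hd, e, rfl⟩ := hx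
      obtain ⟨T, hT⟩ := hR.squareIntegrable d hd
      refine ⟨_, isKet_map_creationOp h hτ heq hT e, fun c hc => ?_⟩
      exact ⟨tensorF h hτ hφ heq hR hR' hX
        (⟨T, mem_spanSubmodule _ hR.admissible ⟨d, hd, hT⟩⟩ : ketSpan δ (R : Set D))
        (⟨mulEnd (creationOp γ e) c, mulEnd_creationOp_mem γ e hc⟩ : crossedSpan γ),
        Submodule.subset_span ⟨_, _, rfl⟩, rfl⟩
  have hle : Submodule.span ℂ {Q | ∃ T ∈ kets μ (inducedSubspace τ R : Set M),
      ∃ c ∈ crossedAlg β, Q = mulEnd T c} ≤ W.map ι := by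
    refine Submodule.span_le.2 ?_
    rintro _ ⟨T, ⟨ξ, hξ, hT⟩, c, hc, rfl⟩
    obtain ⟨T', hT', h'⟩ := hex ξ hξ
    rw [IsKet.eq μ hT hT']
    exact h' c hc
  intro z
  refine Metric.mem_closure_iff.2 fun ε hε => ?_
  have hz : opF z ∈ ketSpan μ (inducedSubspace τ R : Set M) := z.2
  obtain ⟨Q, hQ, hQz⟩ := Metric.mem_closure_iff.1 hz ε hε
  obtain ⟨w, hw, rfl⟩ := hle hQ
  exact ⟨w, hw, hQz⟩

theorem isTensorModel_tensorF :
    IsTensorModel (induced h hφ hX) (tensorF h hτ hφ heq hR hR' hX) where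
  ip_eq := ip_tensorF h hτ hφ heq hR hR' hX
  dense := dense_span_tensorF h hτ hφ heq hR hR' hX

/-- A dense relatively `L¹` subspace `R` of `D` induces a dense relatively `L¹` subspace
`R' = span τ(R × E)` of `M = D ⊗_φ E`, and `F(R') ≅ F(R) ⊗ (E ⋊_r G)`. -/
theorem exists_unitaryEquiv_induced
    (hd : Dense (Submodule.span ℂ {x : E | ∃ (a : A) (ξ : E), x = (φ a).1 ξ} : Set E))
    (hφ : ∀ t a, φ (α.toFun t a) = adHom γ t (φ a)) (hτ : IsTensorModel φ τ)
    (heq : ∀ t d e, μ.toFun t (τ d e) = τ (δ.toFun t d) (γ.toFun t e)) {R : Submodule ℂ D}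
    (hR : Dense (R : Set D)) (hR1 : RelativelyL1 δ (R : Set D)) :
    Dense (inducedSubspace τ R : Set M) ∧ RelativelyL1 μ (inducedSubspace τ R : Set M) ∧
    ∃ (hD : RelativelyContinuous δ (R : Set D))
      (hM : RelativelyContinuous μ (inducedSubspace τ R : Set M)) (hX : HasCrossedModule γ)
      (Φ : CrossedProduct α →⋆ₙₐ[ℂ] adjointableEnd (CrossedProduct β) (CrossedModule hX)),
      IsInduced γ α φ hX Φ ∧
      Nonempty (UnitaryEquiv (CrossedProduct β) (F hM) (Tensor (F hD) Φ)) := by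
  have h := isTensorModel_actionBilin hd
  have hR' := dense_inducedSubspace hτ hR
  have hR1' := relativelyL1_inducedSubspace hτ heq hR1
  refine ⟨hR', hR1', hR1.relativelyContinuous δ hR, hR1'.relativelyContinuous μ hR',
    hasCrossedModule γ, induced h hφ _, isInduced_induced h hφ _, ?_⟩
  have hT := isTensorModel_tensorF h hτ hφ heq (hR1.relativelyContinuous δ hR)
    (hR1'.relativelyContinuous μ hR') (hasCrossedModule γ)
  exact nonempty_unitaryEquiv (tensorPre (induced h hφ _)) (TensorProduct.lift _)
    hT.ip_lift hT.denseRange_lift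

end Induction

section Dual

variable {G B E : Type*} [Group G] [TopologicalSpace G] [NonUnitalCStarAlgebra B]
  [NormedAddCommGroup E] [NormedSpace ℂ E] [HilbertModule B E] {β : CStarAction G B}

/-! ### The dual module -/

variable (B E) in
/-- The bilinear map `(ξ, η⋆) ↦ |ξ⟩⟨η|`. -/
noncomputable def rankOneBilin : E →ₗ[ℂ] Conj E →ₗ[ℂ] Compacts B E :=
  LinearMap.mk₂ ℂ (fun ξ η => rankOneK ξ η.out)
    (fun ξ ξ' η => Compacts.ext (rankOne_add_left ξ ξ' η.out))
    (fun c ξ η => Compacts.ext (rankOne_smul_left c ξ η.out))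
    (fun ξ η η' => Compacts.ext (rankOne_add_right ξ η.out η'.out))
    (fun c ξ η => Compacts.ext <| by
      have := rankOne_smul_right (B := B) (star c) ξ η.out
      rw [star_star] at this
      exact this)

theorem rankOne_mul_rankOne (ξ η ξ' η' : E) :
    rankOne B ξ η * rankOne B ξ' η' = rankOne B (ract ξ (ip η ξ' : B)) η' :=
  end_ext fun x y => by
    change (ip x (ract ξ (ip η (ract ξ' (ip η' y : B)) : B)) : B) =
      ip x (ract (ract ξ (ip η ξ' : B)) (ip η' y : B))
    rw [ip_ract η, ract_mul]

/-- Products and adjoints of rank one operators are again rank one, so K(E) is their closed linear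
span. -/
theorem adjoin_rankOne_le : (NonUnitalStarAlgebra.adjoin ℂ
    {T : adjointableEnd B E | ∃ ξ η : E, T = rankOne B ξ η} : Set (adjointableEnd B E)) ⊆
    Submodule.span ℂ {T : adjointableEnd B E | ∃ ξ η : E, T = rankOne B ξ η} := by
  intro T hT
  induction hT using NonUnitalStarAlgebra.adjoin_induction with
  | mem T hT => exact Submodule.subset_span hT
  | add S T _ _ hS hT => exact add_mem hS hT
  | zero => exact zero_mem _
  | mul S T _ _ hS hT =>
    refine Submodule.span_induction₂ (p := fun S T _ _ => S * T ∈
      Submodule.span ℂ {T : adjointableEnd B E | ∃ ξ η : E, T = rankOne B ξ η})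
      ?_ ?_ ?_ ?_ ?_ ?_ ?_ hS hT
    · rintro _ _ ⟨ξ, η, rfl⟩ ⟨ξ', η', rfl⟩
      rw [rankOne_mul_rankOne]
      exact Submodule.subset_span ⟨_, _, rfl⟩
    · intro T _; rw [zero_mul]; exact zero_mem _
    · intro T _; rw [mul_zero]; exact zero_mem _
    · intro S S' T _ _ _ h h'; rw [add_mul]; exact add_mem h h'
    · intro S T T' _ _ _ h h'; rw [mul_add]; exact add_mem h h'
    · intro c S T _ _ h; rw [smul_mul_assoc]; exact Submodule.smul_mem _ c h
    · intro c S T _ _ h; rw [mul_smul_comm]; exact Submodule.smul_mem _ c h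
  | smul c T _ hT => exact Submodule.smul_mem _ c hT
  | star T hm hT =>
    clear hm
    induction hT using Submodule.span_induction with
    | mem T hT =>
      obtain ⟨ξ, η, rfl⟩ := hT
      rw [star_rankOne]
      exact Submodule.subset_span ⟨_, _, rfl⟩
    | zero => rw [star_zero]; exact zero_mem _
    | add S T _ _ hS hT => rw [star_add]; exact add_mem hS hT
    | smul c T _ hT => rw [star_smul]; exact Submodule.smul_mem _ _ hT

/-- E ⊗_B E⋆ = K(E), because (|ξ⟩⟨η|)⋆ |ξ'⟩⟨η'| = |η⟨ξ, ξ'⟩⟩⟨η'|. Density is that of the span of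
rank one operators; fullness of E plays no role. -/
theorem isTensorModel_rankOneBilin : IsTensorModel (dualLeft B E) (rankOneBilin B E) where
  ip_eq ξ η ξ' η' := Compacts.ext <| by
    change star (rankOne B ξ η.out) * rankOne B ξ' η'.out =
      rankOne B η.out (ract η'.out (star (ip ξ ξ' : B)))
    rw [star_rankOne, rankOne_mul_rankOne, star_ip]
    refine end_ext fun x y => ?_
    change (ip x (ract (ract η.out (ip ξ ξ' : B)) (ip η'.out y : B)) : B) =
      ip x (ract η.out (ip (ract η'.out (ip ξ' ξ : B)) y : B))
    rw [ip_ract_left, star_ip, ract_mul]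
  dense := fun T => by
    refine Metric.mem_closure_iff.2 fun ε hε => ?_
    have hT : T.op ∈ compacts B E := T.2
    obtain ⟨Q, hQ, hTQ⟩ := Metric.mem_closure_iff.1 hT ε hε
    let ι : Compacts B E →ₗ[ℂ] adjointableEnd B E :=
      { toFun := Compacts.op
        map_add' := fun _ _ => rfl
        map_smul' := fun _ _ => rfl }
    have hle : Submodule.span ℂ {T : adjointableEnd B E | ∃ ξ η : E, T = rankOne B ξ η} ≤
        (Submodule.span ℂ {z | ∃ x y, z = rankOneBilin B E x y}).map ι := by
      refine Submodule.span_le.2 ?_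
      rintro _ ⟨ξ, η, rfl⟩
      exact ⟨rankOneK ξ η, Submodule.subset_span ⟨ξ, Conj.mk η, rfl⟩, rfl⟩
    obtain ⟨W, hW, rfl⟩ := hle (adjoin_rankOne_le hQ)
    exact ⟨W, hW, hTQ⟩

/-- The left action of B on E⋆ is nondegenerate because E B is dense in E. -/
theorem dense_span_dualLeft : Dense (Submodule.span ℂ
    {x : Conj E | ∃ (b : B) (ξ : Conj E), x = (dualLeft B E b).1 ξ} : Set (Conj E)) := fun x =>
  Metric.mem_closure_iff.2 fun ε hε => by
    obtain ⟨b, hb⟩ := exists_ract_near B x.out hε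
    refine ⟨Conj.mk (ract x.out b), Submodule.subset_span ⟨star b, x, ?_⟩, ?_⟩
    · change Conj.mk (ract x.out b) = Conj.mk (ract x.out (star (star b)))
      rw [star_star]
    · rw [dist_eq_norm]; exact hb

theorem dualLeft_equivariant (γ : ModuleAction β E) (t : G) (b : B) :
    dualLeft B E (β.toFun t b) = adHom (dualAction γ) t (dualLeft B E b) :=
  Subtype.ext <| ContinuousLinearMap.ext fun ξ => by
    change ract ξ.out (star (β.toFun t b)) = γ.toFun t (ract (γ.toFun t⁻¹ ξ.out) (star b))
    rw [γ.map_ract, action_inv, map_star]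

end Dual

end HilbertModule

theorem lemma4p4
    {G : Type*} [Group G] [TopologicalSpace G] [IsTopologicalGroup G] [LocallyCompactSpace G]
    [T2Space G] [MeasurableSpace G] [BorelSpace G]
    {B E : Type*} [NonUnitalCStarAlgebra B] [NormedAddCommGroup E] [NormedSpace ℂ E]
    [HilbertModule B E] (β : CStarAction G B) (γ : ModuleAction β E) :
    (∀ R : Submodule ℂ E, Dense (R : Set E) → RelativelyL1 γ (R : Set E) →
      let RK : Submodule ℂ (Compacts B E) :=
        Submodule.span ℂ {T | ∃ ξ ∈ R, ∃ η : E, T = rankOneK ξ η}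
      Dense (RK : Set (Compacts B E)) ∧
      RelativelyL1 (adAction γ).self (RK : Set (Compacts B E)) ∧
      ∃ (hE : RelativelyContinuous γ (R : Set E))
        (hK : RelativelyContinuous (adAction γ).self (RK : Set (Compacts B E)))
        (hX : HasCrossedModule (dualAction γ))
        (Φ : CrossedProduct β →⋆ₙₐ[ℂ]
          adjointableEnd (CrossedProduct (adAction γ)) (CrossedModule hX)),
        IsInduced (dualAction γ) β (dualLeft B E) hX Φ ∧
        Nonempty (UnitaryEquiv (CrossedProduct (adAction γ)) (F hK) (Tensor (F hE) Φ))) ∧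
    (∀ {A : Type*} [NonUnitalCStarAlgebra A] (α : CStarAction G A)
      (φ : A →⋆ₙₐ[ℂ] adjointableEnd B E),
      Dense (Submodule.span ℂ {x : E | ∃ (a : A) (ξ : E), x = (φ a).1 ξ} : Set E) →
      (∀ (t : G) (a : A), φ (α.toFun t a) = adHom γ t (φ a)) →
      ∀ R : Submodule ℂ A, Dense (R : Set A) → RelativelyL1 α.self (R : Set A) →
      let RE : Submodule ℂ E := Submodule.span ℂ {x | ∃ a ∈ R, ∃ ξ : E, x = (φ a).1 ξ}
      Dense (RE : Set E) ∧
      RelativelyL1 γ (RE : Set E) ∧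
      ∃ (hA : RelativelyContinuous α.self (R : Set A))
        (hE : RelativelyContinuous γ (RE : Set E))
        (hX : HasCrossedModule γ)
        (Φ : CrossedProduct α →⋆ₙₐ[ℂ] adjointableEnd (CrossedProduct β) (CrossedModule hX)),
        IsInduced γ α φ hX Φ ∧
        Nonempty (UnitaryEquiv (CrossedProduct β) (F hE) (Tensor (F hA) Φ))) := by
  refine ⟨fun R hR hR1 => ?_, fun {A} _ α φ hd hφ R hR hR1 => ?_⟩
  -- The case D = E over B, with B acting on E⋆ from the left and tensor product K(E).
  · exact exists_unitaryEquiv_induced (τ := rankOneBilin B E) (μ := (adAction γ).self)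
      dense_span_dualLeft (dualLeft_equivariant γ) isTensorModel_rankOneBilin
      (fun t ξ η => Compacts.ext (adHom_rankOne γ t ξ η.out)) hR hR1
  -- The case D = A, where A ⊗_φ E is E itself; equivariance of (a, e) ↦ φ(a)e is that of φ.
  · refine exists_unitaryEquiv_induced (τ := actionBilin φ) (δ := α.self) (μ := γ) hd hφ
      (isTensorModel_actionBilin hd) (fun t a e => ?_) hR hR1
    change γ.toFun t ((φ a).1 e) = (φ (α.toFun t a)).1 (γ.toFun t e)
    rw [hφ]
    change _ = γ.toFun t ((φ a).1 (γ.toFun t⁻¹ (γ.toFun t e)))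
    rw [inv_action]
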